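/- Let $n\ge 1$. For a (possibly disconnected) complex reductive group $\Gamma$ let $$\mathcal Y(\Gamma)_{\mathrm{ell}}=\{(s,h)\in\Gamma\times\Gamma\mid s,h\text{ semisimple},\ sh=hs,\ Z_\Gamma(s)\cap Z_\Gamma(h)\text{ finite}\}$$ be the set of elliptic pairs, on which $\Gamma$ acts by simultaneous conjugation; the flip $(s,h)\mapsto(h,s)$ induces an involution of the set of orbits. For a unipotent $u\in\mathrm{PGL}_n(\mathbb C)$ let $\Gamma_u$ be a reductive part of its centralizer $Z(u)$, i.e. a Zariski-closed subgroup of $Z(u)$ with $Z(u)=\Gamma_u\ltimes R_u(Z(u))$, where $R_u(Z(u))$ is the unipotent radical; such a $\Gamma_u$ exists. Let $\lambda$ be the partition of $n$ formed by the sizes of the Jordan blocks of $u$. Write $\Delta_m(z)$ for the class of $\mathrm{diag}(1,z,\dots,z^{m-1})$ in $\mathrm{PGL}_m(\mathbb C)$, put $s_m=\Delta_m(\zeta_m)$ for a primitive $m$-th root of unity $\zeta_m$, and let $\dot w_m\in\mathrm{PGL}_m(\mathbb C)$ be the class of the permutation matrix of the $m$-cycle $(1,2,\dots,m)$. (1)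 One has $$\mathcal Y(\mathrm{PGL}_n(\mathbb C))_{\mathrm{ell}}=\bigsqcup_{k\in(\mathbb Z/n\mathbb Z)^\times}\mathrm{PGL}_n(\mathbb C)\cdot(s_n,\dot w_n^k).$$ In particular there are $\varphi(n)$ orbits of elliptic pairs, and the flip sends the orbit of $(s_n,\dot w_n^k)$ to the orbit of $(s_n,\dot w_n^{-k})$. (2) Let $u\in\mathrm{PGL}_n(\mathbb C)$ be unipotent with partition $\lambda$. Then $\mathcal Y(\Gamma_u)_{\mathrm{ell}}\ne\emptyset$ if and only if $\lambda$ is rectangular, i.e. $\lambda=(i,\dots,i)$ with $r$ equal parts for some $i,r$. In this case, in a suitable basis of $\mathbb C^n$, $\Gamma_u$ is the image in $\mathrm{PGL}_n(\mathbb C)$ of $\mathrm{GL}_r(\mathbb C)$ embedded diagonally in $\mathrm{GL}_r(\mathbb C)^i\subset\mathrm{GL}_n(\mathbb C)$. The embedding induces an isomorphism $\mathrm{PGL}_r(\mathbb C)\cong\Gamma_u$, through which $\mathcal Y(\Gamma_u)_{\mathrm{ell}}$, its orbits and the flip are described as in (1) with $r$ in place of $n$. (3) There are finitely many unipotent conjugacy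 classes in $\mathrm{PGL}_n(\mathbb C)$, the set of orbits $\Gamma_u\backslash\mathcal Y(\Gamma_u)_{\mathrm{ell}}$ is finite for each unipotent $u$, and $$\sum_{u}\bigl|\Gamma_u\backslash\mathcal Y(\Gamma_u)_{\mathrm{ell}}\bigr|=n,$$ where $u$ runs over representatives of the unipotent conjugacy classes. -/

import Mathlib

open scoped MatrixGroups

noncomputable section

namespace EllipticPGL

/-! ### Elements and closed subsets of `PGL_n(ℂ)` -/

/-- An element of `PGL_n(ℂ)` is unipotent if it is the image of a unipotent matrix. -/
def IsUnipotentElt {n : ℕ} (x : PGL(n, ℂ)) : Prop :=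
  ∃ g : GL (Fin n) ℂ, Matrix.ProjGenLinGroup.mk g = x ∧
    IsNilpotent ((g : Matrix (Fin n) (Fin n) ℂ) - 1)

/-- An element of `PGL_n(ℂ)` is semisimple if it is the image of a semisimple
(that is, diagonalizable) matrix. -/
def IsSemisimpleElt {n : ℕ} (x : PGL(n, ℂ)) : Prop :=
  ∃ g : GL (Fin n) ℂ, Matrix.ProjGenLinGroup.mk g = x ∧
    Module.End.IsSemisimple (Matrix.toLin' (g : Matrix (Fin n) (Fin n) ℂ))

/-- Zariski-closed subsets of `PGL_n(ℂ)`: the preimage in `GL_n(ℂ)` is the zero locus of a set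
of polynomials in the matrix entries. -/
def IsZariskiClosed {n : ℕ} (S : Set PGL(n, ℂ)) : Prop :=
  ∃ I : Set (MvPolynomial (Fin n × Fin n) ℂ), ∀ g : GL (Fin n) ℂ,
    Matrix.ProjGenLinGroup.mk g ∈ S ↔
      ∀ p ∈ I, MvPolynomial.eval
        (fun ij : Fin n × Fin n => (g : Matrix (Fin n) (Fin n) ℂ) ij.1 ij.2) p = 0

/-! ### The reductive part of the centralizer of a unipotent element -/

/-- `R` is the unipotent radical of `Z`: the largest closed normal unipotent subgroup of `Z`
(in characteristic zero closed unipotent subgroups are automatically connected). -/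
def IsUnipotentRadical {n : ℕ} (Z R : Subgroup PGL(n, ℂ)) : Prop :=
  IsGreatest {U : Subgroup PGL(n, ℂ) | U ≤ Z ∧ (U.subgroupOf Z).Normal ∧
    IsZariskiClosed (U : Set PGL(n, ℂ)) ∧ ∀ x ∈ U, IsUnipotentElt x} R

/-- `Γ` is a reductive part `Γ_u` of the centralizer `Z(u)` of `u` in `PGL_n(ℂ)`: a closed
subgroup of `Z(u)` which is a complement to the unipotent radical, so that
`Z(u) = Γ ⋉ R_u(Z(u))`. It is determined by `u` only up to conjugation in `Z(u)`. -/
def IsReductivePart {n : ℕ} (u : PGL(n, ℂ)) (Γ : Subgroup PGL(n, ℂ)) : Prop :=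
  IsZariskiClosed (Γ : Set PGL(n, ℂ)) ∧
    ∃ R : Subgroup PGL(n, ℂ), IsUnipotentRadical (Subgroup.centralizer {u}) R ∧
      Γ ⊓ R = ⊥ ∧ Γ ⊔ R = Subgroup.centralizer {u}

/-! ### The partition of a unipotent element -/

/-- The unipotent upper triangular Jordan block of size `m`. -/
def jordanBlock (m : ℕ) : Matrix (Fin m) (Fin m) ℂ :=
  Matrix.of fun i j => if i = j ∨ (i : ℕ) + 1 = j then 1 else 0

/-- `u ∈ PGL_n(ℂ)` is represented by a matrix whose Jordan canonical form has only the
eigenvalue `1` and whose Jordan blocks have the parts of `p` as sizes. -/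
def HasJordanType {n : ℕ} (u : PGL(n, ℂ)) (p : n.Partition) : Prop :=
  ∃ (m : ℕ) (a : Fin m → ℕ) (e : (Σ j : Fin m, Fin (a j)) ≃ Fin n) (P g : GL (Fin n) ℂ),
    Multiset.map a Finset.univ.val = p.parts ∧
    (g : Matrix (Fin n) (Fin n) ℂ) =
      (P : Matrix (Fin n) (Fin n) ℂ) *
        Matrix.reindex e e (Matrix.blockDiagonal' fun j => jordanBlock (a j)) *
        ((P⁻¹ : GL (Fin n) ℂ) : Matrix (Fin n) (Fin n) ℂ) ∧
    u = Matrix.ProjGenLinGroup.mk g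

/-- The diagonal embedding `A ↦ diag(A, …, A)` (`i` copies) of `GL_r(ℂ)` into `GL_n(ℂ)`, where
`n = r i`, with respect to a labelling `e` of the basis vectors. -/
def diagEmb {n r i : ℕ} (e : Fin r × Fin i ≃ Fin n) : GL (Fin r) ℂ →* GL (Fin n) ℂ :=
  Units.map ((Matrix.reindexRingEquiv ℂ e).toRingHom.comp
    ((Matrix.blockDiagonalRingHom (Fin r) (Fin i) ℂ).comp
      (Pi.constRingHom (Fin i) (Matrix (Fin r) (Fin r) ℂ)))).toMonoidHom

/-! ### Elliptic pairs -/

/-- The set of elliptic pairs of a group `H`, where `ss` is the predicate of being semisimple. -/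
def ellipticPairs {H : Type*} [Group H] (ss : H → Prop) : Set (H × H) :=
  {x | ss x.1 ∧ ss x.2 ∧ x.1 * x.2 = x.2 * x.1 ∧
    (Subgroup.centralizer {x.1, x.2} : Set H).Finite}

/-- `Y(PGL_n(ℂ))_ell`. -/
def ellPGL (n : ℕ) : Set (PGL(n, ℂ) × PGL(n, ℂ)) :=
  ellipticPairs IsSemisimpleElt

/-- `Y(Γ)_ell` for a subgroup `Γ` of `PGL_n(ℂ)`. -/
def ellSub {n : ℕ} (Γ : Subgroup PGL(n, ℂ)) : Set (Γ × Γ) :=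
  ellipticPairs fun x : Γ => IsSemisimpleElt (x : PGL(n, ℂ))

/-- The orbit of a pair under simultaneous conjugation. -/
def pairOrbit {H : Type*} [Group H] (x : H × H) : Set (H × H) :=
  MulAction.orbit (ConjAct H) x

/-- The set of orbits, under simultaneous conjugation, of the elements of `Y`. -/
def pairOrbits {H : Type*} [Group H] (Y : Set (H × H)) : Set (Set (H × H)) :=
  pairOrbit '' Y

/-- `Δ_n(z)`, the class of `diag(1, z, …, z^{n-1})`. -/
def Delta (n : ℕ) (z : ℂˣ) : PGL(n, ℂ) :=
  Matrix.ProjGenLinGroup.mk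
    (Units.map (Matrix.diagonalRingHom (Fin n) ℂ).toMonoidHom
      (MulEquiv.piUnits.symm fun j : Fin n => z ^ (j : ℕ)))

/-- The class of the permutation matrix of the `n`-cycle `j ↦ j + 1`, which maps the basis
vector `e_j` to `e_{j+1}` (in Mathlib, `σ.permMatrix` maps `e_j` to `e_{σ⁻¹ j}`). -/
def wdot (n : ℕ) : PGL(n, ℂ) :=
  Matrix.ProjGenLinGroup.mk
    (Matrix.GeneralLinearGroup.mkOfDetNeZero (((finRotate n)⁻¹).permMatrix ℂ) (by
      rw [Matrix.det_permutation]
      exact_mod_cast (Equiv.Perm.sign (finRotate n)⁻¹).ne_zero))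

/-- The set `Y` of pairs is the disjoint union of the orbits of `(s, w ^ k)`,
`k ∈ (ℤ/mℤ)ˣ`; there are `φ(m)` orbits; and the flip `(x, y) ↦ (y, x)` maps the orbit of
`(s, w ^ k)` to the orbit of `(s, w ^ (-k))`. -/
structure IsStandardUnion {H : Type*} [Group H] (Y : Set (H × H)) (m : ℕ) (s w : H) :
    Prop where
  eq_iUnion : Y = ⋃ k : (ZMod m)ˣ, pairOrbit (s, w ^ (k : ZMod m).val)
  disjoint : Pairwise fun k l : (ZMod m)ˣ =>
    Disjoint (pairOrbit (s, w ^ (k : ZMod m).val)) (pairOrbit (s, w ^ (l : ZMod m).val))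
  card_orbits : (pairOrbits Y).Finite ∧ (pairOrbits Y).ncard = Nat.totient m
  flip : ∀ k : (ZMod m)ˣ, Prod.swap '' pairOrbit (s, w ^ (k : ZMod m).val) =
    pairOrbit (s, w ^ ((-k : (ZMod m)ˣ) : ZMod m).val)

/-- The unipotent conjugacy classes of `PGL_n(ℂ)`. -/
def UnipotentClass (n : ℕ) : Type :=
  {c : ConjClasses PGL(n, ℂ) // ∃ u, IsUnipotentElt u ∧ ConjClasses.mk u = c}

end EllipticPGL

end

/-! Two elements of `PGL_n` commute iff their lifts commute up to a scalar `ω`, an `n`-th root of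
unity. The common centralizer of the pair is finite iff the lifts have no common invariant
subspace, iff `ω` is primitive, and then `ω` determines the pair up to conjugacy: an eigenvector of
one lift is moved by the other through a basis in which both have standard form.

For a unipotent `u` with `m_k` Jordan blocks of size `k`, the centralizer algebra of `u`
is a split extension of `∏ₖ M_{m_k}` by a nil ideal, so `Γ_u` is isomorphic to the image of
`∏ₖ GL_{m_k}`. Its centre is infinite unless only one size occurs, which forces the partition to
be rectangular. In the rectangular case, by averaging, any complement contains a conjugate of a
fixed finite group of signed permutation matrices, and this forces it to be the corresponding
conjugate of the diagonal `PGL_r`. A rectangular partition of `n` is a divisor `r` of `n`, and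
`∑ φ(r) = n` over these divisors. -/

namespace EllipticPGL

open Matrix Matrix.ProjGenLinGroup
open scoped commutatorElement

/-! ### Pairs of elements with scalar commutator -/

section Representatives

variable {ι R : Type*} [Fintype ι] [DecidableEq ι] [CommRing R]

theorem coe_scalar_mul (c : Rˣ) (g : GL ι R) :
    (GeneralLinearGroup.scalar ι c * g).1 = (c : R) • g.1 := by
  rw [Units.val_mul, GeneralLinearGroup.coe_scalar, scalar_apply, smul_eq_diagonal_mul]

theorem mk_eq_mk_iff_smul {g h : GL ι R} : mk g = mk h ↔ ∃ c : Rˣ, h.1 = (c : R) • g.1 := by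
  rw [mk_eq_mk_iff]
  refine exists_congr fun c => ?_
  rw [← GeneralLinearGroup.scalar_commute, Units.ext_iff, coe_scalar_mul, eq_comm]

theorem mk_eq_one_iff_smul {g : GL ι R} : mk g = 1 ↔ ∃ c : Rˣ, g.1 = (c : R) • 1 := by
  rw [eq_comm, ← map_one mk, mk_eq_mk_iff_smul, Units.val_one]

theorem mk_eq_one_of_eq_smul_one {K : Type*} [Field K] [Nonempty ι] {g : GL ι K} {c : K}
    (h : g.1 = c • 1) : mk g = 1 := by
  have hc : c ≠ 0 := by
    rintro rfl
    exact g.ne_zero (by rw [h, zero_smul])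
  exact mk_eq_one_iff_smul.2 ⟨Units.mk0 c hc, h⟩

end Representatives

section Commutator

variable {ι R : Type*} [Fintype ι] [DecidableEq ι] [CommRing R]

/-- The commutator in `GL` of representatives of `x` and `y` is the scalar `ω`. This does not depend
on the representatives, and such an `ω` exists exactly if `x` and `y` commute. -/
def HasCommutator (x y : PGL(ι, R)) (ω : Rˣ) : Prop :=
  ∃ X Y : GL ι R, mk X = x ∧ mk Y = y ∧ ⁅X, Y⁆ = GeneralLinearGroup.scalar ι ω

theorem commutatorElement_eq_scalar_iff {X Y : GL ι R} {ω : Rˣ} :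
    ⁅X, Y⁆ = GeneralLinearGroup.scalar ι ω ↔ X.1 * Y.1 = (ω : R) • (Y.1 * X.1) := by
  rw [commutatorElement_def, mul_inv_eq_iff_eq_mul, mul_inv_eq_iff_eq_mul, mul_assoc, Units.ext_iff,
    coe_scalar_mul, Units.val_mul, Units.val_mul]

theorem hasCommutator_mk_iff {X Y : GL ι R} {ω : Rˣ} :
    HasCommutator (mk X) (mk Y) ω ↔ X.1 * Y.1 = (ω : R) • (Y.1 * X.1) := by
  refine ⟨?_, fun h => ⟨X, Y, rfl, rfl, commutatorElement_eq_scalar_iff.2 h⟩⟩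
  rintro ⟨X', Y', hX, hY, h⟩
  obtain ⟨a, ha⟩ := mk_eq_mk_iff_smul.1 hX
  obtain ⟨b, hb⟩ := mk_eq_mk_iff_smul.1 hY
  rw [ha, hb, smul_mul_smul_comm, smul_mul_smul_comm, commutatorElement_eq_scalar_iff.1 h,
    smul_comm, mul_comm (b : R)]

theorem exists_hasCommutator_iff {x y : PGL(ι, R)} :
    (∃ ω, HasCommutator x y ω) ↔ Commute x y := by
  obtain ⟨X, rfl⟩ := mk_surjective x
  obtain ⟨Y, rfl⟩ := mk_surjective y
  simp only [hasCommutator_mk_iff]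
  rw [commute_iff_eq, eq_comm, ← map_mul, ← map_mul, mk_eq_mk_iff_smul, Units.val_mul,
    Units.val_mul]

theorem hasCommutator_mk_one_iff {X Y : GL ι R} :
    HasCommutator (mk X) (mk Y) 1 ↔ Commute X.1 Y.1 := by
  rw [hasCommutator_mk_iff, Units.val_one, one_smul, commute_iff_eq]

theorem hasCommutator_self (x : PGL(ι, R)) : HasCommutator x x 1 := by
  obtain ⟨X, rfl⟩ := mk_surjective x
  exact hasCommutator_mk_one_iff.2 (Commute.refl _)

theorem HasCommutator.swap {x y : PGL(ι, R)} {ω : Rˣ} (h : HasCommutator x y ω) :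
    HasCommutator y x ω⁻¹ := by
  obtain ⟨X, Y, hX, hY, h⟩ := h
  exact ⟨Y, X, hY, hX, by rw [← commutatorElement_inv, h, map_inv]⟩

theorem HasCommutator.mul_right {x y z : PGL(ι, R)} {a b : Rˣ} (hy : HasCommutator x y a)
    (hz : HasCommutator x z b) : HasCommutator x (y * z) (a * b) := by
  obtain ⟨X, rfl⟩ := mk_surjective x
  obtain ⟨Y, rfl⟩ := mk_surjective y
  obtain ⟨Z, rfl⟩ := mk_surjective z
  rw [← map_mul, hasCommutator_mk_iff] at *
  rw [Units.val_mul, ← mul_assoc, hy, smul_mul_assoc, mul_assoc, hz, mul_smul_comm, smul_smul,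
    mul_assoc, Units.val_mul]

theorem HasCommutator.inv_right {x y : PGL(ι, R)} {ω : Rˣ} (h : HasCommutator x y ω) :
    HasCommutator x y⁻¹ ω⁻¹ := by
  obtain ⟨X, Y, hX, hY, h⟩ := h
  refine ⟨X, Y⁻¹, hX, by rw [map_inv, hY], ?_⟩
  rw [commutatorElement_inv_right, ← commutatorElement_inv, h, ← map_inv, mul_assoc,
    GeneralLinearGroup.scalar_commute, inv_mul_cancel_left]

theorem HasCommutator.pow_right {x y : PGL(ι, R)} {ω : Rˣ} (h : HasCommutator x y ω) (k : ℕ) :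
    HasCommutator x (y ^ k) (ω ^ k) := by
  induction k with
  | zero =>
    obtain ⟨X, rfl⟩ := mk_surjective x
    rw [pow_zero, pow_zero, ← map_one mk, hasCommutator_mk_one_iff]
    exact Commute.one_right _
  | succ k ih => simpa only [pow_succ] using ih.mul_right h

theorem HasCommutator.conj {x y : PGL(ι, R)} {ω : Rˣ} (h : HasCommutator x y ω)
    (q : PGL(ι, R)) : HasCommutator (q * x * q⁻¹) (q * y * q⁻¹) ω := by
  obtain ⟨X, Y, rfl, rfl, h⟩ := h
  obtain ⟨Q, rfl⟩ := mk_surjective q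
  refine ⟨Q * X * Q⁻¹, Q * Y * Q⁻¹, by simp, by simp, ?_⟩
  rw [← conjugate_commutatorElement, h, ← GeneralLinearGroup.scalar_commute, mul_inv_cancel_right]

theorem HasCommutator.pow_card_eq_one {x y : PGL(ι, R)} {ω : Rˣ} (h : HasCommutator x y ω) :
    ω ^ Fintype.card ι = 1 := by
  obtain ⟨X, Y, -, -, h⟩ := h
  rw [← GeneralLinearGroup.det_scalar, ← h, map_commutatorElement, (Commute.all _ _).commutator_eq]

variable {K : Type*} [Field K]

theorem HasCommutator.unique [Nonempty ι] {x y : PGL(ι, K)} {ω ω' : Kˣ}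
    (h : HasCommutator x y ω) (h' : HasCommutator x y ω') : ω = ω' := by
  obtain ⟨X, rfl⟩ := mk_surjective x
  obtain ⟨Y, rfl⟩ := mk_surjective y
  rw [hasCommutator_mk_iff] at h h'
  exact Units.ext (smul_left_injective K (Y * X).ne_zero (h.symm.trans h'))

end Commutator

section IrreduciblePairs

variable {ι K : Type*} [Fintype ι] [DecidableEq ι] [Field K]

/-- The matrices `X` and `Y` act irreducibly on the space of column vectors: a subspace stable under
both is trivial. -/
def IsIrreduciblePair (X Y : Matrix ι ι K) : Prop :=
  ∀ W ∈ Module.End.invtSubmodule (toLin' X), W ∈ Module.End.invtSubmodule (toLin' Y) → W = ⊥ ∨ W = ⊤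

theorem eigenspace_mem_invtSubmodule_of_commute {X Z : Matrix ι ι K} (h : Commute X Z) (c : K) :
    Module.End.eigenspace (toLin' Z) c ∈ Module.End.invtSubmodule (toLin' X) := by
  rw [Module.End.mem_invtSubmodule_iff_forall_mem_of_mem]
  intro v hv
  rw [Module.End.mem_eigenspace_iff, toLin'_apply] at hv ⊢
  rw [toLin'_apply, mulVec_mulVec, ← h.eq, ← mulVec_mulVec, hv, mulVec_smul]

theorem IsIrreduciblePair.eq_smul_one_of_commute [Nonempty ι] [IsAlgClosed K]
    {X Y Z : Matrix ι ι K} (h : IsIrreduciblePair X Y) (hX : Commute X Z) (hY : Commute Y Z) :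
    ∃ c : K, Z = c • 1 := by
  obtain ⟨c, hc⟩ := Module.End.exists_eigenvalue (toLin' Z)
  have htop : Module.End.eigenspace (toLin' Z) c = ⊤ :=
    (h _ (eigenspace_mem_invtSubmodule_of_commute hX c)
      (eigenspace_mem_invtSubmodule_of_commute hY c)).resolve_left hc
  refine ⟨c, toLin'.injective (LinearMap.ext fun v => ?_)⟩
  rw [Module.End.mem_eigenspace_iff.1 (htop ▸ Submodule.mem_top : v ∈ _), map_smul, toLin'_one,
    LinearMap.smul_apply, LinearMap.id_apply]

theorem exists_eigenvector_mem [IsAlgClosed K] {X : Matrix ι ι K} {W : Submodule K (ι → K)}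
    (hW : W ∈ Module.End.invtSubmodule (toLin' X)) (hW0 : W ≠ ⊥) :
    ∃ (μ : K) (v : ι → K), v ∈ W ∧ v ≠ 0 ∧ X *ᵥ v = μ • v := by
  have := Submodule.nontrivial_iff_ne_bot.2 hW0
  obtain ⟨μ, hμ⟩ := Module.End.exists_eigenvalue ((toLin' X).restrict hW)
  obtain ⟨v, hv⟩ := hμ.exists_hasEigenvector
  exact ⟨μ, v, v.2, by simpa using hv.2, congrArg Subtype.val hv.apply_eq_smul⟩

theorem mulVec_pow_mulVec {X Y : Matrix ι ι K} {ω μ : K} (h : X * Y = ω • (Y * X)) {v : ι → K}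
    (hv : X *ᵥ v = μ • v) (k : ℕ) : X *ᵥ (Y ^ k *ᵥ v) = (ω ^ k * μ) • (Y ^ k *ᵥ v) := by
  induction k with
  | zero => simpa using hv
  | succ k ih =>
    rw [pow_succ', ← mulVec_mulVec, mulVec_mulVec, h, smul_mulVec, ← mulVec_mulVec, ih, mulVec_smul,
      smul_smul, pow_succ', mul_assoc]

theorem mulVec_ne_zero (Y : GL ι K) {v : ι → K} (hv : v ≠ 0) : Y.1 *ᵥ v ≠ 0 := fun h =>
  hv (mulVec_injective_of_isUnit Y.isUnit (h.trans (mulVec_zero _).symm))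

theorem linearIndependent_pow_mulVec {X Y : GL ι K} {ω : K} {m : ℕ} (hω : IsPrimitiveRoot ω m)
    (h : X.1 * Y.1 = ω • (Y.1 * X.1)) {μ : K} {v : ι → K} (hv0 : v ≠ 0)
    (hv : X.1 *ᵥ v = μ • v) : LinearIndependent K fun j : Fin m => Y.1 ^ (j : ℕ) *ᵥ v := by
  have hμ : μ ≠ 0 := by
    rintro rfl
    exact mulVec_ne_zero X hv0 (by rw [hv, zero_smul])
  refine Module.End.eigenvectors_linearIndependent' (toLin' X.1) (fun j : Fin m => ω ^ (j : ℕ) * μ)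
    (fun i j hij => Fin.ext (hω.pow_inj i.2 j.2 (mul_right_cancel₀ hμ hij))) _ fun j => ⟨?_, ?_⟩
  · rw [Module.End.mem_eigenspace_iff, toLin'_apply, mulVec_pow_mulVec h hv]
  · rw [← Units.val_pow_eq_pow_val]
    exact mulVec_ne_zero _ hv0

theorem pow_mulVec_mem {Y : Matrix ι ι K} {W : Submodule K (ι → K)}
    (hW : W ∈ Module.End.invtSubmodule (toLin' Y)) {v : ι → K} (hv : v ∈ W) (j : ℕ) :
    Y ^ j *ᵥ v ∈ W := by
  induction j with
  | zero => simpa using hv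
  | succ j ih =>
    rw [pow_succ', ← mulVec_mulVec]
    exact hW ih

theorem isIrreduciblePair_of_isPrimitiveRoot [IsAlgClosed K] {X Y : GL ι K} {ω : K}
    (hω : IsPrimitiveRoot ω (Fintype.card ι)) (h : X.1 * Y.1 = ω • (Y.1 * X.1)) :
    IsIrreduciblePair X.1 Y.1 := by
  intro W hWX hWY
  refine or_iff_not_imp_left.2 fun hW0 => ?_
  obtain ⟨μ, v, hvW, hv0, hv⟩ := exists_eigenvector_mem hWX hW0
  have hspan := (linearIndependent_pow_mulVec hω h hv0 hv).span_eq_top_of_card_eq_finrank'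
    (by rw [Fintype.card_fin, Module.finrank_fintype_fun_eq_card])
  rw [eq_top_iff, ← hspan, Submodule.span_le]
  rintro _ ⟨j, rfl⟩
  exact pow_mulVec_mem hWY hvW j

theorem IsIrreduciblePair.card_le [Nonempty ι] [IsAlgClosed K] {X Y : Matrix ι ι K} {ω c : K}
    {d : ℕ} (hd : 0 < d) (hirr : IsIrreduciblePair X Y) (h : X * Y = ω • (Y * X))
    (hYd : Y ^ d = c • 1) : Fintype.card ι ≤ d := by
  obtain ⟨μ, v, -, hv0, hv⟩ :=
    exists_eigenvector_mem (Module.End.invtSubmodule.top_mem (toLin' X)) top_ne_bot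
  let W := Submodule.span K (Set.range fun b : Fin d => Y ^ (b : ℕ) *ᵥ v)
  have hmem : ∀ b < d, Y ^ b *ᵥ v ∈ W := fun b hb => Submodule.subset_span ⟨⟨b, hb⟩, rfl⟩
  have hWX : W ∈ Module.End.invtSubmodule (toLin' X) := by
    rw [Module.End.mem_invtSubmodule, Submodule.span_le]
    rintro _ ⟨b, rfl⟩
    rw [SetLike.mem_coe, Submodule.mem_comap, toLin'_apply, mulVec_pow_mulVec h hv]
    exact W.smul_mem _ (hmem b b.2)
  have hWY : W ∈ Module.End.invtSubmodule (toLin' Y) := by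
    rw [Module.End.mem_invtSubmodule, Submodule.span_le]
    rintro _ ⟨b, rfl⟩
    rw [SetLike.mem_coe, Submodule.mem_comap, toLin'_apply, mulVec_mulVec, ← pow_succ']
    rcases (Nat.succ_le_of_lt b.2).lt_or_eq with hb | hb
    · exact hmem _ hb
    · rw [← Nat.succ_eq_add_one, hb, hYd, smul_mulVec]
      simpa using W.smul_mem c (hmem 0 hd)
  have hW0 : W ≠ ⊥ := by
    rw [Submodule.ne_bot_iff]
    exact ⟨v, by simpa using hmem 0 hd, hv0⟩
  simpa using finrank_le_of_span_eq_top ((hirr W hWX hWY).resolve_left hW0)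

theorem IsIrreduciblePair.eq_one_of_hasCommutator [Nonempty ι] [IsAlgClosed K] {X Y : GL ι K}
    (hirr : IsIrreduciblePair X.1 Y.1) {z : PGL(ι, K)} (hX : HasCommutator (mk X) z 1)
    (hY : HasCommutator (mk Y) z 1) : z = 1 := by
  obtain ⟨Z, rfl⟩ := mk_surjective z
  obtain ⟨c, hc⟩ := hirr.eq_smul_one_of_commute (hasCommutator_mk_one_iff.1 hX)
    (hasCommutator_mk_one_iff.1 hY)
  exact mk_eq_one_of_eq_smul_one hc

theorem isPrimitiveRoot_of_isIrreduciblePair [Nonempty ι] [IsAlgClosed K] {X Y : GL ι K} {ω : Kˣ}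
    (hirr : IsIrreduciblePair X.1 Y.1) (h : HasCommutator (mk X) (mk Y) ω) :
    IsPrimitiveRoot ω (Fintype.card ι) := by
  have hd : orderOf ω ∣ Fintype.card ι := orderOf_dvd_of_pow_eq_one h.pow_card_eq_one
  have hd0 : 0 < orderOf ω := Nat.pos_of_dvd_of_pos hd Fintype.card_pos
  have hYd : mk Y ^ orderOf ω = 1 := hirr.eq_one_of_hasCommutator
    (by simpa only [pow_orderOf_eq_one] using h.pow_right (orderOf ω))
    (by simpa only [one_pow] using (hasCommutator_self (mk Y)).pow_right (orderOf ω))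
  obtain ⟨c, hc⟩ := mk_eq_one_iff_smul.1 ((map_pow mk Y _).trans hYd)
  have hle := hirr.card_le hd0 (hasCommutator_mk_iff.1 h) hc
  rw [← (Nat.le_of_dvd Fintype.card_pos hd).antisymm hle]
  exact IsPrimitiveRoot.orderOf ω

theorem mem_centralizer_pair {H : Type*} [Group H] {x y z : H} :
    z ∈ Subgroup.centralizer {x, y} ↔ Commute x z ∧ Commute y z := by
  simp [Subgroup.mem_centralizer_iff, commute_iff_eq]

theorem IsIrreduciblePair.finite_centralizer [Nonempty ι] [IsAlgClosed K] {X Y : GL ι K}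
    (hirr : IsIrreduciblePair X.1 Y.1) :
    (Subgroup.centralizer {mk X, mk Y} : Set PGL(ι, K)).Finite := by
  have hcomm : ∀ z : (Subgroup.centralizer {mk X, mk Y} : Subgroup PGL(ι, K)),
      ∃ ω : Kˣ × Kˣ, HasCommutator (mk X) z.1 ω.1 ∧ HasCommutator (mk Y) z.1 ω.2 := fun z =>
    have ⟨hX, hY⟩ := mem_centralizer_pair.1 z.2
    have ⟨a, ha⟩ := exists_hasCommutator_iff.2 hX
    have ⟨b, hb⟩ := exists_hasCommutator_iff.2 hY
    ⟨(a, b), ha, hb⟩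
  choose ω hωX hωY using hcomm
  let f (z : (Subgroup.centralizer {mk X, mk Y} : Subgroup PGL(ι, K))) :
      rootsOfUnity (Fintype.card ι) K × rootsOfUnity (Fintype.card ι) K :=
    (⟨(ω z).1, (hωX z).pow_card_eq_one⟩, ⟨(ω z).2, (hωY z).pow_card_eq_one⟩)
  have hf : Function.Injective f := by
    intro z z' hzz'
    have hX : (ω z).1 = (ω z').1 := congrArg Subtype.val (congrArg Prod.fst hzz')
    have hY : (ω z).2 = (ω z').2 := congrArg Subtype.val (congrArg Prod.snd hzz')
    refine Subtype.ext (mul_inv_eq_one.1 (hirr.eq_one_of_hasCommutator ?_ ?_))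
    · simpa only [hX, mul_inv_cancel] using (hωX z).mul_right (hωX z').inv_right
    · simpa only [hY, mul_inv_cancel] using (hωY z).mul_right (hωY z').inv_right
  exact Set.finite_coe_iff.1 (Finite.of_injective f hf)

end IrreduciblePairs

section FiniteCentralizer

variable {ι K : Type*} [Fintype ι] [DecidableEq ι] [Field K]

theorem exists_gl_eq_smul_one_sub {Z : Matrix ι ι K} {t : K} (ht : t ∉ spectrum K Z) :
    ∃ g : GL ι K, g.1 = t • 1 - Z := by
  obtain ⟨g, hg⟩ := spectrum.notMem_iff.1 ht
  exact ⟨g, by rw [hg, Algebra.algebraMap_eq_smul_one]⟩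

theorem eq_of_mk_smul_one_sub_eq {Z : Matrix ι ι K} (hZ : ∀ c : K, Z ≠ c • 1) {s t : K}
    {g h : GL ι K} (hg : g.1 = s • 1 - Z) (hh : h.1 = t • 1 - Z) (hgh : mk g = mk h) : s = t := by
  obtain ⟨c, hc⟩ := mk_eq_mk_iff_smul.1 hgh
  have hlin : ((c : K) - 1) • Z = ((c : K) * s - t) • (1 : Matrix ι ι K) := by
    rw [hg, hh, smul_sub, smul_smul, sub_eq_sub_iff_add_eq_add] at hc
    rw [sub_smul, sub_smul, one_smul, sub_eq_sub_iff_add_eq_add, add_comm, hc, add_comm]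
  have hc1 : (c : K) = 1 := by
    by_contra hne
    refine hZ (((c : K) - 1)⁻¹ * (c * s - t)) ?_
    rw [mul_smul, ← hlin, inv_smul_smul₀ (sub_ne_zero.2 hne)]
  rw [hc1, sub_self, zero_smul, one_mul, eq_comm, smul_eq_zero, sub_eq_zero] at hlin
  exact hlin.resolve_right fun h1 => hZ 0 (by rw [zero_smul, ← mul_one Z, h1, mul_zero])

theorem infinite_setOf_mk_smul_one_sub [Infinite K] {Z : Matrix ι ι K} (hZ : ∀ c : K, Z ≠ c • 1) :
    {x : PGL(ι, K) | ∃ (t : K) (g : GL ι K), g.1 = t • 1 - Z ∧ mk g = x}.Infinite := by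
  choose! g hg using fun t (ht : t ∉ spectrum K Z) => exists_gl_eq_smul_one_sub ht
  exact Set.infinite_of_injOn_mapsTo (f := fun t => mk (g t))
    (fun s hs t ht h => eq_of_mk_smul_one_sub_eq hZ (hg s hs) (hg t ht) h)
    (fun t ht => ⟨t, g t, hg t ht, rfl⟩) (Matrix.finite_spectrum Z).infinite_compl

theorem eq_smul_one_of_finite_centralizer [Infinite K] {X Y : GL ι K}
    (hfin : (Subgroup.centralizer {mk X, mk Y} : Set PGL(ι, K)).Finite)
    {Z : Matrix ι ι K} (hX : Commute X.1 Z) (hY : Commute Y.1 Z) : ∃ c : K, Z = c • 1 := by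
  by_contra! hZ
  refine infinite_setOf_mk_smul_one_sub hZ (hfin.subset ?_)
  rintro _ ⟨t, g, hg, rfl⟩
  have hcomm {A : GL ι K} (hA : Commute A.1 Z) : Commute (mk A) (mk g) := by
    refine Commute.map (Units.ext ?_ : Commute A g) mk
    rw [Units.val_mul, Units.val_mul, hg]
    exact (((Commute.one_right _).smul_right t).sub_right hA).eq
  exact mem_centralizer_pair.2 ⟨hcomm hX, hcomm hY⟩

/-- The action of `PGL` on matrices by conjugation. -/
noncomputable def conjAut (ι K : Type*) [Fintype ι] [DecidableEq ι] [Field K] :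
    PGL(ι, K) →* Matrix ι ι K ≃ₐ[K] Matrix ι ι K :=
  lift ((MulSemiringAction.toAlgAut (ConjAct (GL ι K)) K (Matrix ι ι K)).comp
    ConjAct.toConjAct.toMonoidHom) <| by
      refine MonoidHom.ext fun c => AlgEquiv.ext fun T => ?_
      change (GeneralLinearGroup.scalar ι c).1 * T * (GeneralLinearGroup.scalar ι c)⁻¹.1 = T
      rw [GeneralLinearGroup.coe_scalar, scalar_comm _ (fun _ => Commute.all _ _), mul_assoc,
        ← GeneralLinearGroup.coe_scalar, Units.mul_inv, mul_one]

theorem conjAut_mk (X : GL ι K) (T : Matrix ι ι K) :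
    conjAut ι K (mk X) T = X.1 * T * X⁻¹.1 := rfl

theorem conjAut_mk_eq_self_iff {X : GL ι K} {T : Matrix ι ι K} :
    conjAut ι K (mk X) T = T ↔ Commute X.1 T := by
  rw [conjAut_mk, Units.mul_inv_eq_iff_eq_mul, commute_iff_eq]

theorem trace_conjAut (x : PGL(ι, K)) (T : Matrix ι ι K) : (conjAut ι K x T).trace = T.trace := by
  obtain ⟨X, rfl⟩ := mk_surjective x
  rw [conjAut_mk, trace_mul_cycle, Units.inv_mul, one_mul]

theorem conjAut_sum_conjAut {S : Subgroup PGL(ι, K)} [Fintype S] (s : S) (T : Matrix ι ι K) :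
    conjAut ι K s (∑ t : S, conjAut ι K t T) = ∑ t : S, conjAut ι K t T := by
  rw [map_sum]
  refine Fintype.sum_equiv (Equiv.mulLeft s) _ _ fun t => ?_
  rw [Equiv.coe_mulLeft, Subgroup.coe_mul, map_mul, AlgEquiv.mul_apply]

theorem exists_sum_conjAut_eq_smul_one [CharZero K] {X Y : GL ι K}
    (hfin : (Subgroup.centralizer {mk X, mk Y} : Set PGL(ι, K)).Finite)
    {S : Subgroup PGL(ι, K)} [Fintype S] (hX : mk X ∈ S) (hY : mk Y ∈ S) {T : Matrix ι ι K}
    (hT : T.trace ≠ 0) : ∃ c : K, c ≠ 0 ∧ ∑ t : S, conjAut ι K t T = c • 1 := by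
  obtain ⟨c, hc⟩ := eq_smul_one_of_finite_centralizer hfin
    (conjAut_mk_eq_self_iff.1 (conjAut_sum_conjAut (⟨_, hX⟩ : S) T))
    (conjAut_mk_eq_self_iff.1 (conjAut_sum_conjAut (⟨_, hY⟩ : S) T))
  refine ⟨c, ?_, hc⟩
  rintro rfl
  have htr := congrArg trace hc
  simp only [trace_sum, trace_conjAut, zero_smul, trace_zero, Finset.sum_const, nsmul_eq_mul,
    mul_eq_zero, Nat.cast_eq_zero, Finset.card_ne_zero_of_mem (Finset.mem_univ (1 : S)),
    false_or] at htr
  exact hT htr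

theorem exists_mk_eq_of_mem_closure {X Y : GL ι K} {W : Submodule K (ι → K)}
    (hX : W ∈ Module.End.invtSubmodule (toLin' X.1))
    (hY : W ∈ Module.End.invtSubmodule (toLin' Y.1)) {z : PGL(ι, K)}
    (hz : z ∈ Submonoid.closure {mk X, mk Y}) :
    ∃ Z : GL ι K, mk Z = z ∧ W ∈ Module.End.invtSubmodule (toLin' Z.1) := by
  induction hz using Submonoid.closure_induction with
  | mem z hz =>
    rcases hz with rfl | rfl
    exacts [⟨X, rfl, hX⟩, ⟨Y, rfl, hY⟩]
  | one => exact ⟨1, map_one mk, by simp⟩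
  | mul z z' _ _ hz hz' =>
    obtain ⟨Z, rfl, hZ⟩ := hz
    obtain ⟨Z', rfl, hZ'⟩ := hz'
    refine ⟨Z * Z', map_mul mk Z Z', fun v hv => ?_⟩
    rw [Submodule.mem_comap, toLin'_apply, Units.val_mul, ← mulVec_mulVec]
    exact hZ (hZ' hv)

/-- Maschke-type argument: the average of a matrix of rank one with image in `W` over the finite
group generated by `X` and `Y` is a nonzero scalar. -/
theorem isIrreduciblePair_of_finite_centralizer [CharZero K] {X Y : GL ι K}
    (hcomm : Commute (mk X) (mk Y))
    (hfin : (Subgroup.centralizer {mk X, mk Y} : Set PGL(ι, K)).Finite) :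
    IsIrreduciblePair X.1 Y.1 := by
  intro W hWX hWY
  refine or_iff_not_imp_left.2 fun hW0 => ?_
  obtain ⟨v, hvW, hv0⟩ := W.exists_mem_ne_zero_of_ne_bot hW0
  obtain ⟨i, hi⟩ := Function.ne_iff.1 hv0
  let S : Subgroup PGL(ι, K) := Subgroup.closure {mk X, mk Y}
  have hXS : mk X ∈ S := Subgroup.subset_closure (Set.mem_insert _ _)
  have hYS : mk Y ∈ S := Subgroup.subset_closure (Set.mem_insert_of_mem _ rfl)
  have hle : S ≤ Subgroup.centralizer {mk X, mk Y} := by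
    rw [Subgroup.closure_le]
    rintro _ (rfl | rfl)
    exacts [mem_centralizer_pair.2 ⟨.refl _, hcomm.symm⟩, mem_centralizer_pair.2 ⟨hcomm, .refl _⟩]
  have : Finite S := (hfin.subset hle).to_subtype
  have := Fintype.ofFinite S
  have hord : ∀ z ∈ ({mk X, mk Y} : Set PGL(ι, K)), IsOfFinOrder z := fun z hz =>
    Submonoid.isOfFinOrder_coe.2 (isOfFinOrder_of_finite (⟨z, Subgroup.subset_closure hz⟩ : S))
  obtain ⟨c, hc0, hc⟩ := exists_sum_conjAut_eq_smul_one hfin hXS hYS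
    (T := vecMulVec v (Pi.single i 1)) (by simpa using hi)
  refine eq_top_iff.2 fun w _ => (W.smul_mem_iff hc0).1 ?_
  rw [← one_mulVec w, ← smul_mulVec, ← hc, sum_mulVec]
  refine W.sum_mem fun z _ => ?_
  obtain ⟨Z, hZz, hZ⟩ := exists_mk_eq_of_mem_closure hWX hWY
    ((Subgroup.closure_toSubmonoid_of_isOfFinOrder hord).le z.2)
  rw [← hZz, conjAut_mk, ← mulVec_mulVec, ← mulVec_mulVec, vecMulVec_mulVec, op_smul_eq_smul]
  exact hZ (W.smul_mem _ hvW)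

end FiniteCentralizer

/-! ### The standard pairs and their orbits -/

section FiniteOrder

variable {ι K : Type*} [Fintype ι] [DecidableEq ι] [Field K] [IsAlgClosed K]

theorem exists_mk_eq_pow_eq_one {k : ℕ} (hk : k ≠ 0) {x : PGL(ι, K)} (hx : x ^ k = 1) :
    ∃ X : GL ι K, mk X = x ∧ X ^ k = 1 := by
  obtain ⟨X, rfl⟩ := mk_surjective x
  obtain ⟨c, hc⟩ := mk_eq_one_iff_smul.1 ((map_pow mk X k).trans hx)
  obtain ⟨γ, hγ⟩ := IsAlgClosed.exists_pow_nat_eq (c⁻¹ : K) (Nat.pos_of_ne_zero hk)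
  have hγ0 : γ ≠ 0 := by
    rintro rfl
    exact inv_ne_zero c.ne_zero (by rw [← hγ, zero_pow hk])
  refine ⟨GeneralLinearGroup.scalar ι (Units.mk0 γ hγ0) * X, by rw [map_mul, mk_scalar, one_mul],
    Units.ext ?_⟩
  rw [Commute.mul_pow (GeneralLinearGroup.scalar_commute _ X), ← map_pow, coe_scalar_mul, hc,
    Units.val_pow_eq_pow_val, Units.val_mk0, hγ, inv_smul_smul₀ c.ne_zero, Units.val_one]

theorem HasCommutator.pow_card_right_eq_one [Nonempty ι] {x y : PGL(ι, K)} {ω : Kˣ}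
    (hω : IsPrimitiveRoot ω (Fintype.card ι)) (h : HasCommutator x y ω) :
    y ^ Fintype.card ι = 1 := by
  obtain ⟨X, rfl⟩ := mk_surjective x
  obtain ⟨Y, rfl⟩ := mk_surjective y
  have hirr := isIrreduciblePair_of_isPrimitiveRoot (IsPrimitiveRoot.coe_units_iff.2 hω)
    (hasCommutator_mk_iff.1 h)
  exact hirr.eq_one_of_hasCommutator
    (by simpa only [hω.pow_eq_one] using h.pow_right (Fintype.card ι))
    (by simpa only [one_pow] using (hasCommutator_self (mk Y)).pow_right (Fintype.card ι))

theorem HasCommutator.pow_card_left_eq_one [Nonempty ι] {x y : PGL(ι, K)} {ω : Kˣ}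
    (hω : IsPrimitiveRoot ω (Fintype.card ι)) (h : HasCommutator x y ω) :
    x ^ Fintype.card ι = 1 :=
  h.swap.pow_card_right_eq_one hω.inv

theorem commute_and_finite_centralizer_iff [Nonempty ι] [CharZero K] {x y : PGL(ι, K)} :
    Commute x y ∧ (Subgroup.centralizer {x, y} : Set PGL(ι, K)).Finite ↔
      ∃ ω : Kˣ, IsPrimitiveRoot ω (Fintype.card ι) ∧ HasCommutator x y ω := by
  constructor
  · rintro ⟨hcomm, hfin⟩
    obtain ⟨ω, hω⟩ := exists_hasCommutator_iff.2 hcomm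
    obtain ⟨X, rfl⟩ := mk_surjective x
    obtain ⟨Y, rfl⟩ := mk_surjective y
    exact ⟨ω, isPrimitiveRoot_of_isIrreduciblePair
      (isIrreduciblePair_of_finite_centralizer hcomm hfin) hω, hω⟩
  · rintro ⟨ω, hω, h⟩
    refine ⟨exists_hasCommutator_iff.1 ⟨ω, h⟩, ?_⟩
    obtain ⟨X, Y, rfl, rfl, -⟩ := id h
    exact (isIrreduciblePair_of_isPrimitiveRoot (IsPrimitiveRoot.coe_units_iff.2 hω)
      (hasCommutator_mk_iff.1 h)).finite_centralizer

end FiniteOrder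

section StandardPair

theorem isSemisimpleElt_of_pow_eq_one {n k : ℕ} (hk : k ≠ 0) {x : PGL(n, ℂ)} (hx : x ^ k = 1) :
    IsSemisimpleElt x := by
  obtain ⟨g, rfl, hg⟩ := exists_mk_eq_pow_eq_one hk hx
  refine ⟨g, rfl, Module.End.isSemisimple_of_squarefree_aeval_eq_zero
    (Polynomial.X_pow_sub_one_separable_iff.2 (Nat.cast_ne_zero.2 hk)).squarefree ?_⟩
  rw [map_sub, map_pow, Polynomial.aeval_X, map_one, ← toLin'_pow, ← Units.val_pow_eq_pow_val, hg,
    Units.val_one, toLin'_one, Module.End.one_eq_id, sub_self]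

variable {n : ℕ}

theorem coe_delta_rep (z : ℂˣ) :
    ((Units.map (Matrix.diagonalRingHom (Fin n) ℂ).toMonoidHom
      (MulEquiv.piUnits.symm fun j : Fin n => z ^ (j : ℕ)) : GL (Fin n) ℂ) :
        Matrix (Fin n) (Fin n) ℂ) = diagonal fun j : Fin n => (z : ℂ) ^ (j : ℕ) := by
  ext i j
  simp [Matrix.diagonal_apply]

theorem col_mul_permMatrix (Q : Matrix (Fin n) (Fin n) ℂ) (σ : Equiv.Perm (Fin n)) (j : Fin n) :
    (Q * σ⁻¹.permMatrix ℂ).col j = Q.col (σ j) := by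
  ext i
  rw [Equiv.Perm.permMatrix, PEquiv.mul_toMatrix_toPEquiv]
  rfl

theorem val_finRotate [NeZero n] (j : Fin n) : (finRotate n j : ℕ) = (j + 1) % n := by
  rw [finRotate_apply, Fin.val_add, Fin.val_one', Nat.add_mod_mod]

theorem pow_val_finRotate {M : Type*} [Monoid M] [NeZero n] {a : M} (ha : a ^ n = 1) (j : Fin n) :
    a ^ (finRotate n j : ℕ) = a ^ (j + 1 : ℕ) := by
  rw [val_finRotate, ← pow_eq_pow_mod _ ha]

theorem hasCommutator_delta_wdot [NeZero n] {ζ : ℂˣ} (hζ : ζ ^ n = 1) :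
    HasCommutator (Delta n ζ) (wdot n) ζ := by
  rw [Delta, wdot, hasCommutator_mk_iff, coe_delta_rep]
  change _ * (finRotate n)⁻¹.permMatrix ℂ = _ • ((finRotate n)⁻¹.permMatrix ℂ * _)
  refine Matrix.ext_col fun j => funext fun i => ?_
  have hζ' : (ζ : ℂ) ^ n = 1 := by rw [← Units.val_pow_eq_pow_val, hζ, Units.val_one]
  rw [col_mul_permMatrix]
  simp only [col_apply, Matrix.smul_apply, mul_diagonal, smul_eq_mul, diagonal_apply,
    Equiv.Perm.permMatrix, PEquiv.toMatrix_apply, Equiv.toPEquiv_apply, Option.mem_some_iff,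
    Equiv.Perm.inv_eq_iff_eq, ite_mul, one_mul, zero_mul, mul_ite, mul_zero]
  split_ifs with hij
  · rw [hij, pow_val_finRotate hζ', pow_succ']
  · rfl

theorem exists_col_eq_of_linearIndependent {v : Fin n → Fin n → ℂ}
    (hv : LinearIndependent ℂ v) : ∃ Q : GL (Fin n) ℂ, ∀ j, Q.1.col j = v j := by
  obtain ⟨Q, hQ⟩ := Matrix.linearIndependent_cols_iff_isUnit (A := (Matrix.of v)ᵀ).1 hv
  exact ⟨Q, fun j => by rw [hQ]; rfl⟩

/-- The basis adapted to the standard pair consists of the `Y ^ j v`, for `v` an eigenvector of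
`X`. -/
theorem exists_conj_standard [NeZero n] {x y : PGL(n, ℂ)} {ω : ℂˣ} (hω : IsPrimitiveRoot ω n)
    (h : HasCommutator x y ω) : ∃ q, q * Delta n ω * q⁻¹ = x ∧ q * wdot n * q⁻¹ = y := by
  obtain ⟨X, rfl⟩ := mk_surjective x
  obtain ⟨Y, rfl, hYn⟩ := exists_mk_eq_pow_eq_one (NeZero.ne n)
    (by simpa using h.pow_card_right_eq_one (by simpa using hω))
  have hXY := hasCommutator_mk_iff.1 h
  obtain ⟨μ, v, -, hv0, hv⟩ :=
    exists_eigenvector_mem (Module.End.invtSubmodule.top_mem (toLin' X.1)) top_ne_bot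
  have hμ : μ ≠ 0 := by
    rintro rfl
    exact mulVec_ne_zero X hv0 (by rw [hv, zero_smul])
  obtain ⟨Q, hQ⟩ := exists_col_eq_of_linearIndependent
    (linearIndependent_pow_mulVec (IsPrimitiveRoot.coe_units_iff.2 hω) hXY hv0 hv)
  have hmulQ (A : Matrix (Fin n) (Fin n) ℂ) (j : Fin n) : (A * Q).col j = A *ᵥ Q.1.col j := rfl
  refine ⟨mk Q, ?_, ?_⟩
  · rw [mul_inv_eq_iff_eq_mul, Delta, ← map_mul, ← map_mul, mk_eq_mk_iff_smul]
    refine ⟨Units.mk0 μ hμ, Matrix.ext_col fun j => ?_⟩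
    rw [Units.val_mul, hmulQ, hQ, mulVec_pow_mulVec hXY hv, ← hQ, Units.val_mul, coe_delta_rep]
    ext i
    simp only [col_apply, Matrix.smul_apply, mul_diagonal, Pi.smul_apply, smul_eq_mul,
      Units.val_mk0]
    ring
  · rw [mul_inv_eq_iff_eq_mul, wdot, ← map_mul, ← map_mul]
    refine congrArg mk (Units.ext (Matrix.ext_col fun j => ?_))
    change (Q.1 * (finRotate n)⁻¹.permMatrix ℂ).col j = (Y.1 * Q.1).col j
    rw [col_mul_permMatrix, hmulQ, hQ, hQ, mulVec_mulVec, ← pow_succ', ← Units.val_pow_eq_pow_val,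
      pow_val_finRotate hYn, Units.val_pow_eq_pow_val]

end StandardPair

section PairOrbits

variable {H K : Type*} [Group H] [Group K]

theorem pairOrbits_eq_range {I : Type*} {Y : Set (H × H)} {x : I → H × H}
    (hY : Y = ⋃ k, pairOrbit (x k)) : pairOrbits Y = Set.range fun k => pairOrbit (x k) := by
  ext O
  constructor
  · rintro ⟨p, hp, rfl⟩
    obtain ⟨k, hk⟩ := Set.mem_iUnion.1 (hY.subset hp)
    exact ⟨k, (MulAction.orbit_eq_iff.2 hk).symm⟩
  · rintro ⟨k, rfl⟩
    exact ⟨x k, hY.superset (Set.mem_iUnion_of_mem k (MulAction.mem_orbit_self _)), rfl⟩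

theorem injective_pairOrbit_of_pairwise_disjoint {I : Type*} {x : I → H × H}
    (h : Pairwise fun k l => Disjoint (pairOrbit (x k)) (pairOrbit (x l))) :
    Function.Injective fun k => pairOrbit (x k) := fun k l hkl => by
  by_contra hne
  have hmem : x k ∈ pairOrbit (x k) := MulAction.mem_orbit_self _
  exact Set.disjoint_left.1 (h hne) hmem (hkl.subset hmem)

theorem pairOrbit_map (φ : H ≃* K) (x : H × H) :
    pairOrbit (φ x.1, φ x.2) = Prod.map φ φ '' pairOrbit x := by
  ext p
  constructor
  · rintro ⟨q, rfl⟩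
    obtain ⟨q, rfl⟩ := ConjAct.toConjAct.surjective q
    refine ⟨_, ⟨ConjAct.toConjAct (φ.symm q), rfl⟩, ?_⟩
    simp [ConjAct.toConjAct_smul, Prod.map]
  · rintro ⟨_, ⟨q, rfl⟩, rfl⟩
    obtain ⟨q, rfl⟩ := ConjAct.toConjAct.surjective q
    refine ⟨ConjAct.toConjAct (φ q), ?_⟩
    simp [ConjAct.toConjAct_smul, Prod.map]

theorem centralizer_pair_map (φ : H ≃* K) (x y : H) :
    (Subgroup.centralizer {φ x, φ y} : Set K) = φ '' (Subgroup.centralizer {x, y} : Set H) := by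
  ext z
  obtain ⟨z, rfl⟩ := φ.surjective z
  rw [φ.injective.mem_set_image]
  simp only [SetLike.mem_coe, mem_centralizer_pair, commute_iff_eq, ← map_mul, φ.injective.eq_iff]

theorem image_ellipticPairs (φ : H ≃* K) (ss : K → Prop) :
    Prod.map φ φ '' ellipticPairs (fun x => ss (φ x)) = ellipticPairs ss := by
  ext ⟨x, y⟩
  obtain ⟨x, rfl⟩ := φ.surjective x
  obtain ⟨y, rfl⟩ := φ.surjective y
  rw [show (φ x, φ y) = Prod.map φ φ (x, y) from rfl,
    (φ.injective.prodMap φ.injective).mem_set_image]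
  simp only [ellipticPairs, Set.mem_ofPred_eq, Prod.map, centralizer_pair_map, ← map_mul,
    φ.injective.eq_iff, Set.finite_image_iff φ.injective.injOn]

theorem pairOrbits_image (φ : H ≃* K) (Y : Set (H × H)) :
    pairOrbits (Prod.map φ φ '' Y) = Set.image (Prod.map φ φ) '' pairOrbits Y := by
  rw [pairOrbits, pairOrbits, Set.image_image, Set.image_image]
  exact Set.image_congr' fun x => pairOrbit_map φ x

theorem IsStandardUnion.map (φ : H ≃* K) {Y : Set (H × H)} {m : ℕ} {s w : H}
    (h : IsStandardUnion Y m s w) : IsStandardUnion (Prod.map φ φ '' Y) m (φ s) (φ w) := by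
  have horb (k : ℕ) : pairOrbit (φ s, φ w ^ k) = Prod.map φ φ '' pairOrbit (s, w ^ k) := by
    rw [← pairOrbit_map, ← map_pow]
  have hinj : Function.Injective (Prod.map φ φ) := φ.injective.prodMap φ.injective
  refine ⟨?_, fun k l hkl => ?_, ?_, fun k => ?_⟩
  · rw [h.eq_iUnion, Set.image_iUnion]
    simp only [horb]
  · simp only [horb]
    exact (Set.disjoint_image_iff hinj).2 (h.disjoint hkl)
  · rw [pairOrbits_image]
    exact ⟨h.card_orbits.1.image _, by
      rw [Set.ncard_image_of_injective _ hinj.image_injective, h.card_orbits.2]⟩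
  · rw [horb, horb, ← h.flip k, Set.image_image, Set.image_image]
    rfl

end PairOrbits

section StandardUnion

variable {n : ℕ} [NeZero n]

theorem pairOrbit_eq_hasCommutator {x y : PGL(n, ℂ)} {ω : ℂˣ} (hω : IsPrimitiveRoot ω n)
    (h : HasCommutator x y ω) : pairOrbit (x, y) = {p | HasCommutator p.1 p.2 ω} := by
  ext ⟨x', y'⟩
  constructor
  · rintro ⟨q, hq⟩
    obtain ⟨q, rfl⟩ := ConjAct.toConjAct.surjective q
    rw [← hq]
    exact h.conj q
  · intro h'
    obtain ⟨q, rfl, rfl⟩ := exists_conj_standard hω h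
    obtain ⟨q', rfl, rfl⟩ := exists_conj_standard hω h'
    refine ⟨ConjAct.toConjAct (q' * q⁻¹), Prod.ext ?_ ?_⟩ <;>
    · simp only [ConjAct.toConjAct_smul, Prod.smul_fst, Prod.smul_snd]
      group

theorem mem_ellipticPairs_iff {ss : PGL(n, ℂ) → Prop} (hss : ∀ x, x ^ n = 1 → ss x)
    {p : PGL(n, ℂ) × PGL(n, ℂ)} :
    p ∈ ellipticPairs ss ↔ ∃ ω : ℂˣ, IsPrimitiveRoot ω n ∧ HasCommutator p.1 p.2 ω := by
  have key := commute_and_finite_centralizer_iff (x := p.1) (y := p.2)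
  rw [Fintype.card_fin] at key
  refine ⟨fun ⟨_, _, hcomm, hfin⟩ => key.1 ⟨hcomm, hfin⟩, fun hω => ?_⟩
  obtain ⟨hcomm, hfin⟩ := key.2 hω
  obtain ⟨ω, hω, h⟩ := hω
  rw [← Fintype.card_fin n] at hω
  refine ⟨hss _ ?_, hss _ ?_, hcomm, hfin⟩
  · simpa only [Fintype.card_fin] using h.pow_card_left_eq_one hω
  · simpa only [Fintype.card_fin] using h.pow_card_right_eq_one hω

theorem isPrimitiveRoot_iff_exists_zmod_unit {ζ ω : ℂˣ} (hζ : IsPrimitiveRoot ζ n) :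
    IsPrimitiveRoot ω n ↔ ∃ k : (ZMod n)ˣ, ζ ^ (k : ZMod n).val = ω := by
  constructor
  · intro hω
    obtain ⟨i, hi, hcop, h⟩ := (IsPrimitiveRoot.coe_units_iff.2 hζ).isPrimitiveRoot_iff.1
      (IsPrimitiveRoot.coe_units_iff.2 hω)
    refine ⟨ZMod.unitOfCoprime i hcop, Units.ext ?_⟩
    rw [ZMod.coe_unitOfCoprime, ZMod.val_natCast, Nat.mod_eq_of_lt hi, Units.val_pow_eq_pow_val, h]
  · rintro ⟨k, rfl⟩
    exact hζ.pow_of_coprime _ (ZMod.val_coe_unit_coprime k)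

theorem pow_val_neg {G : Type*} [Group G] {a : G} (ha : a ^ n = 1) (k : ZMod n) :
    a ^ (-k).val = (a ^ k.val)⁻¹ := by
  rw [eq_inv_iff_mul_eq_one, ← pow_add]
  obtain ⟨m, hm⟩ : n ∣ (-k).val + k.val := by
    rw [← ZMod.natCast_eq_zero_iff]
    simp
  rw [hm, pow_mul, ha, one_pow]

theorem isStandardUnion_ellipticPairs {ss : PGL(n, ℂ) → Prop} (hss : ∀ x, x ^ n = 1 → ss x)
    {ζ : ℂˣ} (hζ : IsPrimitiveRoot ζ n) :
    IsStandardUnion (ellipticPairs ss) n (Delta n ζ) (wdot n) := by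
  have horb (k : (ZMod n)ˣ) : pairOrbit (Delta n ζ, wdot n ^ (k : ZMod n).val) =
      {p | HasCommutator p.1 p.2 (ζ ^ (k : ZMod n).val)} :=
    pairOrbit_eq_hasCommutator ((isPrimitiveRoot_iff_exists_zmod_unit hζ).2 ⟨k, rfl⟩)
      ((hasCommutator_delta_wdot hζ.pow_eq_one).pow_right _)
  have hunion : ellipticPairs ss =
      ⋃ k : (ZMod n)ˣ, pairOrbit (Delta n ζ, wdot n ^ (k : ZMod n).val) := by
    ext p
    simp only [mem_ellipticPairs_iff hss, isPrimitiveRoot_iff_exists_zmod_unit hζ, Set.mem_iUnion,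
      horb, Set.mem_ofPred_eq, ↓existsAndEq, true_and]
  have hdisj : Pairwise fun k l : (ZMod n)ˣ =>
      Disjoint (pairOrbit (Delta n ζ, wdot n ^ (k : ZMod n).val))
        (pairOrbit (Delta n ζ, wdot n ^ (l : ZMod n).val)) := fun k l hkl => by
    simp only [horb, Set.disjoint_left]
    intro p hp hp'
    exact hkl (Units.ext (ZMod.val_injective n
      (hζ.pow_inj (ZMod.val_lt _) (ZMod.val_lt _) (hp.unique hp'))))
  refine ⟨hunion, hdisj, ?_, fun k => ?_⟩
  · rw [pairOrbits_eq_range hunion]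
    refine ⟨Set.finite_range _, ?_⟩
    rw [← Nat.card_coe_set_eq, Nat.card_range_of_injective
      (injective_pairOrbit_of_pairwise_disjoint hdisj), Nat.card_eq_fintype_card,
      ZMod.card_units_eq_totient]
  · rw [horb, horb, Units.val_neg, pow_val_neg hζ.pow_eq_one, Set.image_swap_eq_preimage_swap]
    ext p
    exact ⟨fun h => HasCommutator.swap h, fun h => by simpa using HasCommutator.swap h⟩

end StandardUnion

/-! ### Complements in nilpotent extensions of matrix algebras -/

section Dilation

variable {K A B : Type*} [Field K] [Ring A] [Algebra K A] [Ring B] [Algebra K B]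

/-- The one-parameter group `z ↦ 1 + (z - 1) e` attached to an idempotent `e`. -/
noncomputable def dilation {e : A} (he : IsIdempotentElem e) : Kˣ →* Aˣ :=
  MonoidHom.toHomUnits
    { toFun := fun z => 1 + ((z : K) - 1) • e
      map_one' := by simp
      map_mul' := fun z w => by
        simp only [mul_add, add_mul, smul_mul_smul_comm, he.eq, mul_one, one_mul, Units.val_mul]
        module }

theorem coe_dilation {e : A} (he : IsIdempotentElem e) (z : Kˣ) :
    (dilation he z).1 = 1 + ((z : K) - 1) • e := rfl

theorem coe_dilation_eq_line {e : A} (he : IsIdempotentElem e) (z : Kˣ) :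
    (dilation he z).1 = (1 - e) + (z : K) • e := by
  rw [coe_dilation]
  module

theorem coe_dilation_neg_one {e : A} (he : IsIdempotentElem e) :
    (dilation he (-1 : Kˣ)).1 = 1 - (2 : K) • e := by
  rw [coe_dilation, Units.val_neg, Units.val_one]
  module

theorem map_dilation (φ : A →ₐ[K] B) {e : A} (he : IsIdempotentElem e) (z : Kˣ) :
    Units.map φ (dilation he z) = dilation (he.map φ) z :=
  Units.ext (by simp [coe_dilation])

theorem commute_dilation_of_commute {e x : A} (he : IsIdempotentElem e) (h : Commute x e)
    (z : Kˣ) : Commute x (dilation he z).1 :=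
  (Commute.one_right x).add_right (h.smul_right _)

theorem commute_of_commute_dilation_neg_one [NeZero (2 : K)] {e x : A} (he : IsIdempotentElem e)
    (h : Commute x (dilation he (-1 : Kˣ)).1) : Commute x e := by
  rw [coe_dilation_neg_one] at h
  have h2 := ((Commute.one_right x).sub_right h).smul_right (2⁻¹ : K)
  rwa [sub_sub_cancel, inv_smul_smul₀ two_ne_zero] at h2

end Dilation

section Generators

variable {κ K : Type*} [Fintype κ] [DecidableEq κ] [Field K]

/-- The invertible diagonal matrix with entries `d`. -/
noncomputable def diagUnit : (κ → Kˣ) →* GL κ K :=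
  (Units.map (diagonalRingHom κ K).toMonoidHom).comp
    (MulEquiv.piUnits (M := fun _ : κ => K)).symm.toMonoidHom

theorem coe_diagUnit (d : κ → Kˣ) : (diagUnit d).1 = diagonal fun i => (d i : K) := rfl

/-- The transvection `1 + c E_ij`, `i ≠ j`, as an invertible matrix. -/
noncomputable def transvectionUnit {i j : κ} (h : i ≠ j) (c : K) : GL κ K :=
  ⟨transvection i j c, transvection i j (-c),
    by rw [transvection_mul_transvection_same _ _ h, add_neg_cancel, transvection_zero],
    by rw [transvection_mul_transvection_same _ _ h, neg_add_cancel, transvection_zero]⟩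

theorem coe_transvectionUnit {i j : κ} (h : i ≠ j) (c : K) :
    (transvectionUnit h c).1 = 1 + c • single i j 1 := by
  rw [smul_single, smul_eq_mul, mul_one]
  rfl

theorem isIdempotentElem_single (i : κ) : IsIdempotentElem (single i i (1 : K)) := by
  rw [IsIdempotentElem, single_mul_single_same, mul_one]

theorem diagUnit_mulSingle (i : κ) (z : Kˣ) :
    diagUnit (Pi.mulSingle i z) = dilation (isIdempotentElem_single i) z := by
  refine Units.ext ?_
  rw [coe_diagUnit, coe_dilation, smul_single, ← diagonal_one, ← diagonal_single, diagonal_add]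
  congr 1
  ext k
  by_cases hk : k = i
  · subst hk; simp
  · simp [hk]

theorem exists_eq_diagUnit {g : GL κ K} {D : κ → K} (hg : g.1 = diagonal D) :
    ∃ d, g = diagUnit d := by
  have hD : ∀ i, D i ≠ 0 := by
    have := (g.1.isUnit_iff_isUnit_det.1 g.isUnit).ne_zero
    rw [hg, det_diagonal, Finset.prod_ne_zero_iff] at this
    exact fun i => this i (Finset.mem_univ i)
  exact ⟨fun i => Units.mk0 (D i) (hD i), Units.ext (by rw [hg, coe_diagUnit]; rfl)⟩

/-- The orthogonal projection onto the line spanned by `e_i - e_j`. -/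
noncomputable def differenceProj (K : Type*) [Field K] (i j : κ) : Matrix κ κ K :=
  (2⁻¹ : K) • (single i i 1 + single j j 1 - single i j 1 - single j i 1)

theorem isIdempotentElem_differenceProj [NeZero (2 : K)] {i j : κ} (h : i ≠ j) :
    IsIdempotentElem (differenceProj K i j) := by
  have h2 : (2 : K) ≠ 0 := two_ne_zero
  rw [IsIdempotentElem, differenceProj, smul_mul_smul_comm]
  simp only [mul_add, add_mul, mul_sub, sub_mul, single_mul_single_same,
    single_mul_single_of_ne _ _ _ _ h, single_mul_single_of_ne _ _ _ _ h.symm, mul_one]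
  match_scalars <;> field_simp <;> norm_num

theorem transvectionUnit_conj {i j : κ} (h : i ≠ j) (z : Kˣ) (a : K) :
    dilation (isIdempotentElem_single i) z * transvectionUnit h a *
      (dilation (isIdempotentElem_single i) z)⁻¹ = transvectionUnit h (z * a) := by
  rw [mul_inv_eq_iff_eq_mul]
  refine Units.ext ?_
  simp only [Units.val_mul, coe_dilation, coe_transvectionUnit, mul_add, add_mul, smul_mul_assoc,
    mul_smul_comm, single_mul_single_same, single_mul_single_of_ne _ _ _ _ h.symm, mul_one, one_mul,
    smul_zero]
  module

variable [CharZero K]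

/-- Multiplying two symmetric circulant blocks, one of them conjugated by a diagonal matrix so that
a corner of the product vanishes. -/
theorem dilation_mul_dilation_mul_dilation {i j : κ} (h : i ≠ j) :
    dilation (isIdempotentElem_differenceProj h) (Units.mk0 (-1 / 3 : K) (by norm_num)) *
        dilation (isIdempotentElem_single i) (Units.mk0 (2 : K) two_ne_zero) *
        dilation (isIdempotentElem_differenceProj h) (Units.mk0 (-5 / 3 : K) (by norm_num)) =
      dilation (isIdempotentElem_single i) (Units.mk0 (1 / 3 : K) (by norm_num)) *
        dilation (isIdempotentElem_single j) (Units.mk0 (5 / 3 : K) (by norm_num)) *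
        transvectionUnit h (2 : K) *
        dilation (isIdempotentElem_single i) (Units.mk0 (2 : K) two_ne_zero) := by
  refine Units.ext ?_
  simp only [Units.val_mul, coe_dilation, coe_transvectionUnit, Units.val_mk0, differenceProj,
    mul_add, add_mul, mul_sub, sub_mul, smul_add, smul_sub, smul_mul_assoc, mul_smul_comm,
    single_mul_single_same, single_mul_single_of_ne _ _ _ _ h,
    single_mul_single_of_ne _ _ _ _ h.symm, mul_one, one_mul, zero_mul, smul_zero]
  match_scalars <;> norm_num

theorem eq_top_of_dilation_mem {S : Subgroup (GL κ K)}
    (hdiag : ∀ i (z : Kˣ), dilation (isIdempotentElem_single i) z ∈ S)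
    (hdiff : ∀ {i j : κ} (h : i ≠ j) (z : Kˣ),
      dilation (isIdempotentElem_differenceProj h) z ∈ S) : S = ⊤ := by
  have htwo {i j : κ} (h : i ≠ j) : transvectionUnit h (2 : K) ∈ S := by
    rw [← S.mul_mem_cancel_left (S.mul_mem (hdiag i _) (hdiag j _)),
      ← S.mul_mem_cancel_right (hdiag i _), ← dilation_mul_dilation_mul_dilation h]
    exact S.mul_mem (S.mul_mem (hdiff h _) (hdiag i _)) (hdiff h _)
  have htrans {i j : κ} (h : i ≠ j) (c : K) : transvectionUnit h c ∈ S := by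
    by_cases hc : c = 0
    · subst hc
      convert S.one_mem
      exact Units.ext (transvection_zero i j)
    · have hz := hdiag i (Units.mk0 (c / 2) (div_ne_zero hc two_ne_zero))
      have := S.mul_mem (S.mul_mem hz (htwo h)) (S.inv_mem hz)
      rwa [transvectionUnit_conj, Units.val_mk0, div_mul_cancel₀ _ two_ne_zero] at this
  have hdiagUnit (d : κ → Kˣ) : diagUnit d ∈ S := by
    induction d using Pi.mulSingle_induction with
    | one => exact map_one (diagUnit (κ := κ) (K := K)) ▸ S.one_mem
    | mul d d' hd hd' => exact map_mul diagUnit d d' ▸ S.mul_mem hd hd'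
    | mulSingle i z => exact diagUnit_mulSingle i z ▸ hdiag i z
  refine (Subgroup.eq_top_iff' S).2 fun A => ?_
  suffices h : ∀ g : GL κ K, g.1 = A.1 → g ∈ S from h A rfl
  refine diagonal_transvection_induction_of_det_ne_zero (fun M => ∀ g : GL κ K, g.1 = M → g ∈ S)
    A.1 (A.1.isUnit_iff_isUnit_det.1 A.isUnit).ne_zero ?_ ?_ ?_
  · intro D _ g hg
    obtain ⟨d, rfl⟩ := exists_eq_diagUnit hg
    exact hdiagUnit d
  · intro t g hg
    rw [show g = transvectionUnit t.hij t.c from Units.ext hg]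
    exact htrans t.hij t.c
  · intro M N hM hN hMS hNS g hg
    obtain ⟨m, rfl⟩ := M.isUnit_iff_isUnit_det.2 (IsUnit.mk0 _ hM)
    obtain ⟨k, rfl⟩ := N.isUnit_iff_isUnit_det.2 (IsUnit.mk0 _ hN)
    rw [show g = m * k from Units.ext hg]
    exact S.mul_mem (hMS m rfl) (hNS k rfl)

end Generators

section IntegralOrthogonal

variable (κ K : Type*) [Fintype κ] [DecidableEq κ] [Field K]

/-- The group of integral orthogonal matrices, which are the signed permutation matrices. -/
noncomputable def signedPerm : orthogonalGroup κ ℤ →* GL κ K :=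
  MonoidHom.toHomUnits
    ((Int.castRingHom K).mapMatrix.toMonoidHom.comp (orthogonalGroup κ ℤ).subtype)

instance finite_orthogonalGroup_int : Finite (orthogonalGroup κ ℤ) := by
  have hbd (A : orthogonalGroup κ ℤ) (i j : κ) : A.1 i j ∈ Set.Icc (-1 : ℤ) 1 := by
    have hrow := congrFun (congrFun ((mem_orthogonalGroup_iff κ ℤ).1 A.2) i) i
    rw [mul_apply, one_apply_eq] at hrow
    have hsq : A.1 i j * A.1 i j ≤ 1 := hrow ▸
      Finset.single_le_sum (f := fun k => A.1 i k * A.1 i k)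
        (fun k _ => mul_self_nonneg _) (Finset.mem_univ j)
    exact ⟨by nlinarith, by nlinarith⟩
  refine Finite.of_injective
    (fun A : orthogonalGroup κ ℤ => fun i j => (⟨A.1 i j, hbd A i j⟩ : Set.Icc (-1 : ℤ) 1)) ?_
  intro A B h
  exact Subtype.ext (Matrix.ext fun i j => congrArg Subtype.val (congrFun (congrFun h i) j))

variable {κ K}

theorem exists_signedPerm_eq {A : GL κ K} {B : Matrix κ κ ℤ} (hB : B * Bᵀ = 1)
    (hA : A.1 = (Int.castRingHom K).mapMatrix B) : ∃ f, signedPerm κ K f = A :=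
  ⟨⟨B, (mem_orthogonalGroup_iff κ ℤ).2 hB⟩, Units.ext hA.symm⟩

theorem mapMatrix_single_one (i j : κ) :
    (Int.castRingHom K).mapMatrix (single i j 1) = single i j 1 := by
  rw [RingHom.mapMatrix_apply, map_single _ _ _ (Int.castRingHom K), map_one]

theorem exists_signedPerm_eq_dilation_single (i : κ) :
    ∃ f, signedPerm κ K f = dilation (isIdempotentElem_single i) (-1 : Kˣ) := by
  refine exists_signedPerm_eq (B := 1 - (2 : ℤ) • single i i 1) ?_ ?_
  · rw [transpose_sub, transpose_one, transpose_smul, transpose_single]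
    simp only [mul_sub, sub_mul, mul_one, one_mul, mul_smul_comm, smul_mul_assoc,
      single_mul_single_same]
    module
  · rw [coe_dilation_neg_one, map_sub, map_one, map_zsmul, mapMatrix_single_one, two_smul,
      two_smul]

theorem exists_signedPerm_eq_dilation_differenceProj [NeZero (2 : K)] {i j : κ} (h : i ≠ j) :
    ∃ f, signedPerm κ K f = dilation (isIdempotentElem_differenceProj h) (-1 : Kˣ) := by
  refine exists_signedPerm_eq
    (B := 1 - (single i i 1 + single j j 1 - single i j 1 - single j i 1)) ?_ ?_
  · simp only [transpose_sub, transpose_add, transpose_one, transpose_single]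
    simp only [mul_add, add_mul, mul_sub, sub_mul, mul_one, one_mul, single_mul_single_same,
      single_mul_single_of_ne _ _ _ _ h, single_mul_single_of_ne _ _ _ _ h.symm]
    abel
  · simp only [coe_dilation_neg_one, differenceProj, smul_inv_smul₀ (two_ne_zero (α := K)), map_sub,
      map_add, map_one, mapMatrix_single_one]

end IntegralOrthogonal

section NilpotentExtension

variable {K A C : Type*} [Field K] [CharZero K] [Ring A] [Algebra K A] [Ring C] [Algebra K C]

theorem isSemisimple_lmul_of_pow_eq_one {x : C} {N : ℕ} (hN : N ≠ 0) (hx : x ^ N = 1) :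
    (Algebra.lmul K C x).IsSemisimple := by
  refine Module.End.isSemisimple_of_squarefree_aeval_eq_zero
    (Polynomial.X_pow_sub_one_separable_iff.2 (Nat.cast_ne_zero.2 hN)).squarefree ?_
  rw [map_sub, map_pow, Polynomial.aeval_X, map_one, ← map_pow, hx, map_one, sub_self]

theorem eq_of_pow_eq_one_of_isNilpotent_sub [FiniteDimensional K C] {x y : C} {N : ℕ} (hN : N ≠ 0)
    (hxy : Commute x y) (hx : x ^ N = 1) (hy : y ^ N = 1) (hnil : IsNilpotent (x - y)) :
    x = y := by
  have hss := (isSemisimple_lmul_of_pow_eq_one (K := K) hN hx).sub_of_commute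
    (hxy.map (Algebra.lmul K C)) (isSemisimple_lmul_of_pow_eq_one hN hy)
  rw [← map_sub] at hss
  exact sub_eq_zero.1 (Algebra.lmul_injective (R := K) ((map_zero (Algebra.lmul K C)).symm ▸
    Module.End.eq_zero_of_isNilpotent_isSemisimple (hnil.map (Algebra.lmul K C)) hss))

variable {π : C →ₐ[K] A}

theorem isUnit_of_map_eq_natCast (hnil : ∀ x, π x = 0 → IsNilpotent x) {c : C} {m : ℕ}
    (hm : m ≠ 0) (hc : π c = m) : IsUnit c := by
  have hsub : IsNilpotent (c - (m : C)) := hnil _ (by rw [map_sub, hc, map_natCast, sub_self])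
  have hunit : IsUnit (m : C) := by
    simpa using (IsUnit.mk0 (m : K) (Nat.cast_ne_zero.2 hm)).map (algebraMap K C)
  simpa using hsub.isUnit_add_left_of_commute hunit (Nat.commute_cast _ _)

/-- The intertwiner is the sum of the `ρ₁ f * (ρ₂ f)⁻¹`. -/
theorem exists_conj_of_finite {F : Type*} [Group F] [Finite F]
    (hnil : ∀ x, π x = 0 → IsNilpotent x) {ρ₁ ρ₂ : F →* Cˣ} (h : ∀ f, π (ρ₁ f) = π (ρ₂ f)) :
    ∃ c : Cˣ, π c ∈ Set.center A ∧ ∀ f, ρ₁ f * c = c * ρ₂ f := by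
  have := Fintype.ofFinite F
  let c : C := ∑ f : F, (ρ₁ f * (ρ₂ f)⁻¹ : Cˣ).1
  have hterm (f : F) : π (ρ₁ f * (ρ₂ f)⁻¹ : Cˣ).1 = 1 := by
    rw [Units.val_mul, map_mul, h, ← map_mul, Units.mul_inv, map_one]
  have hπc : π c = Fintype.card F := by
    simp only [c, map_sum, hterm, Finset.sum_const, Finset.card_univ, nsmul_eq_mul, mul_one]
  obtain ⟨u, hu⟩ := isUnit_of_map_eq_natCast hnil Fintype.card_ne_zero hπc
  refine ⟨u, by rw [hu, hπc]; exact Set.natCast_mem_center A _, fun f => Units.ext ?_⟩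
  rw [Units.val_mul, Units.val_mul, hu, Finset.mul_sum, Finset.sum_mul,
    ← Equiv.sum_comp (Equiv.mulLeft f) fun g => (ρ₁ g * (ρ₂ g)⁻¹ : Cˣ).1 * (ρ₂ f).1]
  refine Finset.sum_congr rfl fun g _ => ?_
  rw [← Units.val_mul, ← Units.val_mul, Equiv.coe_mulLeft, map_mul, map_mul]
  congr 1
  group

/-- A set of units is line-closed if it contains the units on every affine line which it meets in
infinitely many points. Zariski-closed sets have this property. -/
def IsLineClosed (K : Type*) {C : Type*} [Field K] [Ring C] [Algebra K C] (S : Set Cˣ) : Prop :=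
  ∀ a b : C, {z : K | ∃ x ∈ S, x.1 = a + z • b}.Infinite →
    ∀ (z : K) (x : Cˣ), x.1 = a + z • b → x ∈ S

omit [CharZero K] in
theorem IsLineClosed.preimage_conj {S : Set Cˣ} (hS : IsLineClosed K S) (c : Cˣ) :
    IsLineClosed K ((fun x => c * x * c⁻¹) ⁻¹' S) := by
  have hline {x : Cˣ} {a b : C} {z : K} (hx : x.1 = a + z • b) :
      (c * x * c⁻¹).1 = c.1 * a * c⁻¹.1 + z • (c.1 * b * c⁻¹.1) := by
    rw [Units.val_mul, Units.val_mul, hx, mul_add, add_mul, mul_smul_comm, smul_mul_assoc]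
  intro a b hinf z x hx
  refine hS _ _ (hinf.mono ?_) z _ (hline hx)
  rintro w ⟨y, hy, hyw⟩
  exact ⟨_, hy, hline hyw⟩

theorem infinite_setOf_torsion [IsAlgClosed K] :
    {z : Kˣ | ∃ N : ℕ, N ≠ 0 ∧ z ^ N = 1}.Infinite := by
  have (N : ℕ) : ∃ z : Kˣ, IsPrimitiveRoot z (N + 1) := by
    obtain ⟨z, hz⟩ := HasEnoughRootsOfUnity.exists_primitiveRoot K (N + 1)
    exact ⟨_, hz.isUnit_unit N.succ_ne_zero⟩
  choose f hf using this
  refine Set.infinite_of_injective_forall_mem (f := f) (fun M N h => ?_)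
    fun N => ⟨N + 1, N.succ_ne_zero, (hf N).pow_eq_one⟩
  exact Nat.succ_injective ((hf M).unique (h ▸ hf N))

variable [FiniteDimensional K C] {ι : A →ₐ[K] C} {σ : Aˣ →* Cˣ} {e : A}

theorem map_dilation_eq_of_torsion (hπι : ∀ a, π (ι a) = a)
    (hnil : ∀ x, π x = 0 → IsNilpotent x) (hσ : ∀ a, π (σ a) = a) (he : IsIdempotentElem e)
    (hrefl : σ (dilation he (-1 : Kˣ)) = Units.map ι (dilation he (-1 : Kˣ))) {z : Kˣ} {N : ℕ}
    (hN : N ≠ 0) (hz : z ^ N = 1) : σ (dilation he z) = Units.map ι (dilation he z) := by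
  have hpow (ρ : Aˣ →* Cˣ) : (ρ (dilation he z)).1 ^ N = 1 := by
    rw [← Units.val_pow_eq_pow_val, ← map_pow, ← map_pow, hz, map_one, map_one, Units.val_one]
  have hcomm : Commute (σ (dilation he z)) (σ (dilation he (-1 : Kˣ))) :=
    ((Commute.all z (-1)).map (dilation he)).map σ
  rw [hrefl, map_dilation] at hcomm
  refine Units.ext (eq_of_pow_eq_one_of_isNilpotent_sub (K := K) hN ?_ (hpow σ)
    (hpow (Units.map ι)) (hnil _ ?_))
  · rw [map_dilation]
    exact commute_dilation_of_commute _
      (commute_of_commute_dilation_neg_one _ hcomm.units_val) z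
  · rw [map_sub, hσ, sub_eq_zero]
    exact (hπι _).symm

theorem map_dilation_eq_of_isLineClosed [IsAlgClosed K] (hπι : ∀ a, π (ι a) = a)
    (hnil : ∀ x, π x = 0 → IsNilpotent x) (hσ : ∀ a, π (σ a) = a)
    (hclosed : IsLineClosed K (σ.range : Set Cˣ)) (he : IsIdempotentElem e)
    (hrefl : σ (dilation he (-1 : Kˣ)) = Units.map ι (dilation he (-1 : Kˣ))) (z : Kˣ) :
    σ (dilation he z) = Units.map ι (dilation he z) := by
  have hline (w : Kˣ) : (Units.map (ι : A →* C) (dilation he w)).1 = (1 - ι e) + (w : K) • ι e := by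
    rw [← coe_dilation_eq_line (he.map ι), ← map_dilation]
  have hinf : {w : K | ∃ x ∈ (σ.range : Set Cˣ), x.1 = (1 - ι e) + w • ι e}.Infinite := by
    refine (infinite_setOf_torsion.image Units.val_injective.injOn).mono ?_
    rintro _ ⟨w, ⟨N, hN, hw⟩, rfl⟩
    exact ⟨_, ⟨dilation he w, map_dilation_eq_of_torsion hπι hnil hσ he hrefl hN hw⟩, hline w⟩
  obtain ⟨a, ha⟩ := hclosed _ _ hinf z _ (hline z)
  rw [← ha]
  refine congrArg σ (Units.ext ?_)
  rw [← hσ a, ha]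
  exact (hπι _).symm

end NilpotentExtension

section Complement

variable {κ K C : Type*} [Fintype κ] [DecidableEq κ] [Field K] [CharZero K] [IsAlgClosed K]
  [Ring C] [Algebra K C] [FiniteDimensional K C] {π : C →ₐ[K] Matrix κ κ K}
  {ι : Matrix κ κ K →ₐ[K] C}

theorem eq_map_of_isLineClosed_range (hπι : ∀ A, π (ι A) = A)
    (hnil : ∀ x, π x = 0 → IsNilpotent x) {σ : GL κ K →* Cˣ} (hσ : ∀ A, π (σ A) = A.1)
    (hclosed : IsLineClosed K (σ.range : Set Cˣ))
    (hfin : ∀ f, σ (signedPerm κ K f) = Units.map ι (signedPerm κ K f)) : σ = Units.map ι := by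
  have hdilation {e : Matrix κ κ K} (he : IsIdempotentElem e)
      (hrefl : ∃ f, signedPerm κ K f = dilation he (-1 : Kˣ)) (z : Kˣ) :
      dilation he z ∈ σ.eqLocus (Units.map (ι : Matrix κ κ K →* C)) := by
    obtain ⟨f, hf⟩ := hrefl
    exact map_dilation_eq_of_isLineClosed hπι hnil hσ hclosed he (hf ▸ hfin f) z
  exact MonoidHom.eq_of_eqOn_top fun A _ => (eq_top_of_dilation_mem
    (fun i => hdilation _ (exists_signedPerm_eq_dilation_single i))
    (fun h => hdilation _ (exists_signedPerm_eq_dilation_differenceProj h))).ge (Subgroup.mem_top A)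

/-- Both complements contain a copy of the finite group of signed permutation matrices; once these
copies are made equal by an averaging argument, the complements coincide. -/
theorem exists_conj_of_isLineClosed_complement (hπι : ∀ A, π (ι A) = A)
    (hnil : ∀ x, π x = 0 → IsNilpotent x) {H : Subgroup Cˣ}
    (hbij : Function.Bijective ((Units.map (π : C →* Matrix κ κ K)).comp H.subtype))
    (hclosed : IsLineClosed K (H : Set Cˣ)) :
    ∃ c : Cˣ, ∀ x : Cˣ, x ∈ H ↔ ∃ A : GL κ K, x = c * Units.map ι A * c⁻¹ := by
  let E : H ≃* GL κ K := MulEquiv.ofBijective _ hbij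
  let σ : GL κ K →* Cˣ := H.subtype.comp E.symm.toMonoidHom
  have hσ (A : GL κ K) : π (σ A) = A.1 := congrArg Units.val (E.apply_symm_apply A)
  have hσH (x : Cˣ) : x ∈ H ↔ ∃ A, σ A = x :=
    ⟨fun hx => ⟨E ⟨x, hx⟩, congrArg Subtype.val (E.symm_apply_apply ⟨x, hx⟩)⟩,
      fun ⟨A, hA⟩ => hA ▸ (E.symm A).2⟩
  obtain ⟨c, hπc, hc⟩ := exists_conj_of_finite hnil (ρ₁ := σ.comp (signedPerm κ K))
    (ρ₂ := (Units.map (ι : Matrix κ κ K →* C)).comp (signedPerm κ K))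
    fun f => (hσ _).trans (hπι _).symm
  let τ : GL κ K →* Cˣ := (MulAut.conj c⁻¹).toMonoidHom.comp σ
  have hτ (A : GL κ K) : τ A = c⁻¹ * σ A * c := by simp [τ]
  have hστ (A : GL κ K) : σ A = c * τ A * c⁻¹ := by rw [hτ]; group
  have hτι : τ = Units.map ι := by
    refine eq_map_of_isLineClosed_range hπι hnil (fun A => ?_) ?_ fun f => ?_
    · rw [hτ, Units.val_mul, Units.val_mul, map_mul, map_mul, hσ, mul_assoc,
        ← (Set.mem_center_iff.1 hπc).comm, ← mul_assoc, ← map_mul, Units.inv_mul, map_one, one_mul]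
    · convert hclosed.preimage_conj c using 1
      ext x
      simp only [SetLike.mem_coe, MonoidHom.mem_range, Set.mem_preimage, hσH, hστ,
        mul_left_inj, mul_right_inj]
    · rw [hτ, mul_assoc, show σ (signedPerm κ K f) * c = _ from hc f, inv_mul_cancel_left]
      rfl
  refine ⟨c, fun x => ?_⟩
  simp only [hσH, hστ, hτι, eq_comm]

end Complement

/-! ### Centralizers of unipotent elements -/

section Unipotent

variable {ι K : Type*} [Fintype ι] [DecidableEq ι]

theorem trace_eq_card_of_isNilpotent_sub_one [CommRing K] [IsReduced K] {M : Matrix ι ι K}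
    (h : IsNilpotent (M - 1)) : M.trace = Fintype.card ι := by
  have := (Matrix.isNilpotent_trace_of_isNilpotent h).eq_zero
  rwa [trace_sub, trace_one, sub_eq_zero] at this

theorem det_eq_one_of_isNilpotent_sub_one [CommRing K] [IsDomain K] {M : Matrix ι ι K}
    (h : IsNilpotent (M - 1)) : M.det = 1 := by
  have hchar := (Matrix.isNilpotent_charpoly_sub_pow_of_isNilpotent
    (neg_sub M 1 ▸ h.neg : IsNilpotent (1 - M))).eq_zero
  have heval := Matrix.eval_charpoly (1 - M) 1
  rw [sub_eq_zero.1 hchar] at heval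
  simpa using heval.symm

theorem eq_one_of_isNilpotent_sub_one_of_diagonal [CommRing K] [IsReduced K] {M : Matrix ι ι K}
    (h : IsNilpotent (M - 1)) (hM : ∀ i j, i ≠ j → M i j = 0) : M = 1 := by
  have hdiag : M - 1 = diagonal fun i => M i i - 1 := by
    ext i j
    rcases eq_or_ne i j with rfl | hij
    · simp
    · simp [hij, hM i j hij]
  obtain ⟨k, hk⟩ := h
  rw [hdiag, diagonal_pow, diagonal_eq_zero] at hk
  refine sub_eq_zero.1 (hdiag.trans (diagonal_eq_zero.2 (funext fun i => ?_)))
  exact IsReduced.eq_zero _ ⟨k, congrFun hk i⟩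

variable [Field K] [CharZero K] [Nonempty ι]

theorem eq_of_mk_eq_mk_of_isNilpotent {g h : GL ι K} (hgh : mk g = mk h)
    (hg : IsNilpotent (g.1 - 1)) (hh : IsNilpotent (h.1 - 1)) : g = h := by
  obtain ⟨c, hc⟩ := mk_eq_mk_iff_smul.1 hgh
  have htrace := congrArg Matrix.trace hc
  rw [trace_smul, trace_eq_card_of_isNilpotent_sub_one hg,
    trace_eq_card_of_isNilpotent_sub_one hh, smul_eq_mul, eq_comm,
    mul_eq_right₀ (Nat.cast_ne_zero.2 Fintype.card_ne_zero)] at htrace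
  rw [htrace, one_smul] at hc
  exact Units.ext hc.symm

theorem commute_of_commute_mk_of_isNilpotent {g x : GL ι K} (hg : IsNilpotent (g.1 - 1))
    (h : Commute (mk x) (mk g)) : Commute x g := by
  have hconj : IsNilpotent ((x * g * x⁻¹).1 - 1) := by
    have := hg.map (conjAut ι K (mk x))
    rwa [map_sub, map_one, conjAut_mk, ← Units.val_mul, ← Units.val_mul] at this
  rw [commute_iff_eq, ← mul_inv_eq_iff_eq_mul]
  refine eq_of_mk_eq_mk_of_isNilpotent ?_ hconj hg
  rw [map_mul, map_mul, map_inv, h.eq, mul_inv_cancel_right]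

end Unipotent

section ZariskiClosed

variable {n : ℕ} {S : Set PGL(n, ℂ)}

theorem exists_mvPolynomial_eval_eq {I R : Type*} [Finite I] [CommRing R]
    (f : Module.Dual R (Matrix I I R)) :
    ∃ p : MvPolynomial (I × I) R, ∀ M, MvPolynomial.eval (fun ij => M ij.1 ij.2) p = f M := by
  classical
  have := Fintype.ofFinite I
  refine ⟨∑ i, ∑ j, MvPolynomial.C (f (single i j 1)) * MvPolynomial.X (i, j), fun M => ?_⟩
  conv_rhs => rw [matrix_eq_sum_single M]
  simp only [map_sum, map_mul, MvPolynomial.eval_C, MvPolynomial.eval_X]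
  refine Finset.sum_congr rfl fun i _ => Finset.sum_congr rfl fun j _ => ?_
  rw [← mul_one (M i j), ← smul_eq_mul (M i j), ← smul_single, map_smul, smul_eq_mul, smul_eq_mul,
    mul_one, mul_comm]

theorem isZariskiClosed_of_submodule (W : Submodule ℂ (Matrix (Fin n) (Fin n) ℂ))
    (h : ∀ g : GL (Fin n) ℂ, mk g ∈ S ↔ g.1 ∈ W) : IsZariskiClosed S := by
  choose p hp using exists_mvPolynomial_eval_eq (I := Fin n) (R := ℂ)
  refine ⟨p '' W.dualAnnihilator, fun g => ?_⟩
  rw [h, Set.forall_mem_image, ← Subspace.forall_mem_dualAnnihilator_apply_eq_zero_iff W]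
  simp only [hp, SetLike.mem_coe]

theorem exists_polynomial_eval_line {σ R : Type*} [CommRing R] (a b : σ → R)
    (p : MvPolynomial σ R) :
    ∃ q : Polynomial R, ∀ z, q.eval z = MvPolynomial.eval (a + z • b) p := by
  refine ⟨MvPolynomial.aeval (fun s => Polynomial.C (a s) + Polynomial.X * Polynomial.C (b s)) p,
    fun z => ?_⟩
  have hhom : (Polynomial.aeval z).comp
      (MvPolynomial.aeval fun s => Polynomial.C (a s) + Polynomial.X * Polynomial.C (b s)) =
      MvPolynomial.aeval (a + z • b) :=
    MvPolynomial.algHom_ext fun s => by simpa using mul_comm (b s) z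
  simpa using DFunLike.congr_fun hhom p

theorem IsZariskiClosed.isLineClosed {C : Type*} [Ring C] [Algebra ℂ C] (hS : IsZariskiClosed S)
    (f : C →ₐ[ℂ] Matrix (Fin n) (Fin n) ℂ) :
    IsLineClosed ℂ ((fun x => mk (Units.map (f : C →* Matrix (Fin n) (Fin n) ℂ) x)) ⁻¹' S) := by
  intro a b hinf z x hx
  obtain ⟨I, hI⟩ := hS
  refine (hI _).2 fun p hp => ?_
  obtain ⟨q, hq⟩ := exists_polynomial_eval_line (fun ij : Fin n × Fin n => f a ij.1 ij.2)
    (fun ij => f b ij.1 ij.2) p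
  have heval {y : Cˣ} {w : ℂ} (hy : y.1 = a + w • b) :
      MvPolynomial.eval (fun ij : Fin n × Fin n => f y ij.1 ij.2) p = q.eval w := by
    rw [hq, hy, map_add, map_smul]
    rfl
  have hq0 : q = 0 := by
    refine Polynomial.eq_zero_of_infinite_isRoot q (hinf.mono ?_)
    rintro w ⟨y, hy, hw⟩
    exact (heval hw).symm.trans ((hI _).1 hy p hp)
  exact (heval hx).trans (by rw [hq0, Polynomial.eval_zero])

end ZariskiClosed

section Centralizer

variable {ι K : Type*} [Fintype ι] [DecidableEq ι] [Field K]

/-- The nonzero scalars, as units of a `K`-algebra. -/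
noncomputable def scalarUnits (K C : Type*) [Field K] [Ring C] [Algebra K C] : Subgroup Cˣ :=
  (Units.map (algebraMap K C : K →* C)).range

theorem mem_scalarUnits {C : Type*} [Ring C] [Algebra K C] {x : Cˣ} :
    x ∈ scalarUnits K C ↔ ∃ c : Kˣ, x.1 = algebraMap K C c := by
  refine exists_congr fun c => ?_
  rw [Units.ext_iff, eq_comm]
  rfl

theorem mem_scalarUnits_iff_mem_bot {C : Type*} [Ring C] [Algebra K C] {x : Cˣ} :
    x ∈ scalarUnits K C ↔ x.1 ∈ (⊥ : Subalgebra K C) := by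
  rw [mem_scalarUnits, Algebra.mem_bot]
  refine ⟨fun ⟨c, hc⟩ => ⟨c, hc.symm⟩, fun ⟨c, hc⟩ => ?_⟩
  rcases eq_or_ne c 0 with rfl | hc0
  · have : Subsingleton C := by
      rw [← subsingleton_iff_zero_eq_one, ← isUnit_zero_iff, ← map_zero (algebraMap K C), hc]
      exact x.isUnit
    exact ⟨1, Subsingleton.elim _ _⟩
  · exact ⟨Units.mk0 c hc0, hc.symm⟩

instance normal_scalarUnits (C : Type*) [Ring C] [Algebra K C] : (scalarUnits K C).Normal := by
  refine ⟨fun x hx y => ?_⟩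
  obtain ⟨c, hc⟩ := mem_scalarUnits.1 hx
  have hcomm : y * x = x * y := Units.ext <| by
    rw [Units.val_mul, Units.val_mul, hc, Algebra.commutes]
  rwa [hcomm, mul_inv_cancel_right]

theorem map_mem_scalarUnits {B C : Type*} [Ring B] [Algebra K B] [Ring C] [Algebra K C]
    (f : C →ₐ[K] B) {x : Cˣ} (hx : x ∈ scalarUnits K C) :
    Units.map (f : C →* B) x ∈ scalarUnits K B := by
  obtain ⟨c, rfl⟩ := hx
  exact ⟨c, Units.ext (f.commutes c).symm⟩

/-- The algebra of the matrices commuting with `g`. -/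
abbrev matrixCentralizer (g : GL ι K) : Subalgebra K (Matrix ι ι K) :=
  Subalgebra.centralizer K {g.1}

/-- The map to `PGL` from the group of the invertible matrices commuting with `g`. -/
noncomputable def centralizerToPGL (g : GL ι K) : (matrixCentralizer g)ˣ →* PGL(ι, K) :=
  mk.comp (Units.map ((matrixCentralizer g).val : matrixCentralizer g →* Matrix ι ι K))

variable {g : GL ι K}

theorem exists_unit_matrixCentralizer {x : GL ι K} (hx : x.1 ∈ matrixCentralizer g) :
    ∃ y : (matrixCentralizer g)ˣ,
      Units.map ((matrixCentralizer g).val : matrixCentralizer g →* Matrix ι ι K) y = x := by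
  have hx' : x⁻¹.1 ∈ matrixCentralizer g := by
    rw [Subalgebra.mem_centralizer_iff] at hx ⊢
    exact fun y hy => (Commute.units_inv_right (hx y hy : Commute y x.1)).eq
  exact ⟨⟨⟨x.1, hx⟩, ⟨x⁻¹.1, hx'⟩, Subtype.ext (by simp), Subtype.ext (by simp)⟩, Units.ext rfl⟩

theorem ker_centralizerToPGL : (centralizerToPGL g).ker = scalarUnits K (matrixCentralizer g) := by
  ext x
  rw [MonoidHom.mem_ker, centralizerToPGL, MonoidHom.comp_apply, mk_eq_one_iff_smul,
    mem_scalarUnits]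
  refine exists_congr fun c => ?_
  rw [Algebra.algebraMap_eq_smul_one, Subtype.ext_iff]
  rfl

theorem exists_unit_of_mk_mem_centralizer [CharZero K] [Nonempty ι] (hg : IsNilpotent (g.1 - 1))
    {x : GL ι K} (hx : mk x ∈ Subgroup.centralizer {mk g}) :
    ∃ y : (matrixCentralizer g)ˣ,
      Units.map ((matrixCentralizer g).val : matrixCentralizer g →* Matrix ι ι K) y = x := by
  have hcomm : Commute (mk x) (mk g) := (Subgroup.mem_centralizer_singleton_iff.1 hx)
  refine exists_unit_matrixCentralizer ((Subalgebra.mem_centralizer_iff K).2 ?_)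
  rintro _ rfl
  exact (commute_of_commute_mk_of_isNilpotent hg hcomm).symm.units_val.eq

theorem range_centralizerToPGL [CharZero K] [Nonempty ι] (hg : IsNilpotent (g.1 - 1)) :
    (centralizerToPGL g).range = Subgroup.centralizer {mk g} := by
  ext y
  constructor
  · rintro ⟨x, rfl⟩
    rw [Subgroup.mem_centralizer_singleton_iff, centralizerToPGL, MonoidHom.comp_apply, ← map_mul,
      ← map_mul]
    exact congrArg mk (Units.ext ((Subalgebra.mem_centralizer_iff K).1 x.1.2 g.1 rfl).symm)
  · intro h
    obtain ⟨x, rfl⟩ := mk_surjective y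
    obtain ⟨z, rfl⟩ := exists_unit_of_mk_mem_centralizer hg h
    exact ⟨z, rfl⟩

end Centralizer

theorem isZariskiClosed_of_le_range_centralizerToPGL {n : ℕ} {g : GL (Fin n) ℂ}
    {H : Subgroup PGL(n, ℂ)} (W : Submodule ℂ (matrixCentralizer g))
    (hH : H ≤ (centralizerToPGL g).range) (hW : ∀ x, centralizerToPGL g x ∈ H ↔ x.1 ∈ W) :
    IsZariskiClosed (H : Set PGL(n, ℂ)) := by
  refine isZariskiClosed_of_submodule (W.map (matrixCentralizer g).val.toLinearMap) fun x => ?_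
  constructor
  · intro hx
    obtain ⟨y, hy⟩ := hH hx
    obtain ⟨c, hc⟩ := mk_eq_mk_iff_smul.1 hy
    refine ⟨c • y.1, W.smul_mem _ ((hW y).1 (hy ▸ hx)), hc.symm⟩
  · rintro ⟨y, hy, hyx⟩
    obtain ⟨z, rfl⟩ := exists_unit_matrixCentralizer (x := x) (g := g) (hyx ▸ y.2)
    exact (hW z).2 ((Subtype.ext hyx : y = z.1) ▸ hy)

section NilSplitting

/-- A presentation of the algebra `C` as a split extension of the algebra `B` by a nil ideal. For
the centralizer of a unipotent matrix, `B` is a product of matrix algebras. -/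
structure NilSplitting (K C B : Type*) [CommSemiring K] [Ring C] [Algebra K C] [Ring B]
    [Algebra K B] where
  ofSplit ::
  /-- The reduction modulo the nil ideal. -/
  red : C →ₐ[K] B
  /-- The splitting. -/
  emb : B →ₐ[K] C
  red_emb : ∀ b, red (emb b) = b
  isNilpotent_of_red_eq_zero : ∀ x, red x = 0 → IsNilpotent x

namespace NilSplitting

/-- Transport of a splitting along isomorphisms. -/
def congr {K C B C' B' : Type*} [CommSemiring K] [Ring C] [Algebra K C] [Ring B] [Algebra K B]
    [Ring C'] [Algebra K C'] [Ring B'] [Algebra K B'] (L : NilSplitting K C B) (Φ : C ≃ₐ[K] C')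
    (Ψ : B ≃ₐ[K] B') : NilSplitting K C' B' where
  red := (Ψ : B →ₐ[K] B').comp (L.red.comp Φ.symm)
  emb := (Φ : C →ₐ[K] C').comp (L.emb.comp Ψ.symm)
  red_emb b := by simp [L.red_emb]
  isNilpotent_of_red_eq_zero x hx := by
    have hx' : L.red (Φ.symm x) = 0 := by simpa using hx
    simpa using (L.isNilpotent_of_red_eq_zero _ hx').map Φ

variable {K C B : Type*} [Field K] [Ring C] [Algebra K C] [Ring B] [Algebra K B]
  (L : NilSplitting K C B)

/-- The units of `C` whose reduction is scalar. For the centralizer of a unipotent matrix, their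
image in `PGL` is the unipotent radical. -/
noncomputable def scalarRed : Subgroup Cˣ :=
  (scalarUnits K B).comap (Units.map (L.red : C →* B))

instance normal_scalarRed : L.scalarRed.Normal :=
  inferInstanceAs ((scalarUnits K B).comap (Units.map (L.red : C →* B))).Normal

theorem mem_scalarRed {x : Cˣ} : x ∈ L.scalarRed ↔ ∃ c : Kˣ, L.red x.1 = algebraMap K B c :=
  mem_scalarUnits

theorem scalarUnits_le_scalarRed : scalarUnits K C ≤ L.scalarRed := fun _ hx =>
  map_mem_scalarUnits L.red hx

theorem mem_scalarRed_of_red_eq {x y : Cˣ} (h : L.red x.1 = L.red y.1) : x⁻¹ * y ∈ L.scalarRed := by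
  refine L.mem_scalarRed.2 ⟨1, ?_⟩
  rw [Units.val_mul, map_mul, ← h, ← map_mul, Units.inv_mul, Units.val_one, map_one, map_one]

theorem range_emb_inf_scalarRed_le :
    (Units.map (L.emb : B →* C)).range ⊓ L.scalarRed ≤ scalarUnits K C := by
  rintro _ ⟨⟨b, rfl⟩, hb⟩
  obtain ⟨c, hc⟩ := L.mem_scalarRed.1 hb
  have hbc : b.1 = algebraMap K B c := (L.red_emb b.1).symm.trans hc
  exact map_mem_scalarUnits L.emb (mem_scalarUnits.2 ⟨c, hbc⟩)

theorem range_emb_sup_scalarRed : (Units.map (L.emb : B →* C)).range ⊔ L.scalarRed = ⊤ := by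
  refine eq_top_iff.2 fun x _ => ?_
  have hx : x = Units.map (L.emb : B →* C) (Units.map (L.red : C →* B) x) *
      ((Units.map (L.emb : B →* C) (Units.map (L.red : C →* B) x))⁻¹ * x) :=
    (mul_inv_cancel_left _ _).symm
  rw [hx]
  exact Subgroup.mul_mem_sup ⟨_, rfl⟩ (L.mem_scalarRed_of_red_eq (L.red_emb _))

end NilSplitting

end NilSplitting

namespace NilSplitting

section Radical

variable {ι K B : Type*} [Fintype ι] [DecidableEq ι] [Field K] [Ring B] [Algebra K B] {g : GL ι K}
  (L : NilSplitting K (matrixCentralizer g) B)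

/-- The unipotent radical of the centralizer of the class of `g`. -/
noncomputable def radical : Subgroup PGL(ι, K) := L.scalarRed.map (centralizerToPGL g)

/-- The standard reductive part of the centralizer of the class of `g`. -/
noncomputable def levi : Subgroup PGL(ι, K) :=
  (Units.map (L.emb : B →* matrixCentralizer g)).range.map (centralizerToPGL g)

theorem comap_radical : L.radical.comap (centralizerToPGL g) = L.scalarRed :=
  Subgroup.comap_map_eq_self (ker_centralizerToPGL.trans_le L.scalarUnits_le_scalarRed)

theorem centralizerToPGL_mem_radical {x : (matrixCentralizer g)ˣ} :
    centralizerToPGL g x ∈ L.radical ↔ x ∈ L.scalarRed := by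
  rw [← L.comap_radical, Subgroup.mem_comap]

theorem centralizerToPGL_mem_levi {x : (matrixCentralizer g)ˣ} :
    centralizerToPGL g x ∈ L.levi ↔ x.1 ∈ L.emb.range := by
  have hker : (centralizerToPGL g).ker ≤ (Units.map (L.emb : B →* matrixCentralizer g)).range := by
    rw [ker_centralizerToPGL]
    rintro _ ⟨c, rfl⟩
    exact ⟨Units.map (algebraMap K B : K →* B) c, Units.ext (L.emb.commutes c)⟩
  rw [levi, ← Subgroup.mem_comap, Subgroup.comap_map_eq_self hker]
  constructor
  · rintro ⟨b, rfl⟩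
    exact ⟨b, rfl⟩
  · rintro ⟨b, hb⟩
    have : L.emb (L.red x.1) = x.1 := hb ▸ congrArg L.emb (L.red_emb b)
    exact ⟨Units.map (L.red : matrixCentralizer g →* B) x, Units.ext this⟩

theorem levi_inf_radical : L.levi ⊓ L.radical = ⊥ := by
  rw [eq_bot_iff]
  rintro _ ⟨⟨x, hx, rfl⟩, hr⟩
  have := L.range_emb_inf_scalarRed_le ⟨hx, L.centralizerToPGL_mem_radical.1 hr⟩
  rwa [← ker_centralizerToPGL] at this

variable [CharZero K] [Nonempty ι]

theorem levi_sup_radical (hg : IsNilpotent (g.1 - 1)) :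
    L.levi ⊔ L.radical = Subgroup.centralizer {mk g} := by
  rw [levi, radical, ← Subgroup.map_sup, range_emb_sup_scalarRed, ← MonoidHom.range_eq_map,
    range_centralizerToPGL hg]

theorem centralizer_le_normalizer_radical (hg : IsNilpotent (g.1 - 1)) :
    Subgroup.centralizer {mk g} ≤ Subgroup.normalizer (L.radical : Set PGL(ι, K)) := by
  rw [← range_centralizerToPGL hg, MonoidHom.range_eq_map,
    ← Subgroup.normalizer_eq_top (H := L.scalarRed)]
  exact Subgroup.le_normalizer_map _

end Radical

section Complex

variable {n : ℕ} {B : Type*} [Ring B] [Algebra ℂ B] {g : GL (Fin n) ℂ}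
  (L : NilSplitting ℂ (matrixCentralizer g) B)

theorem isZariskiClosed_radical : IsZariskiClosed (L.radical : Set PGL(n, ℂ)) := by
  refine isZariskiClosed_of_le_range_centralizerToPGL
    ((Subalgebra.toSubmodule ⊥).comap L.red.toLinearMap) (Subgroup.map_le_range _ _) fun x => ?_
  rw [L.centralizerToPGL_mem_radical]
  exact mem_scalarUnits_iff_mem_bot (x := Units.map (L.red : matrixCentralizer g →* B) x)

theorem isZariskiClosed_levi : IsZariskiClosed (L.levi : Set PGL(n, ℂ)) :=
  isZariskiClosed_of_le_range_centralizerToPGL (Subalgebra.toSubmodule L.emb.range)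
    (Subgroup.map_le_range _ _) fun _ => L.centralizerToPGL_mem_levi

theorem isUnipotentElt_of_mem_radical {y : PGL(n, ℂ)} (hy : y ∈ L.radical) : IsUnipotentElt y := by
  obtain ⟨x, hx, rfl⟩ := hy
  obtain ⟨c, hc⟩ := L.mem_scalarRed.1 hx
  refine ⟨GeneralLinearGroup.scalar _ c⁻¹ * Units.map
    ((matrixCentralizer g).val : matrixCentralizer g →* Matrix (Fin n) (Fin n) ℂ) x, ?_, ?_⟩
  · exact (mk_eq_mk_iff_smul.2 ⟨c⁻¹, coe_scalar_mul _ _⟩).symm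
  · have hred : L.red ((c⁻¹ : ℂˣ).1 • x.1 - 1) = 0 := by
      rw [map_sub, map_smul, hc, map_one, Algebra.algebraMap_eq_smul_one, smul_smul, Units.inv_mul,
        one_smul, sub_self]
    rw [coe_scalar_mul]
    exact (L.isNilpotent_of_red_eq_zero _ hred).map (matrixCentralizer g).val

end Complex

end NilSplitting

section BlockSubalgebra

variable {κ α R : Type*} [Fintype κ] [DecidableEq κ] [CommRing R] {a : κ → α}

/-- The block diagonal matrices, for the blocks given by the fibres of `a`. -/
def blockSubalgebra (R : Type*) [CommRing R] (a : κ → α) : Subalgebra R (Matrix κ κ R) where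
  carrier := {M | ∀ j l, a j ≠ a l → M j l = 0}
  mul_mem' {M N} hM hN j l h := by
    rw [mul_apply]
    refine Finset.sum_eq_zero fun k _ => ?_
    by_cases hk : a j = a k
    · rw [hN k l (hk ▸ h), mul_zero]
    · rw [hM j k hk, zero_mul]
  add_mem' {M N} hM hN j l h := by rw [Matrix.add_apply, hM j l h, hN j l h, add_zero]
  algebraMap_mem' c j l h := by
    rw [algebraMap_matrix_apply, if_neg fun e => h (congrArg a e)]

theorem transvection_mem_blockSubalgebra {j l : κ} (ha : a j = a l) (s : R) :
    transvection j l s ∈ blockSubalgebra R a := by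
  refine (blockSubalgebra R a).add_mem (blockSubalgebra R a).one_mem fun p q hpq => ?_
  refine single_apply_of_ne _ _ _ _ _ ?_
  rintro ⟨rfl, rfl⟩
  exact hpq ha

theorem exists_unit_blockSubalgebra_eq_transvection {j l : κ} (hjl : j ≠ l) (ha : a j = a l)
    (s : R) : ∃ h : (blockSubalgebra R a)ˣ,
      h.1.1 = transvection j l s ∧ h⁻¹.1.1 = transvection j l (-s) := by
  have hmul (t : R) : transvection j l t * transvection j l (-t) = 1 := by
    rw [transvection_mul_transvection_same _ _ hjl, add_neg_cancel, transvection_zero]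
  exact ⟨⟨⟨_, transvection_mem_blockSubalgebra ha s⟩, ⟨_, transvection_mem_blockSubalgebra ha (-s)⟩,
    Subtype.ext (hmul s), Subtype.ext (by simpa using hmul (-s))⟩, rfl, rfl⟩

variable {K : Type*} [Field K]

theorem trace_mul_transvection_mul_mul_transvection_neg (b : Matrix κ κ R) (j l : κ) (s : R) :
    (b * transvection j l s * b * transvection j l (-s)).trace =
      (b * b).trace - s ^ 2 * b l j ^ 2 := by
  have hsingle (t : R) : single j l t = t • single j l (1 : R) := by
    rw [smul_single, smul_eq_mul, mul_one]
  have hlin : (b * single j l 1 * b).trace = (b * b * single j l 1).trace := by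
    rw [trace_mul_comm, ← mul_assoc]
  have hquad : (b * single j l 1 * b * single j l 1).trace = b l j ^ 2 := by
    have : single j l (1 : R) * b * single j l 1 = b l j • single j l 1 := by
      rw [single_mul_mul_single, smul_single]
      simp
    rw [mul_assoc b, mul_assoc b, this, mul_smul_comm, trace_smul, trace_mul_single]
    simp [sq]
  rw [transvection, transvection, hsingle s, hsingle (-s)]
  simp only [mul_add, add_mul, mul_one, mul_smul_comm, smul_mul_assoc, trace_add, trace_smul, hlin,
    hquad, smul_eq_mul]
  ring

-- Some `s` makes the trace equal to `2 * card κ`, but `2` is not a root of unity.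
theorem apply_eq_zero_of_trace_mul_transvection [IsAlgClosed K] [CharZero K] {k : ℕ} (hk : k ≠ 0)
    {b : Matrix κ κ K} {j l : κ}
    (h : ∀ s : K, ∃ c : K, c ^ k = 1 ∧
      (b * transvection j l s * b * transvection j l (-s)).trace = c * Fintype.card κ) :
    b l j = 0 := by
  by_contra hb
  obtain ⟨s, hs⟩ := IsAlgClosed.exists_pow_nat_eq
    (((b * b).trace - 2 * Fintype.card κ) / (b l j) ^ 2) (n := 2) two_pos
  obtain ⟨c, hc, htrace⟩ := h s
  have hcard : (Fintype.card κ : K) ≠ 0 := Nat.cast_ne_zero.2 (Fintype.card_pos_iff.2 ⟨j⟩).ne'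
  rw [trace_mul_transvection_mul_mul_transvection_neg, hs, div_mul_cancel₀ _ (pow_ne_zero 2 hb),
    sub_sub_cancel] at htrace
  rw [← mul_right_cancel₀ hcard htrace] at hc
  exact (Nat.one_lt_two_pow hk).ne' (by exact_mod_cast hc)

end BlockSubalgebra

namespace NilSplitting

variable {n : ℕ} {κ α : Type*} [Fintype κ] [DecidableEq κ] {a : κ → α} {g : GL (Fin n) ℂ}
  (L : NilSplitting ℂ (matrixCentralizer g) (blockSubalgebra ℂ a))

theorem isNilpotent_coe_red_sub_one {w : matrixCentralizer g} (hw : IsNilpotent (w.1 - 1)) :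
    IsNilpotent ((L.red w).1 - 1) := by
  have hw' : IsNilpotent (w - 1) :=
    (IsNilpotent.map_iff (f := (matrixCentralizer g).val) Subtype.val_injective).1 hw
  simpa using (hw'.map L.red).map (blockSubalgebra ℂ a).val

theorem exists_trace_red_eq {w : (matrixCentralizer g)ˣ} (hdet : w.1.1.det = 1)
    (hw : IsUnipotentElt (centralizerToPGL g w)) :
    ∃ c : ℂ, c ^ n = 1 ∧ (L.red w.1).1.trace = c * Fintype.card κ := by
  obtain ⟨v, hv, hvnil⟩ := hw
  obtain ⟨c, hc⟩ := mk_eq_mk_iff_smul.1 hv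
  replace hc : w.1.1 = (c : ℂ) • v.1 := hc
  refine ⟨c, ?_, ?_⟩
  · rwa [hc, det_smul, det_eq_one_of_isNilpotent_sub_one hvnil, Fintype.card_fin, mul_one] at hdet
  · have hv' : ((c⁻¹ : ℂˣ).1 • w.1).1 = v.1 := by
      rw [Subalgebra.coe_smul, hc, smul_smul, Units.inv_mul, one_smul]
    have htrace := trace_eq_card_of_isNilpotent_sub_one
      (L.isNilpotent_coe_red_sub_one (hv' ▸ hvnil))
    rw [map_smul, Subalgebra.coe_smul, trace_smul, smul_eq_mul] at htrace
    rw [← htrace, Units.mul_inv_cancel_left]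

variable [NeZero n]

theorem red_eq_one_of_conj {z : (matrixCentralizer g)ˣ} (hz : IsNilpotent (z.1.1 - 1))
    (hconj : ∀ e, IsUnipotentElt (centralizerToPGL g (z * (e * z * e⁻¹)))) : L.red z.1 = 1 := by
  have hdet (e : (matrixCentralizer g)ˣ) : (z * (e * z * e⁻¹)).1.1.det = 1 := by
    have hz1 := det_eq_one_of_isNilpotent_sub_one hz
    have := det_units_conj (Units.map
      ((matrixCentralizer g).val : matrixCentralizer g →* Matrix (Fin n) (Fin n) ℂ) e) z.1.1
    exact (det_mul _ _).trans (by rw [hz1, one_mul]; exact this.trans hz1)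
  refine Subtype.ext (eq_one_of_isNilpotent_sub_one_of_diagonal
    (L.isNilpotent_coe_red_sub_one hz) fun l j hlj => ?_)
  by_cases ha : a l = a j
  swap
  · exact (L.red z.1).2 l j ha
  refine apply_eq_zero_of_trace_mul_transvection (NeZero.ne n) fun s => ?_
  obtain ⟨h, hs, hs'⟩ := exists_unit_blockSubalgebra_eq_transvection hlj.symm ha.symm s
  set e := Units.map (L.emb : blockSubalgebra ℂ a →* matrixCentralizer g) h
  have hred : (L.red (z * (e * z * e⁻¹)).1).1 =
      (L.red z.1).1 * transvection j l s * (L.red z.1).1 * transvection j l (-s) := by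
    have he : L.red e.1 = h.1 := L.red_emb _
    have he' : L.red e⁻¹.1 = h⁻¹.1 := L.red_emb _
    simp only [Units.val_mul, map_mul, he, he', MulMemClass.coe_mul, hs, hs', mul_assoc]
  rw [← hred]
  exact L.exists_trace_red_eq (hdet e) (hconj e)

theorem le_radical_of_normal (hg : IsNilpotent (g.1 - 1)) {U : Subgroup PGL(n, ℂ)}
    (hU : U ≤ Subgroup.centralizer {mk g})
    (hnormal : (U.subgroupOf (Subgroup.centralizer {mk g})).Normal)
    (hunip : ∀ x ∈ U, IsUnipotentElt x) : U ≤ L.radical := by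
  intro y hy
  obtain ⟨x, rfl, hx⟩ := hunip y hy
  obtain ⟨z, rfl⟩ := exists_unit_of_mk_mem_centralizer hg (hU hy)
  refine L.centralizerToPGL_mem_radical.2 (L.mem_scalarRed.2 ⟨1, ?_⟩)
  rw [L.red_eq_one_of_conj hx fun e => hunip _ ?_, Units.val_one, map_one]
  have he : centralizerToPGL g e ∈ Subgroup.centralizer {mk g} :=
    range_centralizerToPGL hg ▸ ⟨e, rfl⟩
  rw [map_mul, map_mul, map_mul, map_inv]
  exact U.mul_mem hy (hnormal.conj_mem ⟨_, hU hy⟩ hy ⟨_, he⟩)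

theorem isUnipotentRadical_radical (hg : IsNilpotent (g.1 - 1)) :
    IsUnipotentRadical (Subgroup.centralizer {mk g}) L.radical := by
  have hle : L.radical ≤ Subgroup.centralizer {mk g} := L.levi_sup_radical hg ▸ le_sup_right
  exact ⟨⟨hle, (Subgroup.normal_subgroupOf_iff_le_normalizer hle).2
    (L.centralizer_le_normalizer_radical hg), L.isZariskiClosed_radical,
    fun x hx => L.isUnipotentElt_of_mem_radical hx⟩,
    fun U hU => L.le_radical_of_normal hg hU.1 hU.2.1 hU.2.2.2⟩

theorem isReductivePart_levi (hg : IsNilpotent (g.1 - 1)) : IsReductivePart (mk g) L.levi :=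
  ⟨L.isZariskiClosed_levi, L.radical, L.isUnipotentRadical_radical hg, L.levi_inf_radical,
    L.levi_sup_radical hg⟩

theorem inf_sup_radical_of_isReductivePart (hg : IsNilpotent (g.1 - 1)) {Γ : Subgroup PGL(n, ℂ)}
    (hΓ : IsReductivePart (mk g) Γ) :
    Γ ⊓ L.radical = ⊥ ∧ Γ ⊔ L.radical = Subgroup.centralizer {mk g} := by
  obtain ⟨-, R, hR, hinf, hsup⟩ := hΓ
  rw [(L.isUnipotentRadical_radical hg).unique hR]
  exact ⟨hinf, hsup⟩

end NilSplitting

section Center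

variable {κ α : Type*} [Fintype κ] [DecidableEq κ] {a : κ → α}

theorem ellipticPairs_eq_empty {H : Type*} [Group H] (ss : H → Prop)
    (hH : (Subgroup.center H : Set H).Infinite) : ellipticPairs ss = ∅ :=
  Set.eq_empty_of_forall_notMem fun _ hx =>
    hH (hx.2.2.2.subset (Subgroup.center_le_centralizer _))

/-- The block diagonal matrix whose block at `b` is the scalar matrix `v b`. -/
noncomputable def blockScalar (R : Type*) [CommRing R] (a : κ → α) :
    (α → R) →ₐ[R] blockSubalgebra R a :=
  ((diagonalAlgHom R).comp (AlgHom.pi fun k => Pi.evalAlgHom R _ (a k))).codRestrict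
    (blockSubalgebra R a)
    fun _ _ _ h => diagonal_apply_ne _ fun e => h (congrArg a e)

theorem blockScalar_apply {R : Type*} [CommRing R] (v : α → R) :
    (blockScalar R a v).1 = diagonal (v ∘ a) := rfl

theorem commute_blockScalar {R : Type*} [CommRing R] (v : α → R) (M : blockSubalgebra R a) :
    Commute (blockScalar R a v) M := by
  refine Subtype.ext (Matrix.ext fun j l => ?_)
  change ((blockScalar R a v).1 * M.1) j l = (M.1 * (blockScalar R a v).1) j l
  rw [blockScalar_apply, diagonal_mul, mul_diagonal, Function.comp_apply, Function.comp_apply]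
  by_cases h : a j = a l
  · rw [h, mul_comm]
  · rw [M.2 j l h, mul_zero, zero_mul]

theorem infinite_center_of_ker_eq_scalarUnits {K : Type*} [Field K] [Infinite K] {G : Type*}
    [Group G] {F : (blockSubalgebra K a)ˣ →* G} (hF : Function.Surjective F)
    (hker : F.ker = scalarUnits K _) {j l : κ} (hjl : a j ≠ a l) :
    (Subgroup.center G : Set G).Infinite := by
  classical
  let f : Kˣ →* G := (F.comp (Units.map (blockScalar K a : (α → K) →* _))).comp
    (MulEquiv.piUnits.symm.toMonoidHom.comp (MonoidHom.mulSingle (fun _ => Kˣ) (a j)))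
  have hf : Function.Injective f := (injective_iff_map_eq_one _).2 fun t ht => by
    have hmem : _ ∈ F.ker := ht
    rw [hker] at hmem
    obtain ⟨c, hc⟩ := mem_scalarUnits.1 hmem
    have hentry (k : κ) : (Pi.mulSingle (M := fun _ => Kˣ) (a j) t (a k) : K) = c := by
      simpa [blockScalar_apply, algebraMap_matrix_apply] using
        congrFun₂ (congrArg Subtype.val hc) k k
    refine Units.ext ?_
    rw [← Pi.mulSingle_eq_same (M := fun _ => Kˣ) (a j) t, hentry, ← hentry l,
      Pi.mulSingle_eq_of_ne hjl.symm]
  have : Infinite Kˣ := unitsEquivNeZero.infinite_iff.2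
    (Set.finite_singleton (0 : K)).infinite_compl.to_subtype
  refine Set.infinite_of_injective_forall_mem hf fun t => Subgroup.mem_center_iff.2 fun y => ?_
  obtain ⟨x, rfl⟩ := hF y
  have hcomm : Commute (Units.map (blockScalar K a : (α → K) →* _)
    (MulEquiv.piUnits.symm (Pi.mulSingle (a j) t))) x := Units.ext (commute_blockScalar _ x.1)
  exact (hcomm.map F).symm

end Center

namespace NilSplitting

theorem bijective_red_comp_subtype {K C B : Type*} [Field K] [Ring C] [Algebra K C] [Ring B]
    [Algebra K B] [Nontrivial B] (L : NilSplitting K C B) {H : Subgroup Cˣ}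
    (hle : scalarUnits K C ≤ H) (hinf : H ⊓ L.scalarRed ≤ scalarUnits K C)
    (hsup : H ⊔ L.scalarRed = ⊤) :
    Function.Bijective ((Units.map (L.red : C →* B)).comp H.subtype) := by
  constructor
  · refine (injective_iff_map_eq_one _).2 fun x hx => ?_
    have hx1 : L.red x.1 = 1 := congrArg Units.val hx
    obtain ⟨c, hc⟩ := mem_scalarUnits.1
      (hinf ⟨x.2, L.mem_scalarRed.2 ⟨1, by rw [hx1, Units.val_one, map_one]⟩⟩)
    rw [hc, AlgHom.commutes, ← map_one (algebraMap K B)] at hx1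
    refine Subtype.ext (Units.ext ?_)
    rw [hc, (algebraMap K B).injective hx1, map_one, OneMemClass.coe_one, Units.val_one]
  · intro b
    obtain ⟨x, hx, y, hy, hxy⟩ := Subgroup.mem_sup_of_normal_right.1
      (hsup ▸ Subgroup.mem_top (Units.map (L.emb : B →* C) b))
    obtain ⟨c, hc⟩ := L.mem_scalarRed.1 hy
    refine ⟨⟨x * Units.map (algebraMap K C : K →* C) c, H.mul_mem hx (hle ⟨c, rfl⟩)⟩, Units.ext ?_⟩
    have hred : L.red (x * y) = b := (congrArg (fun z : Cˣ => L.red z.1) hxy).trans (L.red_emb b)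
    rw [← hred, map_mul, hc, ← AlgHom.commutes L.red, ← map_mul]
    rfl

variable {n : ℕ} [NeZero n] {g : GL (Fin n) ℂ} {κ α : Type*} [Fintype κ] [DecidableEq κ]
  {a : κ → α} (L : NilSplitting ℂ (matrixCentralizer g) (blockSubalgebra ℂ a))
  (hg : IsNilpotent (g.1 - 1)) {Γ : Subgroup PGL(n, ℂ)} (hΓ : IsReductivePart (mk g) Γ)

include L hg hΓ

theorem le_range_centralizerToPGL_of_isReductivePart : Γ ≤ (centralizerToPGL g).range := by
  rw [range_centralizerToPGL hg, ← (L.inf_sup_radical_of_isReductivePart hg hΓ).2]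
  exact le_sup_left

theorem bijective_red_comap_of_isReductivePart [Nonempty κ] :
    Function.Bijective ((Units.map (L.red : matrixCentralizer g →* blockSubalgebra ℂ a)).comp
      (Γ.comap (centralizerToPGL g)).subtype) := by
  obtain ⟨hinf, hsup⟩ := L.inf_sup_radical_of_isReductivePart hg hΓ
  refine L.bijective_red_comp_subtype ?_ ?_ ?_
  · rw [← ker_centralizerToPGL]
    exact Subgroup.ker_le_comap _ _
  · rw [← L.comap_radical, ← Subgroup.comap_inf, hinf, MonoidHom.comap_bot, ker_centralizerToPGL]
  · have hle : L.radical ≤ (centralizerToPGL g).range := Subgroup.map_le_range _ _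
    rw [← L.comap_radical, Subgroup.comap_sup_eq_of_le_range _
      (L.le_range_centralizerToPGL_of_isReductivePart hg hΓ) hle, hsup,
      ← range_centralizerToPGL hg, MonoidHom.comap_range_self]

theorem exists_surjective_ker_eq_scalarUnits [Nonempty κ] :
    ∃ F : (blockSubalgebra ℂ a)ˣ →* Γ, Function.Surjective F ∧ F.ker = scalarUnits ℂ _ := by
  let E := MulEquiv.ofBijective _ (L.bijective_red_comap_of_isReductivePart hg hΓ)
  let f := (centralizerToPGL g).subgroupComap Γ
  have hE (x) : E x = Units.map (L.red : matrixCentralizer g →* blockSubalgebra ℂ a) x.1 := rfl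
  have hf : Function.Surjective f := fun y => by
    obtain ⟨x, hx⟩ := L.le_range_centralizerToPGL_of_isReductivePart hg hΓ y.2
    exact ⟨⟨x, Subgroup.mem_comap.2 (hx ▸ y.2)⟩, Subtype.ext hx⟩
  have hker (x) : f x = 1 ↔ x.1 ∈ scalarUnits ℂ (matrixCentralizer g) := by
    rw [← ker_centralizerToPGL, MonoidHom.mem_ker]
    exact Subtype.ext_iff
  refine ⟨f.comp E.symm.toMonoidHom, hf.comp E.symm.surjective, Subgroup.ext fun b => ?_⟩
  obtain ⟨x, rfl⟩ := E.surjective b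
  have hcomp : (f.comp E.symm.toMonoidHom) (E x) = f x := congrArg f (E.symm_apply_apply x)
  rw [MonoidHom.mem_ker, hcomp, hker, hE]
  refine ⟨map_mem_scalarUnits L.red, fun ⟨c, hc⟩ => ?_⟩
  have hmem :
      centralizerToPGL g (Units.map (algebraMap ℂ (matrixCentralizer g) : ℂ →* _) c) ∈ Γ := by
    have h : Units.map (algebraMap ℂ (matrixCentralizer g) : ℂ →* _) c ∈
      (centralizerToPGL g).ker := ker_centralizerToPGL (g := g) ▸ ⟨c, rfl⟩
    rw [MonoidHom.mem_ker.1 h]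
    exact Γ.one_mem
  have : x = ⟨_, hmem⟩ := E.injective (by
    rw [hE, hE, ← hc]
    exact Units.ext (L.red.commutes c).symm)
  exact this ▸ ⟨c, rfl⟩

theorem ellSub_eq_empty {j l : κ} (hjl : a j ≠ a l) : ellSub Γ = ∅ := by
  have : Nonempty κ := ⟨j⟩
  obtain ⟨F, hF, hker⟩ := L.exists_surjective_ker_eq_scalarUnits hg hΓ
  exact ellipticPairs_eq_empty _ (infinite_center_of_ker_eq_scalarUnits hF hker hjl)

end NilSplitting

section Rectangular

variable {κ α : Type*} [Fintype κ] [DecidableEq κ] {a : κ → α}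

/-- If there is only one block, then every matrix is block diagonal. -/
noncomputable def blockSubalgebraEquivOfConst {R : Type*} [CommRing R] (ha : ∀ j l, a j = a l) :
    blockSubalgebra R a ≃ₐ[R] Matrix κ κ R :=
  (Subalgebra.equivOfEq _ _ (eq_top_iff.2 fun _ _ j l h => (h (ha j l)).elim)).trans
    Subalgebra.topEquiv

theorem exists_mulEquiv_of_ker_eq_center {K G : Type*} [Field K] [Group G] {f : GL κ K →* G}
    (hf : Function.Surjective f) (hker : f.ker = Subgroup.center (GL κ K)) :
    ∃ φ : PGL(κ, K) ≃* G, ∀ A, φ (mk A) = f A :=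
  ⟨(QuotientGroup.quotientMulEquivOfEq hker.symm).trans
    (QuotientGroup.quotientKerEquivOfSurjective f hf), fun _ => rfl⟩

theorem mem_center_iff_map_mem_scalarUnits {K C : Type*} [Field K] [Ring C] [Algebra K C]
    {f : Matrix κ κ K →ₐ[K] C} (hf : Function.Injective f) {A : GL κ K} :
    A ∈ Subgroup.center (GL κ K) ↔ Units.map (f : Matrix κ κ K →* C) A ∈ scalarUnits K C := by
  rw [← mk_eq_one, mk_eq_one_iff_smul, mem_scalarUnits]
  refine exists_congr fun c => ?_
  rw [← Algebra.algebraMap_eq_smul_one, ← hf.eq_iff, AlgHom.commutes]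
  rfl

namespace NilSplitting

theorem exists_mulEquiv_of_isReductivePart [Nonempty κ] {n : ℕ} [NeZero n] {g : GL (Fin n) ℂ}
    (L : NilSplitting ℂ (matrixCentralizer g) (blockSubalgebra ℂ a))
    (hg : IsNilpotent (g.1 - 1)) {Γ : Subgroup PGL(n, ℂ)} (hΓ : IsReductivePart (mk g) Γ)
    (ha : ∀ j l, a j = a l) : ∃ (c : (matrixCentralizer g)ˣ) (φ : PGL(κ, ℂ) ≃* Γ), ∀ A : GL κ ℂ,
      (φ (mk A) : PGL(n, ℂ)) = centralizerToPGL g (c * Units.map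
        ((L.emb.comp (blockSubalgebraEquivOfConst ha).symm.toAlgHom : Matrix κ κ ℂ →ₐ[ℂ] _) :
          Matrix κ κ ℂ →* matrixCentralizer g) A * c⁻¹) := by
  let Ψ := blockSubalgebraEquivOfConst (R := ℂ) ha
  let π : matrixCentralizer g →ₐ[ℂ] Matrix κ κ ℂ := (Ψ : _ →ₐ[ℂ] _).comp L.red
  let ι : Matrix κ κ ℂ →ₐ[ℂ] matrixCentralizer g := L.emb.comp Ψ.symm.toAlgHom
  have hπι (A : Matrix κ κ ℂ) : π (ι A) = A :=
    (congrArg Ψ (L.red_emb _)).trans (Ψ.apply_symm_apply A)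
  have hnil (x) (hx : π x = 0) : IsNilpotent x :=
    L.isNilpotent_of_red_eq_zero x (Ψ.injective (hx.trans (map_zero Ψ).symm))
  have hbij : Function.Bijective ((Units.map (π : matrixCentralizer g →* Matrix κ κ ℂ)).comp
      (Γ.comap (centralizerToPGL g)).subtype) :=
    (Units.mapEquiv Ψ.toMulEquiv).bijective.comp (L.bijective_red_comap_of_isReductivePart hg hΓ)
  obtain ⟨c, hc⟩ := exists_conj_of_isLineClosed_complement hπι hnil hbij
    (hΓ.1.isLineClosed (matrixCentralizer g).val)
  let f : GL κ ℂ →* Γ := ((centralizerToPGL g).comp ((MulAut.conj c).toMonoidHom.comp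
    (Units.map (ι : Matrix κ κ ℂ →* matrixCentralizer g)))).codRestrict Γ fun A => (hc _).2 ⟨A, rfl⟩
  have hf : Function.Surjective f := fun y => by
    obtain ⟨x, hx⟩ := L.le_range_centralizerToPGL_of_isReductivePart hg hΓ y.2
    obtain ⟨A, rfl⟩ := (hc x).1 (Subgroup.mem_comap.2 (hx ▸ y.2))
    exact ⟨A, Subtype.ext hx⟩
  have hker : f.ker = Subgroup.center (GL κ ℂ) := Subgroup.ext fun A => by
    rw [mem_center_iff_map_mem_scalarUnits (Function.LeftInverse.injective hπι),
      ← ker_centralizerToPGL, MonoidHom.mem_ker, MonoidHom.mem_ker]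
    refine Subtype.ext_iff.trans ?_
    change centralizerToPGL g (c * _ * c⁻¹) = 1 ↔ _
    rw [map_mul, map_mul, map_inv, conj_eq_one_iff]
  obtain ⟨φ, hφ⟩ := exists_mulEquiv_of_ker_eq_center hf hker
  exact ⟨c, φ, fun A => congrArg Subtype.val (hφ A)⟩

end NilSplitting

end Rectangular

/-! ### Jordan matrices -/

section Jordan

variable {κ : Type*} [DecidableEq κ] {a : κ → ℕ}

/-- The unipotent matrix in Jordan form with blocks of sizes `a j`. -/
noncomputable abbrev jordanMatrix (a : κ → ℕ) : Matrix (Σ j, Fin (a j)) (Σ j, Fin (a j)) ℂ :=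
  blockDiagonal' fun j => jordanBlock (a j)

theorem jordanMatrix_apply (x y : Σ j, Fin (a j)) :
    jordanMatrix a x y = (1 : Matrix _ _ ℂ) x y +
      if x.1 = y.1 ∧ (x.2 : ℕ) + 1 = y.2 then 1 else 0 := by
  obtain ⟨j, k⟩ := x
  obtain ⟨l, m⟩ := y
  rcases eq_or_ne j l with rfl | hjl
  · rw [jordanMatrix, blockDiagonal'_apply_eq, one_apply]
    rcases eq_or_ne k m with rfl | hkm
    · simp [jordanBlock]
    · simp [jordanBlock, hkm]
  · rw [jordanMatrix, blockDiagonal'_apply_ne _ _ _ hjl,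
      one_apply_ne fun h => hjl (congrArg Sigma.fst h), if_neg fun h => hjl h.1, add_zero]

variable [Fintype κ]

theorem mul_jordanMatrix_apply (X : Matrix (Σ j, Fin (a j)) (Σ j, Fin (a j)) ℂ)
    (x : Σ j, Fin (a j)) (j : κ) (k : ℕ) (hk : k < a j) :
    (X * jordanMatrix a) x ⟨j, k, hk⟩ = X x ⟨j, k, hk⟩ +
      if h : 0 < k then X x ⟨j, k - 1, by omega⟩ else 0 := by
  simp only [mul_apply, jordanMatrix_apply, mul_add, Finset.sum_add_distrib]
  congr 1
  · simp [one_apply]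
  · split_ifs with h
    · rw [Finset.sum_eq_single ⟨j, k - 1, by omega⟩]
      · rw [if_pos ⟨rfl, Nat.sub_add_cancel h⟩, mul_one]
      · rintro ⟨l, m⟩ - hne
        rw [if_neg, mul_zero]
        rintro ⟨rfl, rfl⟩
        exact hne rfl
      · exact fun h => (h (Finset.mem_univ _)).elim
    · refine Finset.sum_eq_zero fun y _ => ?_
      rw [if_neg, mul_zero]
      rintro ⟨-, rfl⟩
      exact h (Nat.succ_pos _)

theorem jordanMatrix_mul_apply (X : Matrix (Σ j, Fin (a j)) (Σ j, Fin (a j)) ℂ)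
    (y : Σ j, Fin (a j)) (j : κ) (k : ℕ) (hk : k < a j) :
    (jordanMatrix a * X) ⟨j, k, hk⟩ y = X ⟨j, k, hk⟩ y +
      if h : k + 1 < a j then X ⟨j, k + 1, h⟩ y else 0 := by
  simp only [mul_apply, jordanMatrix_apply, add_mul, Finset.sum_add_distrib]
  congr 1
  · simp [one_apply]
  · split_ifs with h
    · rw [Finset.sum_eq_single ⟨j, k + 1, h⟩]
      · rw [if_pos ⟨rfl, rfl⟩, one_mul]
      · rintro ⟨l, m, hm⟩ - hne
        rw [if_neg, zero_mul]
        rintro ⟨rfl, rfl⟩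
        exact hne rfl
      · exact fun h => (h (Finset.mem_univ _)).elim
    · refine Finset.sum_eq_zero ?_
      rintro ⟨l, m, hm⟩ -
      rw [if_neg, zero_mul]
      rintro ⟨rfl, rfl⟩
      exact h hm

section Commute

variable {X : Matrix (Σ j, Fin (a j)) (Σ j, Fin (a j)) ℂ} (hX : Commute (jordanMatrix a) X)

include hX

theorem shift_eq_shift_of_commute (j l : κ) (k m : ℕ) (hk : k < a j) (hm : m < a l) :
    (if h : k + 1 < a j then X ⟨j, k + 1, h⟩ ⟨l, m, hm⟩ else 0) =
      if h : 0 < m then X ⟨j, k, hk⟩ ⟨l, m - 1, by omega⟩ else 0 := by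
  have := congrFun₂ hX.eq ⟨j, k, hk⟩ ⟨l, m, hm⟩
  rwa [jordanMatrix_mul_apply, mul_jordanMatrix_apply, add_right_inj] at this

theorem apply_succ_succ_of_commute (j l : κ) (k m : ℕ) (hk : k + 1 < a j) (hm : m + 1 < a l) :
    X ⟨j, k + 1, hk⟩ ⟨l, m + 1, hm⟩ = X ⟨j, k, by omega⟩ ⟨l, m, by omega⟩ := by
  have := shift_eq_shift_of_commute hX j l k (m + 1) (by omega) hm
  rwa [dif_pos hk, dif_pos (Nat.succ_pos m)] at this

theorem apply_eq_zero_of_lt {j l : κ} {k : Fin (a j)} {m : Fin (a l)} (hmk : (m : ℕ) < k) :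
    X ⟨j, k⟩ ⟨l, m⟩ = 0 := by
  obtain ⟨m, hm⟩ := m
  obtain ⟨_ | k, hk⟩ := k
  · exact (Nat.not_lt_zero _ hmk).elim
  induction m generalizing k with
  | zero =>
    have := shift_eq_shift_of_commute hX j l k 0 (by omega) hm
    rwa [dif_pos hk, dif_neg (lt_irrefl 0)] at this
  | succ m ih =>
    have hmk' := Nat.lt_of_succ_lt_succ hmk
    obtain ⟨k, rfl⟩ := Nat.exists_eq_succ_of_ne_zero (Nat.ne_zero_of_lt hmk')
    exact (apply_succ_succ_of_commute hX j l _ m hk hm).trans (ih _ k _ hmk')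

theorem apply_eq_zero_of_add_lt {j l : κ} {k : Fin (a j)} {m : Fin (a l)}
    (h : a j + m < a l + k) : X ⟨j, k⟩ ⟨l, m⟩ = 0 := by
  obtain ⟨k, hk⟩ := k
  obtain ⟨m, hm⟩ := m
  dsimp only at h
  obtain ⟨d, hd⟩ : ∃ d, a j = k + 1 + d := ⟨a j - (k + 1), by omega⟩
  induction d generalizing k m with
  | zero =>
    have := shift_eq_shift_of_commute hX j l k (m + 1) hk (by omega)
    rw [dif_neg (by omega), dif_pos (Nat.succ_pos m)] at this
    exact this.symm
  | succ d ih =>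
    rw [← apply_succ_succ_of_commute hX j l k m (by omega) (by omega)]
    exact ih (k + 1) _ (m + 1) _ (by omega) (by omega)

theorem apply_eq_apply_zero_of_commute [∀ j, NeZero (a j)] {j l : κ} {k : Fin (a j)}
    {m : Fin (a l)} (hkm : (k : ℕ) = m) : X ⟨j, k⟩ ⟨l, m⟩ = X ⟨j, 0⟩ ⟨l, 0⟩ := by
  obtain ⟨k, hk⟩ := k
  obtain ⟨m, hm⟩ := m
  obtain rfl : k = m := hkm
  induction k with
  | zero => rfl
  | succ k ih => rw [apply_succ_succ_of_commute hX, ih]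

end Commute

section Reduction

variable [∀ j, NeZero (a j)]

/-- The leading coefficients of the blocks of `X` between Jordan blocks of the same size. -/
noncomputable def leadingBlock (a : κ → ℕ) [∀ j, NeZero (a j)] :
    Matrix (Σ j, Fin (a j)) (Σ j, Fin (a j)) ℂ →ₗ[ℂ] blockSubalgebra ℂ a where
  toFun X := ⟨of fun j l => if a j = a l then X ⟨j, 0⟩ ⟨l, 0⟩ else 0, fun _ _ h => if_neg h⟩
  map_add' X Y := Subtype.ext (Matrix.ext fun j l => by by_cases h : a j = a l <;> simp [h])
  map_smul' c X := Subtype.ext (Matrix.ext fun j l => by by_cases h : a j = a l <;> simp [h])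

theorem leadingBlock_apply (X : Matrix (Σ j, Fin (a j)) (Σ j, Fin (a j)) ℂ) (j l : κ) :
    (leadingBlock a X).1 j l = if a j = a l then X ⟨j, 0⟩ ⟨l, 0⟩ else 0 := rfl

theorem leadingBlock_one : leadingBlock a 1 = 1 := by
  refine Subtype.ext (Matrix.ext fun j l => ?_)
  rw [leadingBlock_apply, OneMemClass.coe_one]
  rcases eq_or_ne j l with rfl | h
  · rw [if_pos rfl, one_apply_eq, one_apply_eq]
  · rw [one_apply_ne h, one_apply_ne fun e => h (congrArg Sigma.fst e), ite_self]

theorem mul_apply_zero_zero_of_commute {X Y : Matrix (Σ j, Fin (a j)) (Σ j, Fin (a j)) ℂ}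
    (hY : Commute (jordanMatrix a) Y) (j l : κ) :
    (X * Y) ⟨j, 0⟩ ⟨l, 0⟩ = ∑ p, X ⟨j, 0⟩ ⟨p, 0⟩ * Y ⟨p, 0⟩ ⟨l, 0⟩ := by
  rw [mul_apply, Fintype.sum_sigma]
  refine Finset.sum_congr rfl fun p _ => Finset.sum_eq_single _ ?_ ?_
  · intro k _ hk
    have hk' : ((0 : Fin (a l)) : ℕ) < k := Nat.pos_of_ne_zero (Fin.val_ne_zero_iff.2 hk)
    rw [apply_eq_zero_of_lt hY hk', mul_zero]
  · exact fun h => (h (Finset.mem_univ _)).elim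

theorem leadingBlock_mul_of_commute {X Y : Matrix (Σ j, Fin (a j)) (Σ j, Fin (a j)) ℂ}
    (hX : Commute (jordanMatrix a) X) (hY : Commute (jordanMatrix a) Y) :
    leadingBlock a (X * Y) = leadingBlock a X * leadingBlock a Y := by
  refine Subtype.ext (Matrix.ext fun j l => ?_)
  rw [MulMemClass.coe_mul, mul_apply, leadingBlock_apply]
  split_ifs with hjl
  · rw [mul_apply_zero_zero_of_commute hY]
    refine Finset.sum_congr rfl fun p _ => ?_
    rw [leadingBlock_apply, leadingBlock_apply]
    rcases lt_trichotomy (a j) (a p) with h | h | h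
    · rw [if_neg h.ne, zero_mul, apply_eq_zero_of_add_lt hX (by simpa using h), zero_mul]
    · rw [if_pos h, if_pos (h ▸ hjl)]
    · rw [if_neg h.ne', zero_mul, apply_eq_zero_of_add_lt hY (by simpa [← hjl] using h), mul_zero]
  · refine (Finset.sum_eq_zero fun p _ => ?_).symm
    by_cases hp : a j = a p
    · rw [leadingBlock_apply Y, if_neg (hp ▸ hjl), mul_zero]
    · rw [leadingBlock_apply X, if_neg hp, zero_mul]

end Reduction

theorem commute_of_mem_centralizer {X : Matrix (Σ j, Fin (a j)) (Σ j, Fin (a j)) ℂ}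
    (hX : X ∈ Subalgebra.centralizer ℂ {jordanMatrix a}) : Commute (jordanMatrix a) X :=
  (Subalgebra.mem_centralizer_iff ℂ).1 hX _ rfl

/-- The algebra homomorphism which maps a matrix commuting with `jordanMatrix a` to its leading
coefficients. -/
noncomputable def jordanRed (a : κ → ℕ) [∀ j, NeZero (a j)] :
    Subalgebra.centralizer ℂ {jordanMatrix a} →ₐ[ℂ] blockSubalgebra ℂ a :=
  AlgHom.ofLinearMap (leadingBlock a ∘ₗ (Subalgebra.centralizer ℂ {jordanMatrix a}).val.toLinearMap)
    leadingBlock_one fun X Y => leadingBlock_mul_of_commute (commute_of_mem_centralizer X.2)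
      (commute_of_mem_centralizer Y.2)

section Inflation

/-- The matrix whose block between the Jordan blocks `j` and `l` is the scalar matrix `M j l`. -/
noncomputable def inflation (a : κ → ℕ) :
    blockSubalgebra ℂ a →ₗ[ℂ] Matrix (Σ j, Fin (a j)) (Σ j, Fin (a j)) ℂ where
  toFun M := of fun x y => if (x.2 : ℕ) = y.2 then M.1 x.1 y.1 else 0
  map_add' M N := Matrix.ext fun x y => by by_cases h : (x.2 : ℕ) = y.2 <;> simp [h]
  map_smul' c M := Matrix.ext fun x y => by by_cases h : (x.2 : ℕ) = y.2 <;> simp [h]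

theorem inflation_apply (M : blockSubalgebra ℂ a) (x y : Σ j, Fin (a j)) :
    inflation a M x y = if (x.2 : ℕ) = y.2 then M.1 x.1 y.1 else 0 := rfl

theorem commute_inflation (M : blockSubalgebra ℂ a) :
    Commute (jordanMatrix a) (inflation a M) := by
  ext ⟨j, k, hk⟩ ⟨l, m, hm⟩
  rw [jordanMatrix_mul_apply, mul_jordanMatrix_apply, add_right_inj]
  simp only [inflation_apply]
  by_cases hjl : a j = a l
  · split_ifs <;> first | rfl | omega
  · simp only [M.2 j l hjl, ite_self, dite_eq_ite]

theorem inflation_one : inflation a 1 = 1 := by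
  ext ⟨j, k⟩ ⟨l, m⟩
  rw [inflation_apply, OneMemClass.coe_one]
  rcases eq_or_ne j l with rfl | hjl
  · simp [one_apply, Fin.val_inj]
  · rw [one_apply_ne hjl, one_apply_ne fun h => hjl (congrArg Sigma.fst h), ite_self]

theorem inflation_mul (M N : blockSubalgebra ℂ a) :
    inflation a (M * N) = inflation a M * inflation a N := by
  ext ⟨j, k, hk⟩ ⟨l, m, hm⟩
  simp only [mul_apply, Fintype.sum_sigma, inflation_apply, MulMemClass.coe_mul]
  rcases eq_or_ne k m with rfl | hkm
  · rw [if_pos rfl]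
    refine Finset.sum_congr rfl fun p _ => ?_
    by_cases hp : a j = a p
    · rw [Finset.sum_eq_single (⟨k, hp ▸ hk⟩ : Fin (a p))]
      · simp
      · rintro ⟨q, hq⟩ - hne
        rw [if_neg fun h => hne (Fin.ext h.symm), zero_mul]
      · exact fun h => (h (Finset.mem_univ _)).elim
    · simp [M.2 j p hp]
  · rw [if_neg hkm]
    refine (Finset.sum_eq_zero fun p _ => Finset.sum_eq_zero fun q _ => ?_).symm
    split_ifs with h₁ h₂
    · exact (hkm (h₁.trans h₂)).elim
    all_goals simp

/-- The inclusion of the block diagonal matrices into the centralizer of `jordanMatrix a`. -/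
noncomputable def jordanEmb (a : κ → ℕ) :
    blockSubalgebra ℂ a →ₐ[ℂ] Subalgebra.centralizer ℂ {jordanMatrix a} :=
  (AlgHom.ofLinearMap (inflation a) inflation_one inflation_mul).codRestrict _ fun M =>
    (Subalgebra.mem_centralizer_iff ℂ).2 fun _ h => h ▸ commute_inflation M

end Inflation

variable [∀ j, NeZero (a j)]

theorem jordanRed_jordanEmb (M : blockSubalgebra ℂ a) : jordanRed a (jordanEmb a M) = M := by
  refine Subtype.ext (Matrix.ext fun j l => ?_)
  change (leadingBlock a (inflation a M)).1 j l = _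
  rw [leadingBlock_apply, inflation_apply]
  split_ifs with h h0
  · rfl
  · exact (h0 rfl).elim
  · exact (M.2 j l h).symm

theorem pow_apply_ne_zero_of_weight {I R : Type*} [Fintype I] [DecidableEq I] [Semiring R]
    {Y : Matrix I I R} {wt : I → ℤ} (h : ∀ x y, Y x y ≠ 0 → wt y < wt x) {k : ℕ} {x y : I}
    (hxy : (Y ^ k) x y ≠ 0) : wt y + k ≤ wt x := by
  induction k generalizing y with
  | zero =>
    obtain rfl : x = y := by_contra fun hne => hxy (by rw [pow_zero, one_apply_ne hne])
    simp
  | succ k ih =>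
    rw [pow_succ, mul_apply] at hxy
    obtain ⟨z, -, hz⟩ := Finset.exists_ne_zero_of_sum_ne_zero hxy
    have h₁ := ih (left_ne_zero_of_mul hz)
    have h₂ := h z y (right_ne_zero_of_mul hz)
    push_cast
    omega

theorem isNilpotent_of_weight {I R : Type*} [Fintype I] [DecidableEq I] [Semiring R]
    {Y : Matrix I I R} (wt : I → ℤ) (h : ∀ x y, Y x y ≠ 0 → wt y < wt x) : IsNilpotent Y := by
  obtain ⟨b, hb⟩ := (Set.finite_range wt).bddBelow
  obtain ⟨B, hB⟩ := (Set.finite_range wt).bddAbove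
  refine ⟨(B - b).toNat + 1, Matrix.ext fun x y => by_contra fun hne => ?_⟩
  have h₁ := pow_apply_ne_zero_of_weight h hne
  have h₂ := hb (Set.mem_range_self y)
  have h₃ := hB (Set.mem_range_self x)
  omega

theorem isNilpotent_of_leadingBlock_eq_zero {X : Matrix (Σ j, Fin (a j)) (Σ j, Fin (a j)) ℂ}
    (hX : Commute (jordanMatrix a) X) (h : leadingBlock a X = 0) : IsNilpotent X := by
  refine isNilpotent_of_weight (fun x => (a x.1 : ℤ) - 2 * (x.2 : ℕ)) ?_
  rintro ⟨j, k⟩ ⟨l, m⟩ hne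
  have hkm : (k : ℕ) ≤ m := not_lt.1 fun hlt => hne (apply_eq_zero_of_lt hX hlt)
  have hlj : a l + k ≤ a j + m := not_lt.1 fun hlt => hne (apply_eq_zero_of_add_lt hX hlt)
  by_contra hlt
  dsimp only at hlt
  obtain ⟨hkm, hjl⟩ : (k : ℕ) = m ∧ a j = a l := by omega
  have h₀ : (leadingBlock a X).1 j l = 0 := congrFun₂ (congrArg Subtype.val h) j l
  rw [leadingBlock_apply, if_pos hjl, ← apply_eq_apply_zero_of_commute hX hkm] at h₀
  exact hne h₀

/-- The splitting of the centralizer of `jordanMatrix a`. -/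
noncomputable def jordanNilSplitting (a : κ → ℕ) [∀ j, NeZero (a j)] :
    NilSplitting ℂ (Subalgebra.centralizer ℂ {jordanMatrix a}) (blockSubalgebra ℂ a) where
  red := jordanRed a
  emb := jordanEmb a
  red_emb := jordanRed_jordanEmb
  isNilpotent_of_red_eq_zero X hX :=
    (IsNilpotent.map_iff (f := (Subalgebra.centralizer ℂ {jordanMatrix a}).val)
      Subtype.val_injective).1 (isNilpotent_of_leadingBlock_eq_zero
        (commute_of_mem_centralizer X.2) hX)

theorem isNilpotent_jordanMatrix_sub_one (a : κ → ℕ) : IsNilpotent (jordanMatrix a - 1) := by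
  refine isNilpotent_of_weight (fun x => - ((x.2 : ℕ) : ℤ)) fun x y h => ?_
  rw [Matrix.sub_apply, jordanMatrix_apply, add_sub_cancel_left] at h
  have : x.1 = y.1 ∧ (x.2 : ℕ) + 1 = y.2 := by_contra fun hne => h (if_neg hne)
  omega

end Jordan

section CyclicDecomposition

open Polynomial

variable {ι K V : Type*} [Fintype ι] [Field K] [AddCommGroup V] [Module K V] {f : Module.End K V}

/-- The `K[X]`-module `V`, on which `X` acts by `f`, is the direct sum of its submodules generated
by the `v i`, and the `i`-th one is isomorphic to `K[X] / (X ^ k i)`. -/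
structure IsCyclicDecomposition (f : Module.End K V) (k : ι → ℕ) (v : ι → V) : Prop where
  exists_eq_sum : ∀ x, ∃ q : ι → K[X], x = ∑ i, aeval f (q i) (v i)
  sum_eq_zero_iff : ∀ q : ι → K[X], ∑ i, aeval f (q i) (v i) = 0 ↔ ∀ i, X ^ k i ∣ q i

theorem apply_sum_smul_symm_single {R M : Type*} [CommRing R] [AddCommGroup M] [Module R M]
    [DecidableEq ι] {I : ι → Ideal R} (T : M ≃ₗ[R] ∀ i, R ⧸ I i) (q : ι → R) :
    T (∑ i, q i • T.symm (Pi.single i (Submodule.Quotient.mk 1))) =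
      fun i => Submodule.Quotient.mk (q i) := by
  simp only [map_sum, map_smul, LinearEquiv.apply_symm_apply, ← Pi.single_smul,
    ← Submodule.Quotient.mk_smul, smul_eq_mul, mul_one]
  exact Finset.univ_sum_single _

theorem isTorsion'_aeval'_of_isNilpotent (hf : IsNilpotent f) :
    Module.IsTorsion' (Module.AEval' f) (Submonoid.powers (X : K[X])) := by
  obtain ⟨m, hm⟩ := hf
  refine (Submodule.isTorsion'_powers_iff _).2 fun v => ⟨m, ?_⟩
  obtain ⟨v, rfl⟩ := (Module.AEval'.of f).surjective v
  rw [Module.AEval'.X_pow_smul_of, hm, zero_smul, map_zero]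

theorem exists_isCyclicDecomposition [FiniteDimensional K V] (hf : IsNilpotent f) :
    ∃ (d : ℕ) (k : Fin d → ℕ) (v : Fin d → V), IsCyclicDecomposition f k v := by
  obtain ⟨d, k, ⟨T₀⟩⟩ := Module.torsion_by_prime_power_decomposition (p := (X : K[X]))
    irreducible_X (isTorsion'_aeval'_of_isNilpotent hf)
  let T := T₀.trans (DirectSum.linearEquivFunOnFintype K[X] (Fin d) _)
  let of := Module.AEval'.of f
  let v i := of.symm (T.symm (Pi.single i (Submodule.Quotient.mk 1)))
  have hT (q : Fin d → K[X]) :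
      T (of (∑ i, aeval f (q i) (v i))) = fun i => Submodule.Quotient.mk (q i) := by
    rw [← apply_sum_smul_symm_single T q, map_sum]
    congr 2
  refine ⟨d, k, v, fun x => ?_, fun q => ?_⟩
  · choose q hq using fun i => Submodule.Quotient.mk_surjective _ (T (of x) i)
    exact ⟨q, of.injective (T.injective ((hT q).trans (funext hq)).symm)⟩
  · rw [← of.map_eq_zero_iff, ← T.map_eq_zero_iff, hT, funext_iff]
    refine forall_congr' fun i => ?_
    rw [Pi.zero_apply, Submodule.Quotient.mk_eq_zero, Ideal.mem_span_singleton]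

namespace IsCyclicDecomposition

variable {k : ι → ℕ} {v : ι → V}

theorem pow_apply_eq_zero (h : IsCyclicDecomposition f k v) {i : ι} {m : ℕ} (hm : k i ≤ m) :
    (f ^ m) (v i) = 0 := by
  classical
  have := (h.sum_eq_zero_iff (Pi.single i (X ^ m))).2 fun j => by
    rcases eq_or_ne j i with rfl | hj
    · rw [Pi.single_eq_same]
      exact pow_dvd_pow X hm
    · rw [Pi.single_eq_of_ne hj]
      exact dvd_zero _
  rwa [Finset.sum_eq_single i (fun j _ hj => by rw [Pi.single_eq_of_ne hj, map_zero,
      LinearMap.zero_apply]) fun h => (h (Finset.mem_univ i)).elim,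
    Pi.single_eq_same, aeval_X_pow] at this

theorem linearIndependent (h : IsCyclicDecomposition f k v) :
    LinearIndependent K fun x : Σ i, Fin (k i) => (f ^ (x.2.rev : ℕ)) (v x.1) := by
  refine Fintype.linearIndependent_iff.2 fun c hc => ?_
  let q (i : ι) : K[X] := ∑ s : Fin (k i), C (c ⟨i, s⟩) * X ^ (s.rev : ℕ)
  have hq : ∑ i, aeval f (q i) (v i) = 0 := by
    rw [← hc, Fintype.sum_sigma]
    refine Finset.sum_congr rfl fun i _ => ?_
    simp only [q, map_sum, LinearMap.sum_apply, map_mul, aeval_C, aeval_X_pow,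
      Module.End.mul_apply, Module.algebraMap_end_apply]
  rintro ⟨i, s⟩
  have hcoeff := X_pow_dvd_iff.1 ((h.sum_eq_zero_iff q).1 hq i) s.rev s.rev.isLt
  simpa only [q, finsetSum_coeff, coeff_C_mul, coeff_X_pow, Fin.val_inj, Fin.rev_inj, mul_ite,
    mul_one, mul_zero, Finset.sum_ite_eq, Finset.mem_univ, if_true] using hcoeff

theorem top_le_span (h : IsCyclicDecomposition f k v) :
    ⊤ ≤ Submodule.span K (Set.range fun x : Σ i, Fin (k i) => (f ^ (x.2.rev : ℕ)) (v x.1)) := by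
  rintro x -
  obtain ⟨q, rfl⟩ := h.exists_eq_sum x
  refine Submodule.sum_mem _ fun i _ => ?_
  rw [aeval_eq_sum_range, LinearMap.sum_apply]
  refine Submodule.sum_mem _ fun t _ => ?_
  rw [LinearMap.smul_apply]
  refine Submodule.smul_mem _ _ ?_
  rcases lt_or_ge t (k i) with ht | ht
  · exact Submodule.subset_span ⟨⟨i, Fin.rev ⟨t, ht⟩⟩, by simp only [Fin.rev_rev]⟩
  · rw [h.pow_apply_eq_zero ht]
    exact Submodule.zero_mem _

/-- The basis of Jordan chains: `f` maps each vector of a chain to the preceding one. -/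
noncomputable def basis (h : IsCyclicDecomposition f k v) :
    Module.Basis (Σ i, Fin (k i)) K V :=
  Module.Basis.mk h.linearIndependent h.top_le_span

theorem basis_apply (h : IsCyclicDecomposition f k v) (x : Σ i, Fin (k i)) :
    h.basis x = (f ^ (x.2.rev : ℕ)) (v x.1) := Module.Basis.mk_apply _ _ x

theorem apply_basis (h : IsCyclicDecomposition f k v) (i : ι) (s : ℕ) (hs : s < k i) :
    f (h.basis ⟨i, s, hs⟩) = if hs₀ : 0 < s then h.basis ⟨i, s - 1, by omega⟩ else 0 := by
  rw [basis_apply, ← Module.End.mul_apply, ← pow_succ', Fin.val_rev]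
  split_ifs with hs₀
  · rw [basis_apply, Fin.val_rev]
    congr 2
    dsimp only
    omega
  · exact h.pow_apply_eq_zero (by dsimp only; omega)

end IsCyclicDecomposition

theorem exists_jordanBasis [FiniteDimensional K V] (hf : IsNilpotent f) :
    ∃ (m : ℕ) (a : Fin m → ℕ) (b : Module.Basis (Σ j, Fin (a j)) K V), (∀ j, 0 < a j) ∧
      ∀ j s (hs : s < a j),
        f (b ⟨j, s, hs⟩) = if hs₀ : 0 < s then b ⟨j, s - 1, by omega⟩ else 0 := by
  obtain ⟨d, k, v, h⟩ := exists_isCyclicDecomposition hf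
  let ε := (Fintype.equivFin {i // 0 < k i}).symm
  let e : (Σ j, Fin (k (ε j))) ≃ Σ i, Fin (k i) :=
    (Equiv.sigmaCongrLeft (β := fun i : {i // 0 < k i} => Fin (k i)) ε).trans
      (Equiv.sigmaSubtypeEquivOfSubset (fun i => Fin (k i)) _ fun _ s => Fin.pos s)
  refine ⟨_, fun j => k (ε j), h.basis.reindex e.symm, fun j => (ε j).2, fun j s hs => ?_⟩
  simp only [Module.Basis.reindex_apply, Equiv.symm_symm]
  exact h.apply_basis (ε j) s hs

end CyclicDecomposition

theorem toMatrix_eq_jordanMatrix {κ V : Type*} [Fintype κ] [DecidableEq κ] [AddCommGroup V]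
    [Module ℂ V] {a : κ → ℕ} {f : Module.End ℂ V} (b : Module.Basis (Σ j, Fin (a j)) ℂ V)
    (hb : ∀ j s (hs : s < a j),
      (f - 1) (b ⟨j, s, hs⟩) = if hs₀ : 0 < s then b ⟨j, s - 1, by omega⟩ else 0) :
    LinearMap.toMatrix b b f = jordanMatrix a := by
  ext x ⟨j, s, hs⟩
  have hf : f (b ⟨j, s, hs⟩) = b ⟨j, s, hs⟩ + (f - 1) (b ⟨j, s, hs⟩) := by
    rw [LinearMap.sub_apply, Module.End.one_apply, add_sub_cancel]
  rw [← one_mul (jordanMatrix a), mul_jordanMatrix_apply, LinearMap.toMatrix_apply, hf, hb,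
    map_add, Finsupp.add_apply]
  congr 1
  · simp [Finsupp.single_apply, one_apply, eq_comm]
  · split_ifs
    · simp [Finsupp.single_apply, one_apply, eq_comm]
    · rw [map_zero, Finsupp.zero_apply]

section ReindexConj

variable {K ι I : Type*} [Field K] [Fintype ι] [DecidableEq ι] [Fintype I] [DecidableEq I]

/-- The isomorphism of matrix algebras given by a labelling of the basis and a change of basis. -/
noncomputable def reindexConj (e : I ≃ ι) (P : GL ι K) : Matrix I I K ≃ₐ[K] Matrix ι ι K :=
  (reindexAlgEquiv K K e).trans (conjAut ι K (mk P))

theorem reindexConj_apply (e : I ≃ ι) (P : GL ι K) (M : Matrix I I K) :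
    reindexConj e P M = P.1 * reindex e e M * P⁻¹.1 := rfl

theorem exists_reindexConj_toMatrix (e : I ≃ ι) (b : Module.Basis I K (ι → K)) :
    ∃ P : GL ι K, ∀ M : Matrix ι ι K,
      reindexConj e P (LinearMap.toMatrix b b (toLin' M)) = M := by
  let b₀ := Pi.basisFun K ι
  let b' := b.reindex e
  let P : GL ι K := ⟨b₀.toMatrix b', b'.toMatrix b₀, b₀.toMatrix_mul_toMatrix_flip b',
    b'.toMatrix_mul_toMatrix_flip b₀⟩
  refine ⟨P, fun M => ?_⟩
  have hre : reindex e e (LinearMap.toMatrix b b (toLin' M)) =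
      LinearMap.toMatrix b' b' (toLin' M) := by
    ext x y
    simp [b', LinearMap.toMatrix_apply]
  rw [reindexConj_apply, hre]
  change b₀.toMatrix b' * LinearMap.toMatrix b' b' (toLin' M) * b'.toMatrix b₀ = M
  rw [basis_toMatrix_mul_linearMap_toMatrix_mul_basis_toMatrix, LinearMap.toMatrix_eq_toMatrix',
    LinearMap.toMatrix'_toLin']

theorem isConj_of_algEquiv {A : Type*} [Ring A] [Algebra K A] (Φ Ψ : A ≃ₐ[K] Matrix ι ι K) {x : A}
    {g h : GL ι K} (hg : Φ x = g.1) (hh : Ψ x = h.1) : IsConj g h := by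
  obtain ⟨c, hc⟩ := Module.End.mulSemiringActionToAlgEquiv_conjAct_surjective
    ((toLinAlgEquiv'.symm.trans (Φ.symm.trans Ψ)).trans toLinAlgEquiv')
  have hgh := AlgEquiv.congr_fun hc (toLinAlgEquiv' g.1)
  rw [AlgEquiv.trans_apply, AlgEquiv.trans_apply, AlgEquiv.symm_apply_apply, ← hg,
    AlgEquiv.trans_apply, AlgEquiv.symm_apply_apply, hh, hg] at hgh
  have := (GeneralLinearGroup.toLin (R := K) (n := ι)).symm.toMonoidHom.map_isConj
    (isConj_iff.2 ⟨ConjAct.ofConjAct c, Units.ext hgh⟩ :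
      IsConj (GeneralLinearGroup.toLin g) (GeneralLinearGroup.toLin h))
  simpa using this

end ReindexConj

/-! ### Jordan types -/

section CentralizerEquiv

variable {R A B : Type*} [CommRing R] [Ring A] [Algebra R A] [Ring B] [Algebra R B]

theorem map_mem_centralizer_singleton (Ψ : A ≃ₐ[R] B) {x z : A} {y : B} (h : Ψ x = y)
    (hz : z ∈ Subalgebra.centralizer R {x}) : Ψ z ∈ Subalgebra.centralizer R {y} := by
  rw [Subalgebra.mem_centralizer_iff] at hz ⊢
  rintro _ rfl
  rw [← h, ← map_mul, ← map_mul, hz x rfl]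

/-- The isomorphism between the centralizers of elements which correspond to each other. -/
def centralizerEquiv (Ψ : A ≃ₐ[R] B) {x : A} {y : B} (h : Ψ x = y) :
    Subalgebra.centralizer R {x} ≃ₐ[R] Subalgebra.centralizer R {y} :=
  AlgEquiv.ofAlgHom
    ((Ψ.toAlgHom.comp (Subalgebra.val _)).codRestrict _ fun z =>
      map_mem_centralizer_singleton Ψ h z.2)
    ((Ψ.symm.toAlgHom.comp (Subalgebra.val _)).codRestrict _ fun z =>
      map_mem_centralizer_singleton Ψ.symm (Ψ.symm_apply_eq.2 h.symm) z.2)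
    (AlgHom.ext fun z => Subtype.ext (Ψ.apply_symm_apply z.1))
    (AlgHom.ext fun z => Subtype.ext (Ψ.symm_apply_apply z.1))

end CentralizerEquiv

section JordanType

variable {n : ℕ} {u u' : PGL(n, ℂ)} {p : n.Partition}

theorem exists_equiv_of_map_univ_eq {ι κ α : Type*} [Fintype ι] [Fintype κ] {a : ι → α} {b : κ → α}
    (h : Multiset.map a Finset.univ.val = Multiset.map b Finset.univ.val) :
    ∃ σ : ι ≃ κ, ∀ j, b (σ j) = a j := by
  classical
  have hcard (c : α) : Fintype.card {j // a j = c} = Fintype.card {j // b j = c} := by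
    have := congrArg (Multiset.count c) h
    rw [Multiset.count_map, Multiset.count_map] at this
    rw [Fintype.card_subtype, Fintype.card_subtype]
    simpa only [Finset.card, Finset.filter_val, eq_comm] using this
  exact ⟨Equiv.ofFiberEquiv fun c => Fintype.equivOfCardEq (hcard c),
    fun j => Equiv.ofFiberEquiv_map _ j⟩

theorem exists_equiv_reindex_jordanMatrix {κ κ' : Type*} [Fintype κ] [DecidableEq κ] [Fintype κ']
    [DecidableEq κ'] {a : κ → ℕ} {a' : κ' → ℕ}
    (h : Multiset.map a Finset.univ.val = Multiset.map a' Finset.univ.val) :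
    ∃ τ : (Σ j, Fin (a j)) ≃ Σ j, Fin (a' j), reindex τ τ (jordanMatrix a) = jordanMatrix a' := by
  obtain ⟨σ, hσ⟩ := exists_equiv_of_map_univ_eq h
  let τ : (Σ j, Fin (a j)) ≃ Σ j, Fin (a' j) := Equiv.sigmaCongr σ fun j => finCongr (hσ j).symm
  have hτ x y : jordanMatrix a' (τ x) (τ y) = jordanMatrix a x y := by
    have hfst : (τ x).1 = (τ y).1 ↔ x.1 = y.1 := σ.injective.eq_iff
    have hsnd z : ((τ z).2 : ℕ) = z.2 := rfl
    simp only [jordanMatrix_apply, one_apply, τ.injective.eq_iff, hfst, hsnd]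
  exact ⟨τ, (reindex τ τ).eq_symm_apply.1 (Matrix.ext fun x y => (hτ x y).symm)⟩

theorem exists_hasJordanType (hu : IsUnipotentElt u) : ∃ p : n.Partition, HasJordanType u p := by
  obtain ⟨g, rfl, hg⟩ := hu
  have hnil : IsNilpotent (toLin' g.1 - 1) := by
    have := hg.map (toLinAlgEquiv' (R := ℂ))
    rwa [map_sub, map_one] at this
  obtain ⟨m, a, b, ha, hb⟩ := exists_jordanBasis hnil
  let e : (Σ j, Fin (a j)) ≃ Fin n := b.indexEquiv (Pi.basisFun ℂ (Fin n))
  obtain ⟨P, hP⟩ := exists_reindexConj_toMatrix e b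
  let p : n.Partition :=
    { parts := Multiset.map a Finset.univ.val
      parts_pos := fun hi => by
        obtain ⟨j, -, rfl⟩ := Multiset.mem_map.1 hi
        exact ha j
      parts_sum := by
        have := Fintype.card_congr e
        rwa [Fintype.card_sigma, Fintype.card_fin, Finset.sum_congr rfl fun j _ =>
          Fintype.card_fin (a j)] at this }
  refine ⟨p, m, a, e, P, g, rfl, ?_, rfl⟩
  rw [← hP g.1, toMatrix_eq_jordanMatrix b hb, reindexConj_apply]

theorem isConj_of_hasJordanType (h : HasJordanType u p) (h' : HasJordanType u' p) :
    IsConj u u' := by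
  obtain ⟨m, a, e, P, g, ha, hg, rfl⟩ := h
  obtain ⟨m', a', e', P', g', ha', hg', rfl⟩ := h'
  obtain ⟨τ, hτ⟩ := exists_equiv_reindex_jordanMatrix (ha.trans ha'.symm)
  refine mk.map_isConj (isConj_of_algEquiv (reindexConj e P)
    ((reindexAlgEquiv ℂ ℂ τ).trans (reindexConj e' P')) hg.symm (Eq.trans ?_ hg'.symm))
  rw [AlgEquiv.trans_apply, coe_reindexAlgEquiv, hτ, reindexConj_apply]

theorem HasJordanType.of_isConj (h : HasJordanType u p) (hc : IsConj u u') :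
    HasJordanType u' p := by
  obtain ⟨m, a, e, P, g, ha, hg, rfl⟩ := h
  obtain ⟨c, rfl⟩ := isConj_iff.1 hc
  obtain ⟨c, rfl⟩ := mk_surjective c
  refine ⟨m, a, e, c * P, c * g * c⁻¹, ha, ?_, by simp only [map_mul, map_inv]⟩
  simp only [Units.val_mul, hg, _root_.mul_inv_rev, mul_assoc]

theorem isNilpotent_sub_one_of_map_jordanMatrix_eq {g : GL (Fin n) ℂ} {κ : Type*} [Fintype κ]
    [DecidableEq κ] {a : κ → ℕ}
    (Ψ : Matrix (Σ j, Fin (a j)) (Σ j, Fin (a j)) ℂ ≃ₐ[ℂ] Matrix (Fin n) (Fin n) ℂ)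
    (hΨ : Ψ (jordanMatrix a) = g.1) : IsNilpotent (g.1 - 1) := by
  rw [← hΨ, ← map_one Ψ, ← map_sub]
  exact (isNilpotent_jordanMatrix_sub_one a).map Ψ

theorem HasJordanType.isUnipotentElt (h : HasJordanType u p) : IsUnipotentElt u := by
  obtain ⟨m, a, e, P, g, -, hg, rfl⟩ := h
  exact ⟨g, rfl, isNilpotent_sub_one_of_map_jordanMatrix_eq (reindexConj e P) hg.symm⟩

theorem UnipotentClass.exists_hasJordanType (c : UnipotentClass n)
    (hu : ConjClasses.mk u = c.1) : ∃ p : n.Partition, HasJordanType u p := by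
  obtain ⟨v, hv, hvc⟩ := c.2
  obtain ⟨p, hp⟩ := EllipticPGL.exists_hasJordanType hv
  exact ⟨p, hp.of_isConj (ConjClasses.mk_eq_mk_iff_isConj.1 (hvc.trans hu.symm))⟩

theorem finite_unipotentClass (n : ℕ) : Finite (UnipotentClass n) := by
  choose u hu using fun c : UnipotentClass n => ConjClasses.exists_rep c.1
  choose p hp using fun c : UnipotentClass n => c.exists_hasJordanType (hu c)
  refine Finite.of_injective p fun c c' hcc => Subtype.ext ?_
  rw [← hu c, ← hu c', ConjClasses.mk_eq_mk_iff_isConj]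
  exact isConj_of_hasJordanType (hp c) (hcc ▸ hp c')

theorem neZero_of_map_eq_parts {κ : Type*} [Fintype κ] {a : κ → ℕ}
    (h : Multiset.map a Finset.univ.val = p.parts) (j : κ) : NeZero (a j) :=
  ⟨(p.parts_pos (h ▸ Multiset.mem_map_of_mem a (Finset.mem_univ j))).ne'⟩

end JordanType

/-! ### Elliptic pairs in the reductive part -/

section JordanSplitting

variable {n : ℕ} {κ : Type*} [Fintype κ] [DecidableEq κ] {a : κ → ℕ} [∀ j, NeZero (a j)]
  {g : GL (Fin n) ℂ}

/-- The splitting of the centralizer of a matrix which is conjugate to `jordanMatrix a`. -/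
noncomputable def conjJordanNilSplitting
    (Ψ : Matrix (Σ j, Fin (a j)) (Σ j, Fin (a j)) ℂ ≃ₐ[ℂ] Matrix (Fin n) (Fin n) ℂ)
    (hΨ : Ψ (jordanMatrix a) = g.1) : NilSplitting ℂ (matrixCentralizer g) (blockSubalgebra ℂ a) :=
  (jordanNilSplitting a).congr (centralizerEquiv Ψ hΨ) .refl

end JordanSplitting

section Rectangular

variable {n r i : ℕ} {u : PGL(n, ℂ)} {p : n.Partition} {Γ : Subgroup PGL(n, ℂ)}

theorem exists_isReductivePart [NeZero n] (hu : IsUnipotentElt u) :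
    ∃ Γ : Subgroup PGL(n, ℂ), IsReductivePart u Γ := by
  obtain ⟨p, m, a, e, P, g, ha, hg, rfl⟩ := exists_hasJordanType hu
  have := neZero_of_map_eq_parts ha
  exact ⟨_, (conjJordanNilSplitting (reindexConj e P) hg.symm).isReductivePart_levi
    (isNilpotent_sub_one_of_map_jordanMatrix_eq (reindexConj e P) hg.symm)⟩

theorem eq_replicate_of_ellSub_nonempty [NeZero n] (hu : HasJordanType u p)
    (hΓ : IsReductivePart u Γ) (h : (ellSub Γ).Nonempty) :
    ∃ r i : ℕ, p.parts = Multiset.replicate r i := by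
  obtain ⟨m, a, e, P, g, ha, hg, rfl⟩ := hu
  have := neZero_of_map_eq_parts ha
  have hconst (j l) : a j = a l := by_contra fun hjl => h.ne_empty <|
    (conjJordanNilSplitting (reindexConj e P) hg.symm).ellSub_eq_empty
      (isNilpotent_sub_one_of_map_jordanMatrix_eq (reindexConj e P) hg.symm) hΓ hjl
  rw [← ha]
  rcases isEmpty_or_nonempty (Fin m) with _ | ⟨⟨j⟩⟩
  · exact ⟨0, 0, by simp⟩
  · refine ⟨m, a j, ?_⟩
    rw [Multiset.map_congr rfl fun l _ => hconst l j]
    simp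

theorem mul_eq_of_parts_eq_replicate (h : p.parts = Multiset.replicate r i) : r * i = n := by
  rw [← p.parts_sum, h, Multiset.sum_replicate, smul_eq_mul]

theorem neZero_of_parts_eq_replicate [NeZero n] (h : p.parts = Multiset.replicate r i) :
    NeZero r ∧ NeZero i := by
  have hn : r * i ≠ 0 := mul_eq_of_parts_eq_replicate h ▸ NeZero.ne n
  exact ⟨⟨left_ne_zero_of_mul hn⟩, ⟨right_ne_zero_of_mul hn⟩⟩

theorem coe_diagEmb (e : (Σ _ : Fin r, Fin i) ≃ Fin n) (A : GL (Fin r) ℂ) :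
    (diagEmb ((Equiv.sigmaEquivProd _ _).symm.trans e) A).1 =
      reindex e e (inflation (fun _ => i)
        ((blockSubalgebraEquivOfConst fun _ _ => rfl).symm A.1)) := by
  change reindex _ _ (blockDiagonal fun _ : Fin i => A.1) = _
  ext x y
  simp [blockDiagonal_apply, inflation_apply, blockSubalgebraEquivOfConst, Fin.ext_iff]

theorem exists_mulEquiv_of_parts_eq_replicate [NeZero n] (hu : HasJordanType u p)
    (hΓ : IsReductivePart u Γ) (hp : p.parts = Multiset.replicate r i) :
    ∃ (e : Fin r × Fin i ≃ Fin n) (P : GL (Fin n) ℂ) (φ : PGL(r, ℂ) ≃* Γ),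
      ∀ A : GL (Fin r) ℂ, (φ (mk A) : PGL(n, ℂ)) = mk (P * diagEmb e A * P⁻¹) := by
  obtain ⟨_, _⟩ := neZero_of_parts_eq_replicate hp
  obtain ⟨m, a, e, P, g, ha, hg, rfl⟩ := hu
  rw [hp] at ha
  obtain rfl : m = r := by simpa using congrArg Multiset.card ha
  obtain rfl : a = fun _ => i := funext fun j =>
    Multiset.eq_of_mem_replicate (ha ▸ Multiset.mem_map_of_mem a (Finset.mem_univ j))
  let L := conjJordanNilSplitting (reindexConj e P) hg.symm
  obtain ⟨c, φ, hφ⟩ := L.exists_mulEquiv_of_isReductivePart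
    (isNilpotent_sub_one_of_map_jordanMatrix_eq (reindexConj e P) hg.symm) hΓ fun _ _ => rfl
  let toGL : (matrixCentralizer g)ˣ →* GL (Fin n) ℂ :=
    Units.map ((matrixCentralizer g).val : matrixCentralizer g →* Matrix (Fin n) (Fin n) ℂ)
  let e' : Fin m × Fin i ≃ Fin n := (Equiv.sigmaEquivProd _ _).symm.trans e
  have hemb (A : GL (Fin m) ℂ) : toGL (Units.map ((L.emb.comp
      (blockSubalgebraEquivOfConst fun _ _ => rfl).symm.toAlgHom :
        Matrix (Fin m) (Fin m) ℂ →ₐ[ℂ] _) :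
          Matrix (Fin m) (Fin m) ℂ →* matrixCentralizer g) A) = P * diagEmb e' A * P⁻¹ := by
    refine Units.ext ?_
    rw [Units.val_mul, Units.val_mul, coe_diagEmb]
    rfl
  refine ⟨e', toGL c * P, φ, fun A => ?_⟩
  rw [hφ, centralizerToPGL, MonoidHom.comp_apply, map_mul toGL, map_mul toGL, map_inv toGL, hemb]
  simp only [_root_.mul_inv_rev, mul_assoc]

theorem isStandardUnion_ellSub [NeZero r] (φ : PGL(r, ℂ) ≃* Γ) {ζ : ℂˣ}
    (hζ : IsPrimitiveRoot ζ r) :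
    IsStandardUnion (ellSub Γ) r (φ (Delta r ζ)) (φ (wdot r)) := by
  rw [ellSub, ← image_ellipticPairs φ]
  refine (isStandardUnion_ellipticPairs (fun x hx => ?_) hζ).map φ
  refine isSemisimpleElt_of_pow_eq_one (NeZero.ne r) ?_
  rw [← Subgroup.coe_pow, ← map_pow, hx, map_one, Subgroup.coe_one]

theorem exists_isPrimitiveRoot_units (r : ℕ) [NeZero r] : ∃ ζ : ℂˣ, IsPrimitiveRoot ζ r :=
  have h := Complex.isPrimitiveRoot_exp r (NeZero.ne r)
  ⟨(h.isUnit (NeZero.ne r)).unit, IsPrimitiveRoot.coe_units_iff.1 h⟩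

theorem exists_isStandardUnion_ellSub [NeZero n] (hu : HasJordanType u p)
    (hΓ : IsReductivePart u Γ) (hp : p.parts = Multiset.replicate r i) :
    ∃ s w : Γ, IsStandardUnion (ellSub Γ) r s w := by
  have := (neZero_of_parts_eq_replicate hp).1
  obtain ⟨e, P, φ, -⟩ := exists_mulEquiv_of_parts_eq_replicate hu hΓ hp
  obtain ⟨ζ, hζ⟩ := exists_isPrimitiveRoot_units r
  exact ⟨_, _, isStandardUnion_ellSub φ hζ⟩

theorem IsStandardUnion.nonempty {H : Type*} [Group H] {Y : Set (H × H)} {m : ℕ} {s w : H}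
    (h : IsStandardUnion Y m s w) : Y.Nonempty := by
  rw [h.eq_iUnion]
  exact ⟨_, Set.mem_iUnion.2 ⟨1, MulAction.mem_orbit_self _⟩⟩

theorem ellSub_nonempty_iff [NeZero n] (hu : HasJordanType u p) (hΓ : IsReductivePart u Γ) :
    (ellSub Γ).Nonempty ↔ ∃ r i : ℕ, p.parts = Multiset.replicate r i := by
  refine ⟨eq_replicate_of_ellSub_nonempty hu hΓ, ?_⟩
  rintro ⟨r, i, hp⟩
  obtain ⟨s, w, h⟩ := exists_isStandardUnion_ellSub hu hΓ hp
  exact h.nonempty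

theorem ncard_pairOrbits_ellSub [NeZero n] (hu : HasJordanType u p) (hΓ : IsReductivePart u Γ)
    (hp : p.parts = Multiset.replicate r i) : (pairOrbits (ellSub Γ)).ncard = r.totient := by
  obtain ⟨s, w, h⟩ := exists_isStandardUnion_ellSub hu hΓ hp
  exact h.card_orbits.2

theorem finite_pairOrbits_ellSub [NeZero n] (hu : HasJordanType u p) (hΓ : IsReductivePart u Γ) :
    (pairOrbits (ellSub Γ)).Finite := by
  rcases (ellSub Γ).eq_empty_or_nonempty with h | h
  · rw [h, pairOrbits, Set.image_empty]
    exact Set.finite_empty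
  · obtain ⟨r, i, hp⟩ := eq_replicate_of_ellSub_nonempty hu hΓ h
    obtain ⟨s, w, h⟩ := exists_isStandardUnion_ellSub hu hΓ hp
    exact h.card_orbits.1

end Rectangular

/-! ### The number of orbits -/

section RectangularClass

theorem jordanMatrix_sub_one_pow_apply {κ : Type*} [Fintype κ] [DecidableEq κ] (a : κ → ℕ) (k : ℕ)
    (x y : Σ j, Fin (a j)) : ((jordanMatrix a - 1) ^ k) x y =
      if x.1 = y.1 ∧ (x.2 : ℕ) + k = y.2 then 1 else 0 := by
  induction k generalizing y with
  | zero =>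
    obtain ⟨j, s⟩ := x
    obtain ⟨l, t⟩ := y
    rcases eq_or_ne j l with rfl | hjl
    · simp [one_apply, Fin.ext_iff]
    · simp [one_apply, hjl]
  | succ k ih =>
    obtain ⟨l, t, ht⟩ := y
    rw [pow_succ, mul_sub, mul_one, Matrix.sub_apply, mul_jordanMatrix_apply, add_sub_cancel_left]
    simp only [ih]
    grind

theorem jordanMatrix_sub_one_pow_eq_zero_iff {κ : Type*} [Fintype κ] [DecidableEq κ] (a : κ → ℕ)
    (k : ℕ) : (jordanMatrix a - 1) ^ k = 0 ↔ ∀ j, a j ≤ k := by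
  refine ⟨fun h j => ?_, fun h => Matrix.ext fun x y => ?_⟩
  · by_contra! hk
    have h₁ := jordanMatrix_sub_one_pow_apply a k ⟨j, 0, by omega⟩ ⟨j, k, hk⟩
    rw [h, if_pos ⟨rfl, zero_add k⟩] at h₁
    exact zero_ne_one h₁
  · rw [jordanMatrix_sub_one_pow_apply, Matrix.zero_apply, if_neg]
    rintro ⟨-, hy⟩
    exact absurd (h y.1) (by omega)

variable {n r r' i i' : ℕ} {u : PGL(n, ℂ)} {p p' : n.Partition}

theorem HasJordanType.pow_eq_zero_iff [NeZero n] (hu : HasJordanType u p) {g : GL (Fin n) ℂ}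
    (hgu : mk g = u) (hg : IsNilpotent (g.1 - 1)) (k : ℕ) :
    (g.1 - 1) ^ k = 0 ↔ ∀ b ∈ p.parts, b ≤ k := by
  obtain ⟨m, a, e, P, g', ha, hg', rfl⟩ := hu
  have hΨ : reindexConj e P (jordanMatrix a) = g'.1 := hg'.symm
  rw [eq_of_mk_eq_mk_of_isNilpotent hgu hg (isNilpotent_sub_one_of_map_jordanMatrix_eq _ hΨ),
    ← hΨ, ← map_one (reindexConj e P), ← map_sub, ← map_pow, EmbeddingLike.map_eq_zero_iff,
    jordanMatrix_sub_one_pow_eq_zero_iff, ← ha]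
  simp

theorem HasJordanType.eq_of_parts_eq_replicate [NeZero n] (hu : HasJordanType u p)
    (hu' : HasJordanType u p') (hp : p.parts = Multiset.replicate r i)
    (hp' : p'.parts = Multiset.replicate r' i') : r = r' := by
  obtain ⟨g, hgu, hg⟩ := hu.isUnipotentElt
  obtain ⟨_, _⟩ := neZero_of_parts_eq_replicate hp
  obtain ⟨_, _⟩ := neZero_of_parts_eq_replicate hp'
  have hle (k : ℕ) : i ≤ k ↔ i' ≤ k := by
    have h := (hu.pow_eq_zero_iff hgu hg k).symm.trans (hu'.pow_eq_zero_iff hgu hg k)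
    rw [hp, hp'] at h
    simpa [Multiset.mem_replicate, NeZero.ne] using h
  obtain rfl : i = i' := eq_of_forall_ge_iff hle
  exact Nat.eq_of_mul_eq_mul_right (NeZero.pos i)
    ((mul_eq_of_parts_eq_replicate hp).trans (mul_eq_of_parts_eq_replicate hp').symm)

theorem exists_hasJordanType_replicate [NeZero i] (h : r * i = n) :
    ∃ (u : PGL(n, ℂ)) (p : n.Partition), HasJordanType u p ∧
      p.parts = Multiset.replicate r i := by
  let p : n.Partition :=
    { parts := Multiset.replicate r i
      parts_pos := fun hb => Multiset.eq_of_mem_replicate hb ▸ NeZero.pos i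
      parts_sum := by rw [Multiset.sum_replicate, smul_eq_mul, h] }
  let e : (Σ _ : Fin r, Fin i) ≃ Fin n := Fintype.equivOfCardEq (by simp [h])
  have hunit : IsUnit (reindexConj e 1 (jordanMatrix fun _ => i)) := by
    refine IsUnit.map _ ?_
    simpa using (isNilpotent_jordanMatrix_sub_one fun _ : Fin r => i).isUnit_add_one
  refine ⟨mk hunit.unit, p, ⟨r, fun _ => i, e, 1, hunit.unit, ?_, rfl, rfl⟩, rfl⟩
  simp [p]

/-- The Jordan type of the class `c` consists of `r` equal parts. -/
def UnipotentClass.IsRectangular (c : UnipotentClass n) (r : ℕ) : Prop :=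
  ∃ (u : PGL(n, ℂ)) (p : n.Partition) (i : ℕ),
    ConjClasses.mk u = c.1 ∧ HasJordanType u p ∧ p.parts = Multiset.replicate r i

namespace UnipotentClass

variable {c c' : UnipotentClass n}

theorem IsRectangular.dvd (h : c.IsRectangular r) : r ∣ n := by
  obtain ⟨u, p, i, -, -, hp⟩ := h
  exact ⟨i, (mul_eq_of_parts_eq_replicate hp).symm⟩

theorem IsRectangular.class_unique [NeZero n] (h : c.IsRectangular r) (h' : c'.IsRectangular r) :
    c = c' := by
  obtain ⟨u, p, i, hc, hu, hp⟩ := h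
  obtain ⟨u', p', i', hc', hu', hp'⟩ := h'
  have hr := (neZero_of_parts_eq_replicate hp).1
  have hi : i = i' := Nat.eq_of_mul_eq_mul_left hr.pos
    ((mul_eq_of_parts_eq_replicate hp).trans (mul_eq_of_parts_eq_replicate hp').symm)
  have hpp : p = p' := Nat.Partition.ext (by rw [hp, hp', hi])
  refine Subtype.ext ?_
  rw [← hc, ← hc', ConjClasses.mk_eq_mk_iff_isConj]
  exact isConj_of_hasJordanType hu (hpp ▸ hu')

theorem IsRectangular.card_unique [NeZero n] (h : c.IsRectangular r) (h' : c.IsRectangular r') :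
    r = r' := by
  obtain ⟨u, p, i, hc, hu, hp⟩ := h
  obtain ⟨u', p', i', hc', hu', hp'⟩ := h'
  exact hu.eq_of_parts_eq_replicate
    (hu'.of_isConj (ConjClasses.mk_eq_mk_iff_isConj.1 (hc'.trans hc.symm))) hp hp'

theorem exists_isRectangular [NeZero n] (h : r ∣ n) :
    ∃ c : UnipotentClass n, c.IsRectangular r := by
  obtain ⟨i, hri⟩ := h
  have : NeZero i := ⟨right_ne_zero_of_mul (hri ▸ NeZero.ne n)⟩
  obtain ⟨u, p, hu, hp⟩ := exists_hasJordanType_replicate hri.symm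
  exact ⟨⟨ConjClasses.mk u, u, hu.isUnipotentElt, rfl⟩, u, p, i, rfl, hu, hp⟩

variable [NeZero n] {Γ : Subgroup PGL(n, ℂ)}

theorem exists_isRectangular_of_ellSub_nonempty (hc : ConjClasses.mk u = c.1)
    (hΓ : IsReductivePart u Γ) (h : (ellSub Γ).Nonempty) : ∃ r, c.IsRectangular r := by
  obtain ⟨p, hu⟩ := c.exists_hasJordanType hc
  obtain ⟨r, i, hp⟩ := eq_replicate_of_ellSub_nonempty hu hΓ h
  exact ⟨r, u, p, i, hc, hu, hp⟩

theorem IsRectangular.ncard_pairOrbits_ellSub (h : c.IsRectangular r)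
    (hc : ConjClasses.mk u = c.1) (hΓ : IsReductivePart u Γ) :
    (pairOrbits (ellSub Γ)).ncard = r.totient := by
  obtain ⟨v, p, i, hv, hp, hri⟩ := h
  exact EllipticPGL.ncard_pairOrbits_ellSub
    (hp.of_isConj (ConjClasses.mk_eq_mk_iff_isConj.1 (hv.trans hc.symm))) hΓ hri

end UnipotentClass

theorem finsum_ncard_pairOrbits [NeZero n] (u : UnipotentClass n → PGL(n, ℂ))
    (Γ : UnipotentClass n → Subgroup PGL(n, ℂ)) (hu : ∀ c, ConjClasses.mk (u c) = c.1)
    (hΓ : ∀ c, IsReductivePart (u c) (Γ c)) :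
    ∑ᶠ c, (pairOrbits (ellSub (Γ c))).ncard = n := by
  classical
  choose C hC using fun r : n.divisors =>
    UnipotentClass.exists_isRectangular (Nat.dvd_of_mem_divisors r.2)
  have hinj : Function.Injective C := fun r r' h => Subtype.ext ((hC r).card_unique (h ▸ hC r'))
  have hsupp : (Function.support fun c => (pairOrbits (ellSub (Γ c))).ncard) ⊆
      ((Finset.univ.image C : Finset _) : Set (UnipotentClass n)) := by
    intro c hc
    have hne : (ellSub (Γ c)).Nonempty := by
      refine Set.nonempty_iff_ne_empty.2 fun h => hc ?_
      simp [pairOrbits, h]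
    obtain ⟨r, hr⟩ := c.exists_isRectangular_of_ellSub_nonempty (hu c) (hΓ c) hne
    rw [Finset.coe_image, Finset.coe_univ, Set.image_univ]
    exact ⟨⟨r, Nat.mem_divisors.2 ⟨hr.dvd, NeZero.ne n⟩⟩, (hC _).class_unique hr⟩
  rw [finsum_eq_sum_of_support_subset _ hsupp, Finset.sum_image hinj.injOn,
    Finset.sum_congr rfl fun r _ => (hC r).ncard_pairOrbits_ellSub (hu _) (hΓ _),
    Finset.sum_coe_sort n.divisors Nat.totient, Nat.sum_totient]

end RectangularClass

end EllipticPGL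

theorem propositionp (n : ℕ) (hn : 0 < n) :
    -- elliptic pairs in `PGL_n(ℂ)`
    (∀ ζ : ℂˣ, IsPrimitiveRoot ζ n →
      EllipticPGL.IsStandardUnion (EllipticPGL.ellPGL n) n
        (EllipticPGL.Delta n ζ) (EllipticPGL.wdot n)) ∧
    -- elliptic pairs in `Γ_u`
    (∀ u : PGL(n, ℂ), EllipticPGL.IsUnipotentElt u →
      (∃ p : n.Partition, EllipticPGL.HasJordanType u p) ∧
      (∃ Γ : Subgroup PGL(n, ℂ), EllipticPGL.IsReductivePart u Γ) ∧
      ∀ (p : n.Partition) (Γ : Subgroup PGL(n, ℂ)),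
        EllipticPGL.HasJordanType u p → EllipticPGL.IsReductivePart u Γ →
        ((EllipticPGL.ellSub Γ).Nonempty ↔ ∃ r i : ℕ, p.parts = Multiset.replicate r i) ∧
        ∀ r i : ℕ, p.parts = Multiset.replicate r i →
          ∃ (e : Fin r × Fin i ≃ Fin n) (P : GL (Fin n) ℂ) (φ : PGL(r, ℂ) ≃* Γ),
            (∀ A : GL (Fin r) ℂ, (φ (Matrix.ProjGenLinGroup.mk A) : PGL(n, ℂ)) =
              Matrix.ProjGenLinGroup.mk (P * EllipticPGL.diagEmb e A * P⁻¹)) ∧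
            ∀ ζ : ℂˣ, IsPrimitiveRoot ζ r →
              EllipticPGL.IsStandardUnion (EllipticPGL.ellSub Γ) r
                (φ (EllipticPGL.Delta r ζ)) (φ (EllipticPGL.wdot r))) ∧
    -- the number of orbits of elliptic pairs over all unipotent classes
    (Finite (EllipticPGL.UnipotentClass n) ∧
      ∀ (u : EllipticPGL.UnipotentClass n → PGL(n, ℂ))
        (Γ : EllipticPGL.UnipotentClass n → Subgroup PGL(n, ℂ)),
        (∀ c, ConjClasses.mk (u c) = c.1) →
        (∀ c, EllipticPGL.IsReductivePart (u c) (Γ c)) →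
        (∀ c, (EllipticPGL.pairOrbits (EllipticPGL.ellSub (Γ c))).Finite) ∧
        ∑ᶠ c, (EllipticPGL.pairOrbits (EllipticPGL.ellSub (Γ c))).ncard = n) := by
  have : NeZero n := ⟨hn.ne'⟩
  refine ⟨fun ζ hζ => EllipticPGL.isStandardUnion_ellipticPairs
      (fun x hx => EllipticPGL.isSemisimpleElt_of_pow_eq_one hn.ne' hx) hζ,
    fun u hu => ⟨EllipticPGL.exists_hasJordanType hu, EllipticPGL.exists_isReductivePart hu,
      fun p Γ hp hΓ => ⟨EllipticPGL.ellSub_nonempty_iff hp hΓ, fun r i hri => ?_⟩⟩,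
    EllipticPGL.finite_unipotentClass n, fun u Γ hu hΓ => ⟨fun c => ?_,
      EllipticPGL.finsum_ncard_pairOrbits u Γ hu hΓ⟩⟩
  · have := (EllipticPGL.neZero_of_parts_eq_replicate hri).1
    obtain ⟨e, P, φ, hφ⟩ := EllipticPGL.exists_mulEquiv_of_parts_eq_replicate hp hΓ hri
    exact ⟨e, P, φ, hφ, fun ζ hζ => EllipticPGL.isStandardUnion_ellSub φ hζ⟩
  · obtain ⟨p, hp⟩ := c.exists_hasJordanType (hu c)
    exact EllipticPGL.finite_pairOrbits_ellSub hp (hΓ c)
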